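/- Let $p\in[2,3)$, $T>0$, and write $x_{s,t}=x_t-x_s$. A c\`adl\`ag geometric $p$-rough path over $\mathbb R^d$ is a pair $\mathbf X=(X,\mathbb X)$, $\mathbf X_{s,t}=(X_{s,t},\mathbb X_{s,t})\in\mathbb R^d\oplus\mathbb R^{d\times d}$ for $0\le s\le t\le T$, such that $\mathbb X_{s,t}-\mathbb X_{s,u}-\mathbb X_{u,t}=X_{s,u}\otimes X_{u,t}$ for $s\le u\le t$; $t\mapsto\mathbf X_{0,t}$ is c\`adl\`ag; $X$ has finite $p$-variation and $\mathbb X$ finite $p/2$-variation on $[0,T]$; and $\mathbf X_{s,t}\in G^{(2)}(\mathbb R^d)$, i.e. the symmetric part of $\mathbb X_{s,t}$ is $\tfrac12X_{s,t}\otimes X_{s,t}$. Here $G^{(2)}(\mathbb R^d)$ carries the product $(a,b)\otimes(a',b')=(a+a',\,b+a\otimes a'+b')$, and $\log(a,b)=(a,b-\tfrac12a\otimes a)$ has inverse $\exp(a,b)=(a,b+\tfrac12a\otimes a)$. Let $\Delta_t\mathbf X=(\Delta X_t,\Delta\mathbb X_t)=\lim_{s\uparrow t}\mathbf X_{s,t}$,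 and let $J\subset(0,T]$ be the set of times $t$ with $\Delta_t\mathbf X\ne(0,0)$. Let $f=(f_1,\dots,f_d)$ be $C^2$ vector fields on $\mathbb R^e$, $fa=\sum_ia^if_i$, $f'f\,b=\sum_{i,j}b^{ij}\,Df_j\,f_i$ and $[f,f]\,b=\sum_{i,j}b^{ij}[f_i,f_j]$ with $[f_i,f_j]=Df_jf_i-Df_if_j$. For a vector field $g$, $\phi(g;x)$ denotes the value at time $1$ of the solution of $\dot y=g(y)$, $y(0)=x$. **Canonical equation.** A c\`adl\`ag path $Z:[0,T]\to\mathbb R^e$ solves $dZ_t=f(Z_t)\diamond d\mathbf X_t$ with initial value $Z_0$ if $(Z,f(Z))$ is controlled by $X$ (that is, $Z$ and $f(Z)$ have finite $p$-variation and $Z_{s,t}-f(Z_s)X_{s,t}$ has finite $p/2$-variation) and, for all $t\in[0,T]$, $$Z_t=Z_0+\int_0^tf(Z_{s-})\,d\mathbf X_s+\sum_{0<s\le t}\Big\{\phi\big(f\Delta X_s+\tfrac12[f,f]\Delta\mathbb X_s;Z_{s-}\big)-Z_{s-}-f(Z_{s-})\Delta X_s-f'f(Z_{s-})\Delta\mathbb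 X_s\Big\},$$ where the flows are required to exist up to time $1$, the sum converges absolutely, and the integral is the limit of $\sum_{[s,t]\in\mathcal P}f(Z_s)X_{s,t}+f'f(Z_s)\mathbb X_{s,t}$ under refinement of the partition $\mathcal P$. **Stretching.** Choose $\delta_t>0$ for $t\in J$ with $\sum_{t\in J}\delta_t<\infty$. For $t\in[0,T]$ put $\tau(t)=t+\sum_{s\in J,\,s\le t}\delta_s$, $\tau(t-)=t+\sum_{s\in J,\,s<t}\delta_s$, and let $\tilde T=\tau(T)$. Let $\tilde{\mathbf X}$ be the $G^{(2)}(\mathbb R^d)$-valued path on $[0,\tilde T]$ with $\tilde{\mathbf X}_{0,\tau(t)}=\mathbf X_{0,t}$ for $t\in[0,T]$ and $\tilde{\mathbf X}_{0,\tau(t-)+\theta\delta_t}=\exp\big((1-\theta)\log\mathbf X_{0,t-}+\theta\log\mathbf X_{0,t}\big)$ for $t\in J$, $\theta\in[0,1]$; its increments are $\tilde{\mathbf X}_{s,t}=\tilde{\mathbf X}_{0,s}^{-1}\otimes\tilde{\mathbf X}_{0,t}$. A path $\tilde Z$ on $[0,\tilde T]$ is a time-stretched version of $Z:[0,T]\to\mathbb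 R^e$ if $\tilde Z_{\tau(t)}=Z_t$ for all $t\in[0,T]$ and, for each $t\in J$, $\lim_{s\uparrow t}Z_s$ exists and $\theta\mapsto\tilde Z_{\tau(t-)+\theta\delta_t}$ solves $\dot y=(f\Delta X_t+\tfrac12[f,f]\Delta\mathbb X_t)(y)$ on $[0,1]$ with $y(0)=\lim_{s\uparrow t}Z_s$. **Continuous equation.** A continuous path $\tilde Z$ on $[0,\tilde T]$ solves $d\tilde Z_t=f(\tilde Z_t)\,d\tilde{\mathbf X}_t$ with initial value $Z_0$ if $(\tilde Z,f(\tilde Z))$ is controlled by $\tilde X$ and $\tilde Z_t=Z_0+\int_0^tf(\tilde Z)\,d\tilde{\mathbf X}$ for all $t\in[0,\tilde T]$, the integral being the limit of $\sum_{[u,v]\in\mathcal P}f(\tilde Z_u)\tilde X_{u,v}+f'f(\tilde Z_u)\tilde{\mathbb X}_{u,v}$ as the mesh of $\mathcal P$ tends to $0$. **Theorem.** Fix the initial value $Z_0\in\mathbb R^e$. Then $\tilde{\mathbf X}$ is a continuous geometric $p$-rough path over $[0,\tilde T]$. If $\tilde Z$ is a time-stretched version of $Z$, then $Z$ solves $dZ_t=f(Z_t)\diamond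 d\mathbf X_t$ if and only if $\tilde Z$ solves the continuous RDE $d\tilde Z_t=f(\tilde Z_t)\,d\tilde{\mathbf X}_t$. Moreover, a path has at most one time-stretched version, every solution $Z$ of the canonical equation has one, and every solution $\tilde Z$ of the continuous RDE is the time-stretched version of $t\mapsto\tilde Z_{\tau(t)}$. -/

import Mathlib

open Set Filter Topology

noncomputable section

namespace CadlagRDE

/-! ### The step-2 truncated tensor algebra and the group `G⁽²⁾(ℝᵈ)` -/

/-- `ℝᵈ`. -/
abbrev E (d : ℕ) := EuclideanSpace ℝ (Fin d)

/-- `ℝᵈ ⊗ ℝᵈ = ℝ^{d×d}`, with the Hilbert-Schmidt norm. -/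
abbrev E2 (d : ℕ) := EuclideanSpace ℝ (Fin d × Fin d)

/-- The tensor product `a ⊗ b`, with `(i, j)` entry `aⁱ bʲ`. -/
def tensor {d : ℕ} (a b : E d) : E2 d := WithLp.toLp 2 fun ij => a ij.1 * b ij.2

/-- The pair `(a, b)` stands for `1 + a + b` in `{1} ⊕ ℝᵈ ⊕ ℝ^{d×d}` when it is a group element,
and for `a + b` in `ℝᵈ ⊕ ℝ^{d×d}` when it is a tangent (Lie algebra) element. -/
abbrev T2 (d : ℕ) := E d × E2 d

/-- `(1, a, b) ⊗ (1, a', b') = (1, a + a', b + a ⊗ a' + b')`. -/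
def tmul {d : ℕ} (x y : T2 d) : T2 d := (x.1 + y.1, x.2 + tensor x.1 y.1 + y.2)

/-- The inverse for `tmul`. -/
def tinv {d : ℕ} (x : T2 d) : T2 d := (-x.1, -x.2 + tensor x.1 x.1)

/-- `exp (a + b) = 1 + a + b + (1/2) a ⊗ a`. -/
def texp {d : ℕ} (x : T2 d) : T2 d := (x.1, x.2 + (1 / 2 : ℝ) • tensor x.1 x.1)

/-- `log (1 + a + b) = a + b - (1/2) a ⊗ a`. -/
def tlog {d : ℕ} (x : T2 d) : T2 d := (x.1, x.2 - (1 / 2 : ℝ) • tensor x.1 x.1)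

theorem tmul_tinv {d : ℕ} (x : T2 d) : tmul x (tinv x) = (0, 0) := by
  ext
  · simp [tmul, tinv]
  · simp [tmul, tinv, tensor]; ring

theorem tinv_tmul {d : ℕ} (x : T2 d) : tmul (tinv x) x = (0, 0) := by
  ext <;> simp [tmul, tinv, tensor]

/-- The Lie algebra `𝔤⁽²⁾(ℝᵈ) = ℝᵈ ⊕ 𝔰𝔬(d)`. -/
def g2 (d : ℕ) : Set (T2 d) := {x | ∀ i j, x.2 (i, j) = -x.2 (j, i)}

/-- The group `G⁽²⁾(ℝᵈ) = exp (𝔤⁽²⁾(ℝᵈ))`. -/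
def G2 (d : ℕ) : Set (T2 d) := texp '' g2 d

/-! ### Partitions, variation, Riemann-Stieltjes limits, càdlàg paths -/

/-- `a = u 0 ≤ u 1 ≤ ⋯ ≤ u n = b`. Repeated points are allowed; all germs that are summed below
vanish on one-point intervals, so they do not contribute. -/
def IsPartition (a b : ℝ) (n : ℕ) (u : ℕ → ℝ) : Prop := Monotone u ∧ u 0 = a ∧ u n = b

/-- `∑_{[s,t] ∈ 𝒫} Ξ_{s,t}` for the partition `𝒫` given by `u 0, …, u n`. -/
def partSum {F : Type*} [AddCommMonoid F] (Ξ : ℝ → ℝ → F) (n : ℕ) (u : ℕ → ℝ) : F :=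
  ∑ i ∈ Finset.range n, Ξ (u i) (u (i + 1))

/-- Finite `q`-variation over `[0,T]` of a two-parameter function:
`sup_𝒫 ∑_{[s,t] ∈ 𝒫} |A_{s,t}|^q < ∞`. -/
def FiniteVar {F : Type*} [Norm F] (q T : ℝ) (A : ℝ → ℝ → F) : Prop :=
  ∃ C : ℝ, ∀ n u, IsPartition 0 T n u → partSum (fun s t => ‖A s t‖ ^ q) n u ≤ C

/-- Increments `x_{s,t} = x_t - x_s`. -/
def incr {F : Type*} [Sub F] (x : ℝ → F) (s t : ℝ) : F := x t - x s

/-- Convergence in refinement Riemann-Stieltjes sense of `∑_{[s,t] ∈ 𝒫} Ξ_{s,t}` to `L`, over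
partitions `𝒫` of `[a,b]`. -/
def RRSLim {F : Type*} [NormedAddCommGroup F] (a b : ℝ) (Ξ : ℝ → ℝ → F) (L : F) : Prop :=
  ∀ ε > 0, ∃ P₀ : Finset ℝ, (P₀ : Set ℝ) ⊆ Icc a b ∧
    ∀ n u, IsPartition a b n u → (∀ x ∈ P₀, ∃ i ≤ n, u i = x) → ‖partSum Ξ n u - L‖ < ε

/-- Convergence in mesh Riemann-Stieltjes sense. -/
def MRSLim {F : Type*} [NormedAddCommGroup F] (a b : ℝ) (Ξ : ℝ → ℝ → F) (L : F) : Prop :=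
  ∀ ε > 0, ∃ η > 0,
    ∀ n u, IsPartition a b n u → (∀ i < n, u (i + 1) - u i < η) → ‖partSum Ξ n u - L‖ < ε

/-- `x` is càdlàg on `[0,T]`. Values of `x` outside `[0,T]` play no role. -/
def CadlagOn {F : Type*} [TopologicalSpace F] (T : ℝ) (x : ℝ → F) : Prop :=
  (∀ t ∈ Ico 0 T, ContinuousWithinAt x (Ici t) t) ∧
  ∀ t ∈ Ioc 0 T, ∃ l, Tendsto x (𝓝[<] t) (𝓝 l)

/-! ### Rough paths -/

/-- The data `𝐗 = (X, 𝕏)` of a (level-2) rough path. -/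
structure RoughData (d : ℕ) where
  /-- `X_t` -/
  path : ℝ → E d
  /-- `𝕏_{s,t}` -/
  second : ℝ → ℝ → E2 d

/-- `𝐗_{s,t} = (X_{s,t}, 𝕏_{s,t})`. -/
def RoughData.inc {d : ℕ} (X : RoughData d) (s t : ℝ) : T2 d := (incr X.path s t, X.second s t)

/-- What càdlàg and continuous rough paths have in common: Chen's relation and finite
`p`-variation in the rough path sense, over `[0,T]`. -/
structure IsRough {d : ℕ} (p T : ℝ) (X : RoughData d) : Prop where
  chen : ∀ s u t, 0 ≤ s → s ≤ u → u ≤ t → t ≤ T →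
    X.second s t - X.second s u - X.second u t = tensor (incr X.path s u) (incr X.path u t)
  pvar : FiniteVar p T (incr X.path)
  pvar₂ : FiniteVar (p / 2) T X.second

/-- `𝐗` takes values in `G⁽²⁾(ℝᵈ)`. -/
def IsGeometric {d : ℕ} (T : ℝ) (X : RoughData d) : Prop :=
  ∀ s t, 0 ≤ s → s ≤ t → t ≤ T → X.inc s t ∈ G2 d

/-- Càdlàg geometric `p`-rough paths over `[0,T]`. -/
structure IsCadlagGeometric {d : ℕ} (p T : ℝ) (X : RoughData d) : Prop where
  rough : IsRough p T X
  cadlag : CadlagOn T (X.inc 0)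
  geometric : IsGeometric T X

/-- Continuous geometric `p`-rough paths over `[0,T]`. -/
structure IsContinuousGeometric {d : ℕ} (p T : ℝ) (X : RoughData d) : Prop where
  rough : IsRough p T X
  continuous : ContinuousOn (X.inc 0) (Icc 0 T)
  geometric : IsGeometric T X

/-- The jump `Δ_t 𝐗 = lim_{s ↑ t} 𝐗_{s,t}`; its components are `Δ_t X` and `Δ_t 𝕏`. -/
def RoughData.jump {d : ℕ} (X : RoughData d) (t : ℝ) : T2 d :=
  Function.leftLim (fun s => X.inc s t) t

/-- The set of jump times of `𝐗` in `(0,T]`. -/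
def RoughData.jumpTimes {d : ℕ} (X : RoughData d) (T : ℝ) : Set ℝ :=
  {t | t ∈ Ioc 0 T ∧ X.jump t ≠ (0, 0)}

/-! ### Stretching time: the continuous rough path `𝐗̃` -/

/-- Admissible lengths of the extra time intervals: `δ t > 0` for each jump time `t`, and
`∑_t δ t < ∞`. -/
def IsStretchLength {d : ℕ} (T : ℝ) (X : RoughData d) (δ : ℝ → ℝ) : Prop :=
  (∀ t ∈ X.jumpTimes T, 0 < δ t) ∧ Summable fun t : X.jumpTimes T => δ t

open Classical in
/-- The time change `τ(t) = t + ∑_{jump times s ≤ t} δ s` from `[0,T]` into `[0,T̃]`. -/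
def timeChange {d : ℕ} (T : ℝ) (X : RoughData d) (δ : ℝ → ℝ) (t : ℝ) : ℝ :=
  t + ∑' s : X.jumpTimes T, if (s : ℝ) ≤ t then δ s else 0

open Classical in
/-- `τ(t-) = t + ∑_{jump times s < t} δ s`. The jump at time `t` is traversed over the interval
`[τ(t-), τ(t)]`, of length `δ t`. -/
def timeChangeLeft {d : ℕ} (T : ℝ) (X : RoughData d) (δ : ℝ → ℝ) (t : ℝ) : ℝ :=
  t + ∑' s : X.jumpTimes T, if (s : ℝ) < t then δ s else 0

/-- `T̃ = T + ∑ δ`. -/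
def stretchedLength {d : ℕ} (T : ℝ) (X : RoughData d) (δ : ℝ → ℝ) : ℝ := timeChange T X δ T

/-- The original time `t ∈ [0,T]` of `r ∈ [0,T̃]`, i.e. the one with `τ(t-) ≤ r ≤ τ(t)`. -/
def originalTime {d : ℕ} (T : ℝ) (X : RoughData d) (δ : ℝ → ℝ) (r : ℝ) : ℝ :=
  sInf {t | t ∈ Icc 0 T ∧ r ≤ timeChange T X δ t}

open Classical in
/-- The `G⁽²⁾`-valued path `r ↦ 𝐗̃_{0,r}` on `[0,T̃]`: it equals `𝐗_{0,t}` at `r = τ(t)` and runs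
through the jump at `t` along the log-linear segment
`exp ((1-θ) log 𝐗_{0,t-} + θ log 𝐗_{0,t})`, where `θ = (r - τ(t-)) / δ t`. -/
def stretchedPath {d : ℕ} (T : ℝ) (X : RoughData d) (δ : ℝ → ℝ) (r : ℝ) : T2 d :=
  let t := originalTime T X δ r
  if t ∈ X.jumpTimes T then
    texp (((timeChange T X δ t - r) / δ t) • tlog (Function.leftLim (X.inc 0) t) +
      ((r - timeChangeLeft T X δ t) / δ t) • tlog (X.inc 0 t))
  else X.inc 0 t

/-- The rough path `𝐗̃`, with increments `𝐗̃_{s,t} = 𝐗̃_{0,s}⁻¹ ⊗ 𝐗̃_{0,t}`. -/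
def stretched {d : ℕ} (T : ℝ) (X : RoughData d) (δ : ℝ → ℝ) : RoughData d where
  path r := (stretchedPath T X δ r).1
  second s r := (tmul (tinv (stretchedPath T X δ s)) (stretchedPath T X δ r)).2

/-! ### Rough differential equations -/

/-- The basis vector `e_i`. -/
def basisVec {d : ℕ} (i : Fin d) : E d := EuclideanSpace.single i 1

/-- `(f'f)(z) b = ∑_{i,j} b^{ij} Df_j(z) f_i(z)`, where `f_i(z) = f(z) e_i`. -/
def derivTerm {d e : ℕ} (f : E e → (E d →L[ℝ] E e)) (z : E e) (b : E2 d) : E e :=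
  ∑ i, ∑ j, b (i, j) • (fderiv ℝ f z (f z (basisVec i))) (basisVec j)

/-- The vector field `f a + (1/2) [f, f] b = ∑_i aⁱ f_i + (1/2) ∑_{i,j} b^{ij} [f_i, f_j]`, for
`x = (a, b)`. -/
def jumpField {d e : ℕ} (f : E e → (E d →L[ℝ] E e)) (x : T2 d) (z : E e) : E e :=
  f z x.1 + (1 / 2 : ℝ) • ∑ i, ∑ j, x.2 (i, j) •
    VectorField.lieBracket ℝ (fun w => f w (basisVec i)) (fun w => f w (basisVec j)) z

/-- `φ(g, x) = x'`: there is a solution on `[0,1]` of `ẏ = g(y)`, `y(0) = x`, and its value at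
time `1` is `x'`. -/
def IsTimeOneFlow {e : ℕ} (g : E e → E e) (x x' : E e) : Prop :=
  ∃ y : ℝ → E e, y 0 = x ∧ y 1 = x' ∧
    ∀ θ ∈ Icc (0 : ℝ) 1, HasDerivWithinAt y (g (y θ)) (Icc 0 1) θ

/-- `(Y, Y')` is controlled by `X`: `Y`, `Y'` have finite `p`-variation and
`R_{s,t} = Y_{s,t} - Y'_s X_{s,t}` has finite `p/2`-variation. -/
structure IsControlled {d e : ℕ} (p T : ℝ) (X : RoughData d) (Y : ℝ → E e)
    (Y' : ℝ → (E d →L[ℝ] E e)) : Prop where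
  pvar : FiniteVar p T (incr Y)
  pvar' : FiniteVar p T (incr Y')
  remainder : FiniteVar (p / 2) T fun s t => incr Y s t - Y' s (incr X.path s t)

/-- The summand `f(Z_s) X_{s,t} + (f'f)(Z_s) 𝕏_{s,t}` of the compensated Riemann sums that define
the rough integral `∫ f(Z_{s-}) d𝐗_s` (in the continuous case, `∫ f(Z) d𝐗`). -/
def roughGerm {d e : ℕ} (f : E e → (E d →L[ℝ] E e)) (X : RoughData d) (Z : ℝ → E e)
    (s t : ℝ) : E e :=
  f (Z s) (incr X.path s t) + derivTerm f (Z s) (X.second s t)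

/-- `Z` solves the continuous RDE `dZ = f(Z) d𝐗` on `[0,T]` with `Z_0 = z₀`; the rough integral is
a limit in mesh Riemann-Stieltjes sense. -/
structure SolvesRDE {d e : ℕ} (p T : ℝ) (f : E e → (E d →L[ℝ] E e)) (X : RoughData d)
    (z₀ : E e) (Z : ℝ → E e) : Prop where
  init : Z 0 = z₀
  continuous : ContinuousOn Z (Icc 0 T)
  controlled : IsControlled p T X Z fun t => f (Z t)
  equation : ∀ t ∈ Icc 0 T, MRSLim 0 t (roughGerm f X Z) (Z t - z₀)

/-- `Z` solves the rough canonical equation `dZ = f(Z) ⋄ d𝐗` on `[0,T]` with `Z_0 = z₀`: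
`Z_t = z₀ + ∫_0^t f(Z_{s-}) d𝐗_s + ∑_{0 < s ≤ t} {φ(f ΔX_s + (1/2)[f,f] Δ𝕏_s; Z_{s-}) - Z_{s-}
- f(Z_{s-}) ΔX_s - (f'f)(Z_{s-}) Δ𝕏_s}`; the rough integral is a limit in refinement
Riemann-Stieltjes sense, the sum is absolutely convergent, and it is part of the notion of a
solution that the flows in it exist up to time `1`. -/
structure SolvesCanonical {d e : ℕ} (p T : ℝ) (f : E e → (E d →L[ℝ] E e)) (X : RoughData d)
    (z₀ : E e) (Z : ℝ → E e) : Prop where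
  init : Z 0 = z₀
  cadlag : CadlagOn T Z
  controlled : IsControlled p T X Z fun t => f (Z t)
  equation : ∃ Φ : ℝ → E e,
    (∀ s ∈ Ioc 0 T, IsTimeOneFlow (jumpField f (X.jump s)) (Function.leftLim Z s) (Φ s)) ∧
    ∀ t ∈ Icc 0 T, ∃ I S : E e,
      RRSLim 0 t (roughGerm f X Z) I ∧
      HasSum (fun s : Ioc 0 t => Φ s - Function.leftLim Z s
        - f (Function.leftLim Z s) (X.jump s).1
        - derivTerm f (Function.leftLim Z s) (X.jump s).2) S ∧
      Z t = z₀ + I + S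

/-- `Zt` is the time-stretched version `Z̃` of `Z`: `Z̃_{τ(t)} = Z_t` for all `t ∈ [0,T]`, and on
the extra interval `[τ(t-), τ(t)]` of a jump time `t`, `Z̃` starts from `Z_{t-}` and follows the
flow of `f Δ_t X + (1/2) [f,f] Δ_t 𝕏`, at the speed at which it is traversed in time `δ t`. -/
structure IsTimeStretch {d e : ℕ} (T : ℝ) (f : E e → (E d →L[ℝ] E e)) (X : RoughData d)
    (δ : ℝ → ℝ) (Z Zt : ℝ → E e) : Prop where
  agree : ∀ t ∈ Icc 0 T, Zt (timeChange T X δ t) = Z t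
  start : ∀ t ∈ X.jumpTimes T, Tendsto Z (𝓝[<] t) (𝓝 (Zt (timeChangeLeft T X δ t)))
  flow : ∀ t ∈ X.jumpTimes T, ∀ r ∈ Icc (timeChangeLeft T X δ t) (timeChange T X δ t),
    HasDerivWithinAt Zt ((δ t)⁻¹ • jumpField f (X.jump t) (Zt r))
      (Icc (timeChangeLeft T X δ t) (timeChange T X δ t)) r

end CadlagRDE

end

noncomputable section

namespace CadlagRDE

/-! ### Partitions -/

section Partitions

variable {a b c : ℝ} {n m : ℕ} {u v : ℕ → ℝ}

/-! The proof computes one rough integral on two time scales. Let I be the integral of f(Z̃) against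
X̃ on [0, T̃]. By sewing, I_v - I_u differs from the germ f(Z̃_u) X̃_{u,v} + f'f(Z̃_u) 𝕏̃_{u,v} by a
defect D_{u,v} that is bounded by increments of a monotone function, with an arbitrarily small
factor once v - u is small. The image under τ of a partition of [0, t] cannot cut the jump
intervals. Under refinement, all its steps become short except those that cross one of finitely many
long jump intervals. Hence the sum of D along the partition converges to the sum of D_{τ(s-),τ(s)}
over the jumps (`exists_hasSum_rrsLim`). The germs at the points τ(s) are those of the càdlàg
equation, so the refinement integral over [0, t] equals I_{τ(t)} - I_0 minus the sum of I_{τ(s)} -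
I_{τ(s-)} - f(Z_{s-}) ΔX_s - f'f(Z_{s-}) Δ𝕏_s (`exists_hasSum_rrsLim_integral`). This is the
canonical equation as soon as I moves over each jump interval as the flow does.

On a jump interval X̃ is log-linear, so the rough integral is a Riemann integral, of f'f extended
linearly and applied to the logarithm of the jump (`hasDerivWithinAt_integral_segment`).
Geometricity identifies this integrand with f ΔX + (1/2)[f,f] Δ𝕏 (`jumpField_eq_field`). A solution
of the continuous equation therefore follows the flows, and the canonical equation results.
Conversely, left limits in the canonical equation show that its solution jumps to the endpoint of
the flow (`SolvesCanonical.exists_flow`), so the flows can be glued in. Then I and Z̃ - z₀ agree at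
the points τ(t), because refinement limits are unique, and have equal derivatives on the jump
intervals.

What remains is regularity on [0, T̃]. Variation bounds are encoded by increments of a monotone
function, interpolated linearly across the jumps, and `norm_le_stretchFun` transfers them from [0,
T] and the jump intervals to [0, T̃]. This monotone function may be discontinuous, so the smallness
of D has to come from the oscillation of the continuous paths (`norm_roughGerm_defect_le`). -/

theorem IsPartition.mem_Icc (h : IsPartition a b n u) {i : ℕ} (hi : i ≤ n) : u i ∈ Icc a b :=
  ⟨h.2.1 ▸ h.1 (Nat.zero_le i), h.2.2 ▸ h.1 hi⟩

/-- Concatenation of two partitions, the first one with `n` intervals. -/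
def concat (n : ℕ) (u v : ℕ → ℝ) (i : ℕ) : ℝ := if i ≤ n then u i else v (i - n)

theorem concat_add (h : u n = v 0) (i : ℕ) : concat n u v (n + i) = v i := by
  unfold concat
  split_ifs with hi
  · obtain rfl : i = 0 := by omega
    simpa using h
  · congr 1; omega

theorem concat_of_le {i : ℕ} (h : i ≤ n) : concat n u v i = u i := if_pos h

theorem IsPartition.concat (hu : IsPartition a b n u) (hv : IsPartition b c m v) :
    IsPartition a c (n + m) (concat n u v) := by
  have h : u n = v 0 := hu.2.2.trans hv.2.1.symm
  refine ⟨fun i j hij => ?_, ?_, ?_⟩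
  · rcases le_or_gt j n with hj | hj
    · rw [concat_of_le hj, concat_of_le (hij.trans hj)]
      exact hu.1 hij
    · obtain ⟨j, rfl⟩ := Nat.exists_eq_add_of_lt hj
      rw [show n + j + 1 = n + (j + 1) by ring, concat_add h]
      rcases le_or_gt i n with hi | hi
      · rw [concat_of_le hi]
        exact (hu.1 hi).trans (h.le.trans (hv.1 (Nat.zero_le _)))
      · obtain ⟨i, rfl⟩ := Nat.exists_eq_add_of_lt hi
        rw [show n + i + 1 = n + (i + 1) by ring, concat_add h]
        exact hv.1 (by omega)
  · rw [concat_of_le (Nat.zero_le n), hu.2.1]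
  · rw [concat_add h, hv.2.2]

theorem partSum_concat {F : Type*} [AddCommMonoid F] (Ξ : ℝ → ℝ → F) (h : u n = v 0) :
    partSum Ξ (n + m) (concat n u v) = partSum Ξ n u + partSum Ξ m v := by
  unfold partSum
  rw [Finset.sum_range_add]
  congr 1
  · refine Finset.sum_congr rfl fun i hi => ?_
    have := Finset.mem_range.1 hi
    rw [concat_of_le this.le, concat_of_le (by omega)]
  · refine Finset.sum_congr rfl fun i _ => ?_
    rw [concat_add h, add_assoc, concat_add h]

theorem concat_step {r : ℝ} (h : u n = v 0) (hu : ∀ i < n, u (i + 1) - u i < r)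
    (hv : ∀ i < m, v (i + 1) - v i < r) :
    ∀ i < n + m, concat n u v (i + 1) - concat n u v i < r := by
  intro i hi
  rcases lt_or_ge i n with hn | hn
  · rw [concat_of_le hn.le, concat_of_le (by omega)]
    exact hu i hn
  · obtain ⟨i, rfl⟩ := Nat.exists_eq_add_of_le hn
    rw [concat_add h, add_assoc, concat_add h]
    exact hv i (by omega)

/-- The partition of `[a, b]` into a single interval. -/
def single (a b : ℝ) (i : ℕ) : ℝ := if i = 0 then a else b

theorem isPartition_single (h : a ≤ b) : IsPartition a b 1 (single a b) := by
  refine ⟨fun i j hij => ?_, rfl, rfl⟩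
  unfold single
  split_ifs with hi hj
  · exact le_rfl
  · exact h
  · omega
  · exact le_rfl

@[simp] theorem partSum_single {F : Type*} [AddCommMonoid F] (Ξ : ℝ → ℝ → F) :
    partSum Ξ 1 (single a b) = Ξ a b := by
  simp [partSum, single]

theorem exists_fine_partition (h : a ≤ b) {r : ℝ} (hr : 0 < r) :
    ∃ n u, IsPartition a b n u ∧ ∀ i < n, u (i + 1) - u i < r := by
  obtain ⟨n, hn⟩ := exists_nat_gt ((b - a) / r)
  have hn0 : (0 : ℝ) < n := lt_of_le_of_lt (div_nonneg (sub_nonneg.2 h) hr.le) hn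
  refine ⟨n, fun i => a + (min i n : ℕ) * ((b - a) / n), ⟨fun i j hij => ?_, by simp, ?_⟩, ?_⟩
  · have : ((min i n : ℕ) : ℝ) ≤ (min j n : ℕ) := by exact_mod_cast min_le_min_right n hij
    have := mul_le_mul_of_nonneg_right this (div_nonneg (sub_nonneg.2 h) hn0.le)
    simpa using this
  · simp only [min_self]
    field_simp
    ring
  · intro i hi
    have h1 : min (i + 1) n = i + 1 := by omega
    have h2 : min i n = i := by omega
    simp only [h1, h2]
    push_cast
    have : (b - a) / n < r := by
      rw [div_lt_iff₀ hr] at hn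
      rw [div_lt_iff₀ hn0]; linarith
    linarith

/-- Strictness of the enumeration lets an order between points be read as an order between indices,
which `refines_of_sorted` needs. -/
theorem exists_sorted_partition (S : Finset ℝ) (hS : (S : Set ℝ) ⊆ Icc a b) (ha : a ∈ S)
    (hb : b ∈ S) :
    ∃ N w, IsPartition a b N w ∧ StrictMonoOn w (Iic N) ∧ ∀ x ∈ S, ∃ i ≤ N, w i = x := by
  obtain ⟨N, hN⟩ : ∃ N, S.card = N + 1 :=
    Nat.exists_eq_succ_of_ne_zero (Finset.card_ne_zero_of_mem ha)
  have hsur : ∀ x ∈ S, ∃ i : Fin (N + 1), S.orderEmbOfFin hN i = x := by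
    intro x hx
    have : x ∈ Set.range (S.orderEmbOfFin hN) := by
      rw [Finset.range_orderEmbOfFin]; exact hx
    exact this
  have hmem : ∀ i, S.orderEmbOfFin hN i ∈ Icc a b := fun i =>
    hS (Finset.orderEmbOfFin_mem S hN i)
  refine ⟨N, fun i => S.orderEmbOfFin hN ⟨min i N, by omega⟩, ⟨?_, ?_, ?_⟩, ?_, ?_⟩
  · intro i j hij
    refine (S.orderEmbOfFin hN).monotone ?_
    simp only [Fin.mk_le_mk]
    omega
  · refine le_antisymm ?_ (hmem _).1
    obtain ⟨i, hi⟩ := hsur a ha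
    rw [← hi]
    refine (S.orderEmbOfFin hN).monotone ?_
    simp
  · refine le_antisymm (hmem _).2 ?_
    obtain ⟨i, hi⟩ := hsur b hb
    rw [← hi]
    refine (S.orderEmbOfFin hN).monotone ?_
    simp only [Fin.le_def]
    omega
  · intro i hi j hj hij
    refine (S.orderEmbOfFin hN).strictMono ?_
    simp only [mem_Iic] at hi hj
    simp only [Fin.mk_lt_mk]
    omega
  · intro x hx
    obtain ⟨i, hi⟩ := hsur x hx
    have h : (⟨min i N, by omega⟩ : Fin (N + 1)) = i := Fin.ext (min_eq_left (by omega))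
    exact ⟨i, by omega, by simp only [h, hi]⟩

theorem exists_partition_of_finset (h : a ≤ b) (S : Finset ℝ) (hS : (S : Set ℝ) ⊆ Icc a b) :
    ∃ n u, IsPartition a b n u ∧ ∀ x ∈ S, ∃ i ≤ n, u i = x := by
  classical
  obtain ⟨N, w, hw, -, hw'⟩ := exists_sorted_partition (a := a) (b := b) (insert a (insert b S))
    (by
      intro x hx
      simp only [Finset.coe_insert, mem_insert_iff, Finset.mem_coe] at hx
      rcases hx with rfl | rfl | hx
      exacts [left_mem_Icc.2 h, right_mem_Icc.2 h, hS hx]) (by simp) (by simp)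
  exact ⟨N, w, hw, fun x hx => hw' x (by simp [hx])⟩

/-- `w` (with `N` intervals) is a refinement of `u` (with `n` intervals). -/
def Refines (N : ℕ) (w : ℕ → ℝ) (n : ℕ) (u : ℕ → ℝ) : Prop :=
  ∃ k : ℕ → ℕ, Monotone k ∧ k 0 = 0 ∧ k n = N ∧ ∀ i ≤ n, w (k i) = u i

theorem refines_of_sorted {N : ℕ} {w : ℕ → ℝ} (hw : IsPartition a b N w)
    (hm : StrictMonoOn w (Iic N)) (hu : IsPartition a b n u)
    (h : ∀ i ≤ n, ∃ j ≤ N, w j = u i) : Refines N w n u := by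
  choose! k hk hk' using h
  -- The chosen index `k i` is meaningful only for `i ≤ n`; clamping makes the map monotone on all
  -- of `ℕ`.
  refine ⟨fun i => k (min i n), fun i j hij => ?_, ?_, ?_, fun i hi => ?_⟩
  · have h1 := hk' (min i n) (min_le_right _ _)
    have h2 := hk' (min j n) (min_le_right _ _)
    refine (hm.le_iff_le (hk _ (min_le_right _ _)) (hk _ (min_le_right _ _))).1 ?_
    rw [h1, h2]
    exact hu.1 (by omega)
  · refine hm.injOn (hk _ (min_le_right _ _)) (Nat.zero_le N) ?_
    rw [hk' _ (min_le_right _ _), hw.2.1]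
    simpa using hu.2.1
  · refine hm.injOn (hk _ (min_le_right _ _)) (le_refl N) ?_
    rw [hk' _ (min_le_right _ _), hw.2.2]
    simpa using hu.2.2
  · simp only [min_eq_left hi]
    exact hk' i hi

theorem exists_common_refinement (hu : IsPartition a b n u) (hv : IsPartition a b m v) :
    ∃ N w, IsPartition a b N w ∧ Refines N w n u ∧ Refines N w m v := by
  classical
  obtain ⟨N, w, hw, hm, hs⟩ := exists_sorted_partition (a := a) (b := b)
    ((Finset.range (n + 1)).image u ∪ (Finset.range (m + 1)).image v)
    (by
      intro x hx
      simp only [Finset.coe_union, Finset.coe_image, mem_union, mem_image, Finset.coe_range,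
        mem_Iio] at hx
      rcases hx with ⟨i, hi, rfl⟩ | ⟨i, hi, rfl⟩
      · exact hu.mem_Icc (by omega)
      · exact hv.mem_Icc (by omega))
    (Finset.mem_union_left _ (Finset.mem_image.2 ⟨0, by simp, hu.2.1⟩))
    (Finset.mem_union_left _ (Finset.mem_image.2 ⟨n, by simp, hu.2.2⟩))
  refine ⟨N, w, hw, refines_of_sorted hw hm hu fun i hi => hs _ ?_,
    refines_of_sorted hw hm hv fun i hi => hs _ ?_⟩
  · exact Finset.mem_union_left _ (Finset.mem_image.2 ⟨i, by simp; omega, rfl⟩)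
  · exact Finset.mem_union_right _ (Finset.mem_image.2 ⟨i, by simp; omega, rfl⟩)

theorem partSum_eq_sum_blocks {F : Type*} [AddCommMonoid F] (Ξ : ℝ → ℝ → F) (w : ℕ → ℝ)
    {k : ℕ → ℕ} (hk : Monotone k) (h0 : k 0 = 0) (n : ℕ) :
    partSum Ξ (k n) w =
      ∑ i ∈ Finset.range n, partSum Ξ (k (i + 1) - k i) (fun j => w (k i + j)) := by
  induction n with
  | zero => simp [partSum, h0]
  | succ n ih =>
    rw [Finset.sum_range_succ, ← ih]
    obtain ⟨l, hl⟩ := Nat.exists_eq_add_of_le (hk (Nat.le_succ n))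
    simp only [Nat.succ_eq_add_one] at hl
    simp only [hl, partSum, Finset.sum_range_add, Nat.add_sub_cancel_left, add_assoc]

theorem IsPartition.block {w : ℕ → ℝ} (hw : Monotone w) {i j : ℕ} (hij : i ≤ j) :
    IsPartition (w i) (w j) (j - i) (fun l => w (i + l)) :=
  ⟨fun _ _ h => hw (by omega), rfl, by simp only; congr 1; omega⟩

theorem sum_increments_le {F : ℝ → ℝ} (hu : IsPartition a b n u) :
    ∑ i ∈ Finset.range n, (F (u (i + 1)) - F (u i)) = F b - F a := by
  rw [Finset.sum_range_sub (fun i => F (u i)), hu.2.1, hu.2.2]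

end Partitions

/-! ### Finite variation and monotone functions -/

/-- The function is F(t), the supremum of the variation sums over partitions of [0, t]. Appending
the interval [s, t] to a partition of [0, s] shows that F gains at least ‖A s t‖^q from s to t. -/
theorem FiniteVar.exists_monotone {V : Type*} [SeminormedAddCommGroup V] {q T : ℝ}
    {A : ℝ → ℝ → V} (h : FiniteVar q T A) :
    ∃ F : ℝ → ℝ, Monotone F ∧ ∀ s t, 0 ≤ s → s ≤ t → t ≤ T → ‖A s t‖ ^ q ≤ F t - F s := by
  obtain ⟨C, hC⟩ := h
  set S : ℝ → Set ℝ := fun t => {x | ∃ n u, IsPartition 0 t n u ∧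
    x = partSum (fun s t => ‖A s t‖ ^ q) n u} with hS
  have hpos : ∀ n u, 0 ≤ partSum (fun s t => ‖A s t‖ ^ q) n u := fun n u =>
    Finset.sum_nonneg fun i _ => Real.rpow_nonneg (norm_nonneg _) _
  have key : ∀ s t, s ≤ t → ∀ n u, IsPartition 0 s n u →
      ∃ m v, IsPartition 0 t m v ∧ partSum (fun s t => ‖A s t‖ ^ q) m v =
        partSum (fun s t => ‖A s t‖ ^ q) n u + ‖A s t‖ ^ q := by
    intro s t hst n u hu
    refine ⟨_, _, hu.concat (isPartition_single hst), ?_⟩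
    rw [partSum_concat _ (hu.2.2.trans rfl), partSum_single]
  have hbdd : ∀ t ≤ T, BddAbove (S t) := by
    rintro t ht
    refine ⟨C, ?_⟩
    rintro x ⟨n, u, hu, rfl⟩
    obtain ⟨m, v, hv, e⟩ := key t T ht n u hu
    have := hC m v hv
    have h2 : 0 ≤ ‖A t T‖ ^ q := Real.rpow_nonneg (norm_nonneg _) _
    linarith
  have main : ∀ s t, 0 ≤ s → s ≤ t → t ≤ T → ‖A s t‖ ^ q ≤ sSup (S t) - sSup (S s) := by
    intro s t h0 hst ht
    have hne : (S s).Nonempty := ⟨_, 1, single 0 s, isPartition_single h0, rfl⟩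
    have : sSup (S s) ≤ sSup (S t) - ‖A s t‖ ^ q := by
      refine csSup_le hne ?_
      rintro x ⟨n, u, hu, rfl⟩
      obtain ⟨m, v, hv, e⟩ := key s t hst n u hu
      have := le_csSup (hbdd t ht) ⟨m, v, hv, rfl⟩
      linarith
    linarith
  rcases lt_or_ge T 0 with hT | hT
  · exact ⟨fun _ => 0, monotone_const, fun s t h1 h2 h3 => by linarith⟩
  -- Clamping time to [0, T] gives monotonicity on the whole line, while the supremum is controlled
  -- only there.
  refine ⟨fun t => sSup (S (max 0 (min t T))), fun s t hst => ?_, fun s t h1 h2 h3 => ?_⟩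
  · have := main (max 0 (min s T)) (max 0 (min t T)) (le_max_left _ _)
      (max_le_max le_rfl (min_le_min hst le_rfl)) (max_le hT (min_le_right _ _))
    have h2 : 0 ≤ ‖A (max 0 (min s T)) (max 0 (min t T))‖ ^ q :=
      Real.rpow_nonneg (norm_nonneg _) _
    simp only
    linarith
  · simp only [min_eq_left h3, min_eq_left (h2.trans h3), max_eq_right h1,
      max_eq_right (h1.trans h2)]
    exact main s t h1 h2 h3

theorem FiniteVar.exists_monotone_norm_le {V : Type*} [SeminormedAddCommGroup V] {q T : ℝ}
    (hq : 0 < q) {A : ℝ → ℝ → V} (h : FiniteVar q T A) :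
    ∃ F : ℝ → ℝ, Monotone F ∧
      ∀ s t, 0 ≤ s → s ≤ t → t ≤ T → ‖A s t‖ ≤ (F t - F s) ^ q⁻¹ := by
  obtain ⟨F, hF, h⟩ := h.exists_monotone
  refine ⟨F, hF, fun s t h1 h2 h3 => ?_⟩
  have := Real.rpow_le_rpow (Real.rpow_nonneg (norm_nonneg _) _) (h s t h1 h2 h3)
    (inv_nonneg.2 hq.le)
  rwa [Real.rpow_rpow_inv (norm_nonneg _) hq.ne'] at this

theorem finiteVar_of_norm_le {V : Type*} [SeminormedAddCommGroup V] {q T C : ℝ}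
    (hq : 0 < q) {A : ℝ → ℝ → V} {F : ℝ → ℝ} (hC : 0 ≤ C) (hF : MonotoneOn F (Icc 0 T))
    (h : ∀ s t, 0 ≤ s → s ≤ t → t ≤ T → ‖A s t‖ ≤ C * (F t - F s) ^ q⁻¹) :
    FiniteVar q T A := by
  refine ⟨C ^ q * (F T - F 0), fun n u hu => ?_⟩
  rw [← sum_increments_le hu, Finset.mul_sum]
  refine Finset.sum_le_sum fun i hi => ?_
  have hi := Finset.mem_range.1 hi
  have m1 := hu.mem_Icc hi.le
  have m2 := hu.mem_Icc (i := i + 1) hi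
  have hd : 0 ≤ F (u (i + 1)) - F (u i) := sub_nonneg.2 (hF m1 m2 (hu.1 (Nat.le_succ i)))
  have := Real.rpow_le_rpow (norm_nonneg _) (h _ _ m1.1 (hu.1 (Nat.le_succ i)) m2.2) hq.le
  rwa [Real.mul_rpow hC (Real.rpow_nonneg hd _), Real.rpow_inv_rpow hd hq.ne'] at this

/-! ### The sewing bound -/

/-- Induction on the number of intervals. One removes an interval such that the blocks to its left
and right each carry at most half of the increment x of F. With constant C for shorter partitions,
the blocks cost 2 C K (x/2)^θ = 2^(1-θ) C K x^θ, and inserting the two endpoints of the removed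
interval costs 2 K x^θ. No continuity of F is needed. -/
theorem sewing_sum_le {V : Type*} [NormedAddCommGroup V] {a b K θ : ℝ} {Ξ : ℝ → ℝ → V}
    {F : ℝ → ℝ} (hF : Monotone F) (hK : 0 ≤ K) (hθ : 1 < θ)
    (h : ∀ s u t, a ≤ s → s ≤ u → u ≤ t → t ≤ b →
      ‖Ξ s t - Ξ s u - Ξ u t‖ ≤ K * (F t - F s) ^ θ)
    {n : ℕ} {u : ℕ → ℝ} (hu : IsPartition a b n u) :
    ‖partSum Ξ n u - Ξ a b‖ ≤ 2 / (1 - 2 ^ (1 - θ)) * K * (F b - F a) ^ θ := by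
  set C : ℝ := 2 / (1 - 2 ^ (1 - θ)) with hC
  have h2 : (2 : ℝ) ^ (1 - θ) < 1 := Real.rpow_lt_one_of_one_lt_of_neg one_lt_two (by linarith)
  have hC0 : 0 ≤ C := div_nonneg two_pos.le (by linarith)
  -- The constant is the fixed point of this recursion, which exists because θ > 1.
  have hCe : 2 + 2 ^ (1 - θ) * C = C := by
    have : C * (1 - 2 ^ (1 - θ)) = 2 := div_mul_cancel₀ _ (by linarith)
    linarith
  have hself : ∀ s ∈ Icc a b, Ξ s s = 0 := by
    intro s hs
    have := h s s s hs.1 le_rfl le_rfl hs.2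
    rw [sub_self, sub_self, Real.zero_rpow (by linarith), mul_zero, zero_sub, norm_neg] at this
    exact norm_le_zero_iff.1 this
  have key : ∀ l i j : ℕ, i ≤ j → j ≤ n → j - i ≤ l →
      ‖∑ k ∈ Finset.Ico i j, Ξ (u k) (u (k + 1)) - Ξ (u i) (u j)‖
        ≤ C * K * (F (u j) - F (u i)) ^ θ := by
    intro l
    induction l with
    | zero =>
      intro i j hij hj hl
      obtain rfl : i = j := by omega
      rw [Finset.Ico_self, Finset.sum_empty, hself _ (hu.mem_Icc hj), sub_self, sub_self, norm_zero,
        Real.zero_rpow (by linarith), mul_zero]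
    | succ l ih =>
      intro i j hij hj hl
      rcases hij.eq_or_lt with rfl | hij
      · rw [Finset.Ico_self, Finset.sum_empty, hself _ (hu.mem_Icc hj), sub_self, sub_self,
          norm_zero, Real.zero_rpow (by linarith), mul_zero]
      have hmono : ∀ {k m : ℕ}, k ≤ m → F (u k) ≤ F (u m) := fun hkm => hF (hu.1 hkm)
      set x := F (u j) - F (u i) with hx
      have hx0 : 0 ≤ x := sub_nonneg.2 (hmono hij.le)
      obtain ⟨k, hik, hkj, hk1, hk2⟩ : ∃ k, i ≤ k ∧ k < j ∧ F (u k) - F (u i) ≤ x / 2 ∧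
          F (u j) - F (u (k + 1)) ≤ x / 2 := by
        classical
        -- For the last `k < j` with at most half of the increment on its left, either the block to
        -- the right of `k + 1` is empty, or the left of `k + 1` already carries more than half.
        let P : ℕ → Prop := fun k => i ≤ k ∧ F (u k) - F (u i) ≤ x / 2
        have hPi : P i := ⟨le_rfl, by simpa using by linarith⟩
        have hspec : P (Nat.findGreatest P (j - 1)) :=
          Nat.findGreatest_spec (by omega : i ≤ j - 1) hPi
        have hle := Nat.findGreatest_le (P := P) (j - 1)
        refine ⟨_, hspec.1, by omega, hspec.2, ?_⟩
        rcases hle.eq_or_lt with he | hlt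
        · rw [he, Nat.sub_add_cancel (by omega), sub_self]
          linarith
        · have := Nat.findGreatest_is_greatest (P := P) (Nat.lt_succ_self _)
            (by omega : Nat.findGreatest P (j - 1) + 1 ≤ j - 1)
          simp only [P, not_and, not_le] at this
          have := this (hspec.1.trans (Nat.le_succ _))
          simp only [Nat.succ_eq_add_one, P] at *
          linarith
      have e : ∑ m ∈ Finset.Ico i j, Ξ (u m) (u (m + 1)) - Ξ (u i) (u j) =
          (∑ m ∈ Finset.Ico i k, Ξ (u m) (u (m + 1)) - Ξ (u i) (u k)) +
          (∑ m ∈ Finset.Ico (k + 1) j, Ξ (u m) (u (m + 1)) - Ξ (u (k + 1)) (u j)) -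
          ((Ξ (u i) (u j) - Ξ (u i) (u k) - Ξ (u k) (u j)) +
           (Ξ (u k) (u j) - Ξ (u k) (u (k + 1)) - Ξ (u (k + 1)) (u j))) := by
        rw [← Finset.sum_Ico_consecutive _ hik hkj.le, Finset.sum_eq_sum_Ico_succ_bot hkj]
        abel
      have m0 := hu.mem_Icc (hij.le.trans hj)
      have m1 := hu.mem_Icc hj
      have b1 := ih i k hik (by omega) (by omega)
      have b2 := ih (k + 1) j hkj hj (by omega)
      have b3 := h _ _ _ m0.1 (hu.1 hik) (hu.1 hkj.le) m1.2
      have b4 := h _ _ _ (hu.mem_Icc (i := k) (by omega)).1 (hu.1 (Nat.le_succ k)) (hu.1 hkj) m1.2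
      have b1' : (F (u k) - F (u i)) ^ θ ≤ (x / 2) ^ θ :=
        Real.rpow_le_rpow (sub_nonneg.2 (hmono hik)) hk1 (by linarith)
      have b2' : (F (u j) - F (u (k + 1))) ^ θ ≤ (x / 2) ^ θ :=
        Real.rpow_le_rpow (sub_nonneg.2 (hmono hkj)) hk2 (by linarith)
      have b4' : (F (u j) - F (u k)) ^ θ ≤ x ^ θ :=
        Real.rpow_le_rpow (sub_nonneg.2 (hmono hkj.le)) (by have := hmono hik; linarith)
          (by linarith)
      have hxe : 2 * (x / 2) ^ θ = 2 ^ (1 - θ) * x ^ θ := by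
        rw [Real.div_rpow hx0 two_pos.le, Real.rpow_sub two_pos, Real.rpow_one]
        ring
      have hCK : 0 ≤ C * K := mul_nonneg hC0 hK
      rw [e]
      calc _ ≤ _ + _ + (_ + _) := (norm_sub_le _ _).trans (add_le_add (norm_add_le _ _)
            (norm_add_le _ _))
        _ ≤ C * K * (x / 2) ^ θ + C * K * (x / 2) ^ θ + (K * x ^ θ + K * x ^ θ) :=
            add_le_add (add_le_add (b1.trans (mul_le_mul_of_nonneg_left b1' hCK))
              (b2.trans (mul_le_mul_of_nonneg_left b2' hCK)))
              (add_le_add b3 (b4.trans (mul_le_mul_of_nonneg_left b4' hK)))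
        _ = C * K * (2 * (x / 2) ^ θ) + 2 * K * x ^ θ := by ring
        _ = (2 + 2 ^ (1 - θ) * C) * K * x ^ θ := by rw [hxe]; ring
        _ = C * K * x ^ θ := by rw [hCe]
  have := key n 0 n (Nat.zero_le _) le_rfl (by omega)
  rwa [hu.2.1, hu.2.2, ← Finset.range_eq_Ico] at this

/-- The germ `Ξ` is almost additive on `[0, T]`, uniformly with respect to the increments of `F`. -/
structure Sewable {V : Type*} [NormedAddCommGroup V] (T : ℝ) (Ξ : ℝ → ℝ → V) (F : ℝ → ℝ) :
    Prop where
  mono : Monotone F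
  bound : ∃ C, 0 ≤ C ∧ ∀ s t, 0 ≤ s → s ≤ t → t ≤ T → ∀ n u, IsPartition s t n u →
    ‖partSum Ξ n u - Ξ s t‖ ≤ C * (F t - F s)
  small : ∀ κ > 0, ∃ ρ > 0, ∀ s t, 0 ≤ s → s ≤ t → t ≤ T → t - s < ρ →
    ∀ n u, IsPartition s t n u → ‖partSum Ξ n u - Ξ s t‖ ≤ κ * (F t - F s)

/-! ### Mesh and refinement limits of almost additive germs -/

section Limits

variable {V : Type*} [NormedAddCommGroup V] {T a b c : ℝ} {Ξ : ℝ → ℝ → V} {F : ℝ → ℝ}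

theorem MRSLim.sub (hab : a ≤ b) {I J : V} (hI : MRSLim a b Ξ I) (hJ : MRSLim a c Ξ J) :
    MRSLim b c Ξ (J - I) := by
  intro ε hε
  obtain ⟨η, hη, h1⟩ := hI (ε / 2) (half_pos hε)
  obtain ⟨η', hη', h2⟩ := hJ (ε / 2) (half_pos hε)
  obtain ⟨m, v, hv, hs⟩ := exists_fine_partition hab (lt_min hη hη')
  refine ⟨η', hη', fun n u hu hus => ?_⟩
  have e : v m = u 0 := hv.2.2.trans hu.2.1.symm
  have h1 := h1 m v hv fun i hi => (hs i hi).trans_le (min_le_left _ _)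
  have h2 := h2 _ _ (hv.concat hu)
    (concat_step e (fun i hi => (hs i hi).trans_le (min_le_right _ _)) hus)
  rw [partSum_concat _ e] at h2
  rw [show partSum Ξ n u - (J - I) = (partSum Ξ m v + partSum Ξ n u - J) -
    (partSum Ξ m v - I) by abel]
  exact (norm_sub_le _ _).trans_lt (by linarith)

theorem MRSLim.norm_sub_le_of_fine (hab : a ≤ b) {I : V} (hI : MRSLim a b Ξ I) {x : V} {C η : ℝ}
    (hη : 0 < η) (h : ∀ n u, IsPartition a b n u → (∀ i < n, u (i + 1) - u i < η) →
      ‖partSum Ξ n u - x‖ ≤ C) : ‖I - x‖ ≤ C := by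
  refine le_of_forall_pos_le_add fun ε hε => ?_
  obtain ⟨η', hη', h1⟩ := hI ε hε
  obtain ⟨n, u, hu, hs⟩ := exists_fine_partition hab (lt_min hη hη')
  have h1 := h1 n u hu fun i hi => (hs i hi).trans_le (min_le_right _ _)
  have h2 := h n u hu fun i hi => (hs i hi).trans_le (min_le_left _ _)
  rw [show I - x = (partSum Ξ n u - x) - (partSum Ξ n u - I) by abel]
  exact (norm_sub_le _ _).trans (add_le_add h2 h1.le)

theorem MRSLim.norm_sub_le (hab : a ≤ b) {I : V} (hI : MRSLim a b Ξ I) {x : V} {C : ℝ}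
    (h : ∀ n u, IsPartition a b n u → ‖partSum Ξ n u - x‖ ≤ C) : ‖I - x‖ ≤ C :=
  hI.norm_sub_le_of_fine hab zero_lt_one fun n u hu _ => h n u hu

theorem RRSLim.unique (hab : a ≤ b) {I J : V} (hI : RRSLim a b Ξ I) (hJ : RRSLim a b Ξ J) :
    I = J := by
  classical
  refine eq_of_forall_dist_le fun ε hε => ?_
  obtain ⟨P, hP, h1⟩ := hI (ε / 2) (half_pos hε)
  obtain ⟨Q, hQ, h2⟩ := hJ (ε / 2) (half_pos hε)
  obtain ⟨n, u, hu, hs⟩ := exists_partition_of_finset hab (P ∪ Q)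
    (by rw [Finset.coe_union]; exact union_subset hP hQ)
  have h1 := h1 n u hu fun x hx => hs x (Finset.mem_union_left _ hx)
  have h2 := h2 n u hu fun x hx => hs x (Finset.mem_union_right _ hx)
  rw [dist_eq_norm]
  rw [show I - J = (partSum Ξ n u - J) - (partSum Ξ n u - I) by abel]
  exact (norm_sub_le _ _).trans (by linarith)

/-- The increments over short intervals `[s, t]` of a refinement Riemann-Stieltjes integral are
approximated by the germ. -/
theorem RRSLim.exists_near_left {t : ℝ} (ht : 0 < t) {I : V} (hI : RRSLim 0 t Ξ I) {ε : ℝ}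
    (hε : 0 < ε) :
    ∃ s₀ ∈ Ico 0 t, ∀ s ∈ Ioo s₀ t, ∀ J, RRSLim 0 s Ξ J → ‖I - J - Ξ s t‖ ≤ ε := by
  classical
  obtain ⟨P, hP, h1⟩ := hI (ε / 2) (half_pos hε)
  -- `s₀` is the last point of `P` before `t`, or 0. For `s` beyond it, a partition of [0, s]
  -- through these points, followed by the single interval [s, t], still passes through all of `P`.
  obtain ⟨s₀, hs₀, hmax⟩ : ∃ s₀ ∈ Ico 0 t, ∀ x ∈ P, x < t → x ≤ s₀ := by
    have hne : (insert 0 (P.filter (· < t))).Nonempty := ⟨0, by simp⟩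
    refine ⟨(insert 0 (P.filter (· < t))).max' hne, ?_, fun x hx hxt => ?_⟩
    · have := Finset.max'_mem _ hne
      rw [Finset.mem_insert, Finset.mem_filter] at this
      rcases this with h | h
      · rw [h]; exact ⟨le_rfl, ht⟩
      · exact ⟨(hP h.1).1, h.2⟩
    · exact Finset.le_max' _ _ (by simp [hx, hxt])
  refine ⟨s₀, hs₀, fun s hs J hJ => ?_⟩
  obtain ⟨Q, hQ, h2⟩ := hJ (ε / 2) (half_pos hε)
  have hs0 : 0 ≤ s := hs₀.1.trans hs.1.le
  obtain ⟨n, u, hu, hu'⟩ := exists_partition_of_finset hs0 (Q ∪ P.filter (· < t)) (by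
    intro x hx
    simp only [Finset.coe_union, Finset.coe_filter, mem_union, Finset.mem_coe, mem_ofPred_eq] at hx
    rcases hx with hx | hx
    · exact hQ hx
    · exact ⟨(hP hx.1).1, (hmax x hx.1 hx.2).trans hs.1.le⟩)
  have e : u n = single s t 0 := hu.2.2
  have h2 := h2 n u hu fun x hx => hu' x (Finset.mem_union_left _ hx)
  have h1 := h1 _ _ (hu.concat (isPartition_single hs.2.le)) fun x hx => by
    rcases (hP hx).2.lt_or_eq with hxt | rfl
    · obtain ⟨i, hi, hi'⟩ := hu' x (Finset.mem_union_right _ (Finset.mem_filter.2 ⟨hx, hxt⟩))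
      exact ⟨i, hi.trans (Nat.le_succ n), by rw [concat_of_le hi, hi']⟩
    · exact ⟨n + 1, le_rfl, by rw [concat_add e]; rfl⟩
  rw [partSum_concat _ e, partSum_single] at h1
  rw [show I - J - Ξ s t = (partSum Ξ n u - J) - (partSum Ξ n u + Ξ s t - I) by abel]
  exact (norm_sub_le _ _).trans (by linarith)

/-- The finer sum splits into one block per interval of the coarser partition, and the block errors,
being increments of F, telescope. -/
theorem norm_partSum_refinement_sub_le {n N : ℕ} {u w : ℕ → ℝ} (hu : IsPartition a b n u)
    (hw : Monotone w) (h : Refines N w n u) {κ : ℝ}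
    (hb : ∀ i < n, ∀ m v, IsPartition (u i) (u (i + 1)) m v →
      ‖partSum Ξ m v - Ξ (u i) (u (i + 1))‖ ≤ κ * (F (u (i + 1)) - F (u i))) :
    ‖partSum Ξ N w - partSum Ξ n u‖ ≤ κ * (F b - F a) := by
  obtain ⟨k, hk, k0, kn, hkw⟩ := h
  rw [← kn, partSum_eq_sum_blocks Ξ w hk k0 n, partSum, ← Finset.sum_sub_distrib,
    ← sum_increments_le hu, Finset.mul_sum]
  refine norm_sum_le_of_le _ fun i hi => ?_
  have hi := Finset.mem_range.1 hi
  refine hb i hi _ _ ?_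
  rw [← hkw i hi.le, ← hkw (i + 1) hi]
  exact IsPartition.block hw (hk (Nat.le_succ i))

/-- Both partitions are compared with a common refinement; each comparison costs at most κ/2. The
mesh bound does not depend on the endpoint `r`. -/
theorem Sewable.exists_uniform_mesh (h : Sewable T Ξ F) {κ : ℝ} (hκ : 0 < κ) :
    ∃ ρ > 0, ∀ r ∈ Icc 0 T, ∀ n u m v, IsPartition 0 r n u → IsPartition 0 r m v →
      (∀ i < n, u (i + 1) - u i < ρ) → (∀ i < m, v (i + 1) - v i < ρ) →
      ‖partSum Ξ n u - partSum Ξ m v‖ ≤ κ := by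
  have hF : 0 ≤ |F T - F 0| := abs_nonneg _
  set κ' := κ / (2 * (|F T - F 0| + 1)) with hκ'
  have hκ'0 : 0 < κ' := by positivity
  obtain ⟨ρ, hρ, hs⟩ := h.small κ' hκ'0
  have bd : ∀ r ∈ Icc 0 T, κ' * (F r - F 0) ≤ κ / 2 := by
    intro r hr
    have h1 : F r - F 0 ≤ |F T - F 0| + 1 := by
      have := le_abs_self (F T - F 0)
      have := h.mono hr.2
      linarith
    calc _ ≤ κ' * (|F T - F 0| + 1) := mul_le_mul_of_nonneg_left h1 hκ'0.le
      _ = κ / 2 := by rw [hκ']; field_simp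
  refine ⟨ρ, hρ, fun r hr n u m v hu hv hus hvs => ?_⟩
  obtain ⟨N, w, hw, r1, r2⟩ := exists_common_refinement hu hv
  have b1 := norm_partSum_refinement_sub_le (F := F) hu hw.1 r1 (κ := κ') fun i hi =>
    hs _ _ (hu.mem_Icc hi.le).1 (hu.1 (Nat.le_succ i)) ((hu.mem_Icc (i := i + 1) hi).2.trans hr.2)
      (hus i hi)
  have b2 := norm_partSum_refinement_sub_le (F := F) hv hw.1 r2 (κ := κ') fun i hi =>
    hs _ _ (hv.mem_Icc hi.le).1 (hv.1 (Nat.le_succ i)) ((hv.mem_Icc (i := i + 1) hi).2.trans hr.2)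
      (hvs i hi)
  rw [show partSum Ξ n u - partSum Ξ m v = (partSum Ξ N w - partSum Ξ m v) -
    (partSum Ξ N w - partSum Ξ n u) by abel]
  refine (norm_sub_le _ _).trans ?_
  have := bd r hr
  linarith

theorem Sewable.exists_integral [CompleteSpace V] (h : Sewable T Ξ F) :
    ∃ I : ℝ → V, ∀ r ∈ Icc 0 T, MRSLim 0 r Ξ (I r) := by
  suffices H : ∀ r ∈ Icc 0 T, ∃ I : V, MRSLim 0 r Ξ I by
    choose! I hI using H
    exact ⟨I, hI⟩
  intro r hr
  have hp : ∀ k : ℕ, ∃ n u, IsPartition 0 r n u ∧ ∀ i < n, u (i + 1) - u i < 1 / ((k : ℝ) + 1) :=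
    fun k => exists_fine_partition hr.1 Nat.one_div_pos_of_nat
  choose n u hu hus using hp
  have hmesh : ∀ ρ > 0, ∃ K, ∀ k ≥ K, ∀ i < n k, u k (i + 1) - u k i < ρ := by
    intro ρ hρ
    obtain ⟨K, hK⟩ := exists_nat_one_div_lt hρ
    refine ⟨K, fun k hk i hi => (hus k i hi).trans_le (le_trans ?_ hK.le)⟩
    exact Nat.one_div_le_one_div hk
  have hc : CauchySeq fun k => partSum Ξ (n k) (u k) := by
    refine Metric.cauchySeq_iff.2 fun ε hε => ?_
    obtain ⟨ρ, hρ, hb⟩ := h.exists_uniform_mesh (half_pos hε)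
    obtain ⟨K, hK⟩ := hmesh ρ hρ
    refine ⟨K, fun k hk l hl => ?_⟩
    rw [dist_eq_norm]
    exact (hb r hr _ _ _ _ (hu k) (hu l) (hK k hk) (hK l hl)).trans_lt (half_lt_self hε)
  obtain ⟨I, hI⟩ := cauchySeq_tendsto_of_complete hc
  refine ⟨I, fun ε hε => ?_⟩
  obtain ⟨ρ, hρ, hb⟩ := h.exists_uniform_mesh (half_pos hε)
  obtain ⟨K, hK⟩ := hmesh ρ hρ
  refine ⟨ρ, hρ, fun m v hv hvs => lt_of_le_of_lt ?_ (half_lt_self hε)⟩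
  refine le_of_tendsto (tendsto_const_nhds.sub hI).norm ?_
  filter_upwards [eventually_ge_atTop K] with k hk
  exact hb r hr _ _ _ _ hv (hu k) hvs (hK k hk)

theorem Sewable.integral_bound (h : Sewable T Ξ F) {I : ℝ → V}
    (hI : ∀ r ∈ Icc 0 T, MRSLim 0 r Ξ (I r)) :
    ∃ C, 0 ≤ C ∧ ∀ s t, 0 ≤ s → s ≤ t → t ≤ T → ‖I t - I s - Ξ s t‖ ≤ C * (F t - F s) := by
  obtain ⟨C, hC, hb⟩ := h.bound
  exact ⟨C, hC, fun s t h1 h2 h3 => ((hI s ⟨h1, h2.trans h3⟩).sub h1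
    (hI t ⟨h1.trans h2, h3⟩)).norm_sub_le h2 (hb s t h1 h2 h3)⟩

theorem Sewable.integral_small (h : Sewable T Ξ F) {I : ℝ → V}
    (hI : ∀ r ∈ Icc 0 T, MRSLim 0 r Ξ (I r)) {κ : ℝ} (hκ : 0 < κ) :
    ∃ ρ > 0, ∀ s t, 0 ≤ s → s ≤ t → t ≤ T → t - s < ρ →
      ‖I t - I s - Ξ s t‖ ≤ κ * (F t - F s) := by
  obtain ⟨ρ, hρ, hb⟩ := h.small κ hκ
  exact ⟨ρ, hρ, fun s t h1 h2 h3 h4 => ((hI s ⟨h1, h2.trans h3⟩).sub h1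
    (hI t ⟨h1.trans h2, h3⟩)).norm_sub_le h2 (hb s t h1 h2 h3 h4)⟩

end Limits

/-! ### Algebra in the truncated tensor algebra -/

section Algebra

variable {d : ℕ}

@[simp] theorem tensor_apply (a b : E d) (ij : Fin d × Fin d) :
    tensor a b ij = a ij.1 * b ij.2 := rfl

theorem norm_tensor (a b : E d) : ‖tensor a b‖ = ‖a‖ * ‖b‖ := by
  rw [EuclideanSpace.norm_eq, EuclideanSpace.norm_eq, EuclideanSpace.norm_eq,
    ← Real.sqrt_mul (Finset.sum_nonneg fun i _ => sq_nonneg _)]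
  congr 1
  rw [Finset.sum_mul_sum, Fintype.sum_prod_type]
  simp [mul_pow]

theorem continuous_tensor : Continuous fun x : E d × E d => tensor x.1 x.2 := by
  unfold tensor
  fun_prop

@[fun_prop] theorem Continuous.tensor {α : Type*} [TopologicalSpace α] {g h : α → E d}
    (hg : Continuous g) (hh : Continuous h) : Continuous fun x => tensor (g x) (h x) :=
  continuous_tensor.comp (hg.prodMk hh)

theorem continuous_tmul : Continuous fun x : T2 d × T2 d => tmul x.1 x.2 := by
  unfold tmul; fun_prop

theorem continuous_tinv : Continuous (tinv : T2 d → T2 d) := by unfold tinv; fun_prop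

theorem continuous_texp : Continuous (texp : T2 d → T2 d) := by unfold texp; fun_prop

theorem continuous_tlog : Continuous (tlog : T2 d → T2 d) := by unfold tlog; fun_prop

@[simp] theorem texp_tlog (x : T2 d) : texp (tlog x) = x := by
  ext <;> simp [texp, tlog]

@[simp] theorem tlog_texp (x : T2 d) : tlog (texp x) = x := by
  ext <;> simp [texp, tlog]

@[simp] theorem tlog_zero : tlog (0 : T2 d) = 0 := by
  ext <;> simp [tlog]

/-- Antisymmetry of the second level of the logarithm, written as polynomial equations; closedness
and stability under products and inverses can be read off from them. -/
theorem mem_G2_iff (x : T2 d) : x ∈ G2 d ↔ ∀ i j, x.2 (i, j) + x.2 (j, i) = x.1 i * x.1 j := by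
  have : x ∈ G2 d ↔ tlog x ∈ g2 d :=
    ⟨by rintro ⟨y, hy, rfl⟩; rwa [tlog_texp], fun h => ⟨_, h, texp_tlog x⟩⟩
  rw [this]
  refine forall₂_congr fun i j => ?_
  simp only [tlog, PiLp.sub_apply, PiLp.smul_apply, tensor_apply, smul_eq_mul]
  constructor <;> intro h <;> linarith [mul_comm (x.1 i) (x.1 j)]

theorem texp_mem_G2 {x : T2 d} (hx : x ∈ g2 d) : texp x ∈ G2 d := ⟨x, hx, rfl⟩

theorem tlog_mem_g2 {x : T2 d} (hx : x ∈ G2 d) : tlog x ∈ g2 d := by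
  obtain ⟨y, hy, rfl⟩ := hx
  rwa [tlog_texp]

theorem isClosed_G2 : IsClosed (G2 d) := by
  have : G2 d = ⋂ i, ⋂ j, {x | x.2 (i, j) + x.2 (j, i) = x.1 i * x.1 j} := by
    ext x; simp [mem_G2_iff]
  rw [this]
  refine isClosed_iInter fun i => isClosed_iInter fun j => isClosed_eq ?_ ?_ <;> fun_prop

theorem tmul_mem_G2 {x y : T2 d} (hx : x ∈ G2 d) (hy : y ∈ G2 d) : tmul x y ∈ G2 d := by
  rw [mem_G2_iff] at *
  intro i j
  have := hx i j
  have := hy i j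
  simp only [tmul, PiLp.add_apply, tensor_apply]
  linarith

theorem tinv_mem_G2 {x : T2 d} (hx : x ∈ G2 d) : tinv x ∈ G2 d := by
  rw [mem_G2_iff] at *
  intro i j
  have := hx i j
  simp only [tinv, PiLp.add_apply, PiLp.neg_apply, tensor_apply]
  linarith [mul_comm (x.1 i) (x.1 j)]

theorem g2_add_smul {x y : T2 d} (hx : x ∈ g2 d) (hy : y ∈ g2 d) (r s : ℝ) :
    r • x + s • y ∈ g2 d := by
  intro i j
  have := hx i j
  have := hy i j
  simp only [Prod.snd_add, Prod.smul_snd, PiLp.add_apply, PiLp.smul_apply, smul_eq_mul] at *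
  rw [hx i j, hy i j]
  ring

theorem tmul_assoc (x y z : T2 d) : tmul (tmul x y) z = tmul x (tmul y z) := by
  ext
  · simp [tmul]; ring
  · simp [tmul]; ring

@[simp] theorem tmul_zero (x : T2 d) : tmul x 0 = x := by ext <;> simp [tmul]

@[simp] theorem zero_tmul (x : T2 d) : tmul 0 x = x := by ext <;> simp [tmul]

theorem tinv_tmul_self (x : T2 d) : tmul (tinv x) x = 0 := tinv_tmul x

/-- Log-linear interpolation in the group is log-linear seen from any of its points. -/
theorem tinv_tmul_interpolate (a h : T2 d) (s t : ℝ) :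
    tmul (tinv (texp (a + s • h))) (texp (a + t • h)) =
      texp ((t - s) • tlog (tmul (tinv (texp a)) (texp (a + h)))) := by
  ext
  · simp [tmul, tinv, texp, tlog]; ring
  · simp [tmul, tinv, texp, tlog]; ring

end Algebra

/-! ### The vector fields attached to a rough increment -/

section Field

variable {d e : ℕ}

/-- The `(i, j)` coefficient of `derivTerm`: `Df_j f_i`. -/
def derivCoeff (f : E e → (E d →L[ℝ] E e)) (i j : Fin d) (z : E e) : E e :=
  (fderiv ℝ f z (f z (basisVec i))) (basisVec j)

/-- The vector field `f a + (f'f) b` at `z`, as a function of `(a, b)`. -/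
def field (f : E e → (E d →L[ℝ] E e)) (z : E e) : T2 d →L[ℝ] E e :=
  (f z).comp (ContinuousLinearMap.fst ℝ (E d) (E2 d)) +
    (∑ i, ∑ j, (EuclideanSpace.proj (i, j) : E2 d →L[ℝ] ℝ).smulRight (derivCoeff f i j z)).comp
      (ContinuousLinearMap.snd ℝ (E d) (E2 d))

theorem field_apply (f : E e → (E d →L[ℝ] E e)) (z : E e) (x : T2 d) :
    field f z x = f z x.1 + derivTerm f z x.2 := by
  simp [field, derivTerm, derivCoeff]

theorem roughGerm_eq_field (f : E e → (E d →L[ℝ] E e)) (X : RoughData d) (Z : ℝ → E e)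
    (s t : ℝ) : roughGerm f X Z s t = field f (Z s) (X.inc s t) := by
  rw [field_apply]; rfl

theorem vec_eq_sum (a : E d) : a = ∑ i, a i • basisVec i := by
  ext k
  simp [basisVec, Pi.single_apply]

/-- This makes the cross term of Chen's relation cancel the first-order Taylor term of f along the
path. -/
theorem derivTerm_tensor (f : E e → (E d →L[ℝ] E e)) (z : E e) (a b : E d) :
    derivTerm f z (tensor a b) = (fderiv ℝ f z (f z a)) b := by
  conv_rhs => rw [vec_eq_sum a, vec_eq_sum b]
  simp only [derivTerm, tensor_apply, map_sum, map_smul, sum_apply,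
    smul_apply, Finset.smul_sum, smul_smul]
  rw [Finset.sum_comm]
  simp only [mul_comm]

theorem derivTerm_eq_field (f : E e → (E d →L[ℝ] E e)) (z : E e) (b : E2 d) :
    derivTerm f z b = field f z (0, b) := by
  rw [field_apply]; simp

/-- The bracket sum only sees the antisymmetric part of the second level b. Since b^{ij} + b^{ji} =
a^i a^j in the group, (1/2)(b^{ij} - b^{ji}) = b^{ij} - (1/2) a^i a^j, which is the second level of
the logarithm. Through this identity geometricity enters the equation. -/
theorem jumpField_eq_field {f : E e → (E d →L[ℝ] E e)} (hf : ContDiff ℝ 2 f) {x : T2 d}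
    (hx : x ∈ G2 d) (z : E e) : jumpField f x z = field f z (tlog x) := by
  have hd : Differentiable ℝ f := hf.differentiable (by norm_num)
  have hfd : ∀ i, fderiv ℝ (fun w => f w (basisVec i)) z =
      ((fderiv ℝ f z).flip (basisVec i)) := by
    intro i
    ext v
    have := ((hd z).hasFDerivAt.clm_apply (hasFDerivAt_const (basisVec i : E d) z)).fderiv
    rw [this]
    simp
  have hb : ∀ i j, VectorField.lieBracket ℝ (fun w => f w (basisVec i))
      (fun w => f w (basisVec j)) z = derivCoeff f i j z - derivCoeff f j i z := by
    intro i j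
    rw [VectorField.lieBracket, hfd, hfd]
    rfl
  rw [field_apply, jumpField]
  congr 1
  simp only [hb, smul_sub, Finset.sum_sub_distrib]
  rw [Finset.sum_comm (f := fun i j => x.2 (i, j) • derivCoeff f j i z),
    ← smul_sub, ← Finset.sum_sub_distrib, Finset.smul_sum, derivTerm]
  refine Finset.sum_congr rfl fun i _ => ?_
  rw [← Finset.sum_sub_distrib, Finset.smul_sum]
  refine Finset.sum_congr rfl fun j _ => ?_
  rw [← sub_smul, smul_smul]
  change _ = _ • derivCoeff f i j z
  congr 1
  have := (mem_G2_iff x).1 hx i j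
  simp only [tlog, PiLp.sub_apply, PiLp.smul_apply, tensor_apply, smul_eq_mul]
  linarith

theorem contDiff_derivCoeff {f : E e → (E d →L[ℝ] E e)} (hf : ContDiff ℝ 2 f) (i j : Fin d) :
    ContDiff ℝ 1 (derivCoeff f i j) := by
  have h1 : ContDiff ℝ 1 (fderiv ℝ f) := hf.fderiv_right (by norm_num)
  have h2 : ContDiff ℝ 1 f := hf.of_le (by norm_num)
  exact (h1.clm_apply (h2.clm_apply contDiff_const)).clm_apply contDiff_const

theorem contDiff_field {f : E e → (E d →L[ℝ] E e)} (hf : ContDiff ℝ 2 f) :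
    ContDiff ℝ 1 (field f) := by
  have h2 : ContDiff ℝ 1 f := hf.of_le (by norm_num)
  unfold field
  refine (h2.clm_comp contDiff_const).add (ContDiff.clm_comp ?_ contDiff_const)
  refine ContDiff.sum fun i _ => ContDiff.sum fun j _ => ?_
  exact contDiff_const.smulRight (contDiff_derivCoeff hf i j)

/-- Local bounds on a ball for the coefficients of the equation. -/
structure FieldBounds (f : E e → (E d →L[ℝ] E e)) (ρ L : ℝ) : Prop where
  pos : 0 ≤ L
  lip : ∀ z ∈ Metric.closedBall (0 : E e) ρ, ∀ w ∈ Metric.closedBall (0 : E e) ρ,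
    ‖f w - f z‖ ≤ L * ‖w - z‖
  norm_fderiv : ∀ z ∈ Metric.closedBall (0 : E e) ρ, ‖fderiv ℝ f z‖ ≤ L
  taylor : ∀ z ∈ Metric.closedBall (0 : E e) ρ, ∀ w ∈ Metric.closedBall (0 : E e) ρ,
    ‖f w - f z - fderiv ℝ f z (w - z)‖ ≤ L * ‖w - z‖ ^ 2
  norm_field : ∀ z ∈ Metric.closedBall (0 : E e) ρ, ‖field f z‖ ≤ L
  field_lip : ∀ z ∈ Metric.closedBall (0 : E e) ρ, ∀ w ∈ Metric.closedBall (0 : E e) ρ,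
    ‖field f w - field f z‖ ≤ L * ‖w - z‖

theorem exists_lipschitz_closedBall {V : Type*} [NormedAddCommGroup V] [NormedSpace ℝ V]
    {g : E e → V} (hg : ContDiff ℝ 1 g) (ρ : ℝ) :
    ∃ L, 0 ≤ L ∧ ∀ z ∈ Metric.closedBall (0 : E e) ρ, ∀ w ∈ Metric.closedBall (0 : E e) ρ,
      ‖g w - g z‖ ≤ L * ‖w - z‖ := by
  obtain ⟨K, hK⟩ := hg.contDiffOn.exists_lipschitzOnWith (s := Metric.closedBall (0 : E e) ρ)
    one_ne_zero (convex_closedBall _ _) (isCompact_closedBall _ _)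
  exact ⟨K, K.2, fun z hz w hw => by simpa [dist_eq_norm] using hK.dist_le_mul w hw z hz⟩

theorem exists_bound_closedBall {V : Type*} [NormedAddCommGroup V]
    {g : E e → V} (hg : Continuous g) (ρ : ℝ) :
    ∃ L, ∀ z ∈ Metric.closedBall (0 : E e) ρ, ‖g z‖ ≤ L :=
  (isCompact_closedBall _ _).exists_bound_of_continuousOn hg.continuousOn

theorem exists_fieldBounds {f : E e → (E d →L[ℝ] E e)} (hf : ContDiff ℝ 2 f) (ρ : ℝ) :
    ∃ L, FieldBounds f ρ L := by
  have h1 : ContDiff ℝ 1 (fderiv ℝ f) := hf.fderiv_right (by norm_num)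
  have h2 : ContDiff ℝ 1 f := hf.of_le (by norm_num)
  obtain ⟨L1, p1, b1⟩ := exists_lipschitz_closedBall h2 ρ
  obtain ⟨L2, p2, b2⟩ := exists_lipschitz_closedBall h1 ρ
  obtain ⟨L3, p3, b3⟩ := exists_lipschitz_closedBall (contDiff_field hf) ρ
  obtain ⟨L4, b4⟩ := exists_bound_closedBall h1.continuous ρ
  obtain ⟨L5, b5⟩ := exists_bound_closedBall (contDiff_field hf).continuous ρ
  have q4 := le_abs_self L4
  have q5 := le_abs_self L5
  have r4 := abs_nonneg L4
  have r5 := abs_nonneg L5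
  set L := L1 + L2 + L3 + |L4| + |L5| with hL
  have hle : ∀ {c x y : ℝ}, 0 ≤ y → c ≤ L → x ≤ c * y → x ≤ L * y := fun hy hc h =>
    h.trans (mul_le_mul_of_nonneg_right hc hy)
  refine ⟨L, by positivity, fun z hz w hw => hle (norm_nonneg _) (by linarith) (b1 z hz w hw),
    fun z hz => (b4 z hz).trans (by linarith), fun z hz w hw => ?_,
    fun z hz => (b5 z hz).trans (by linarith),
    fun z hz w hw => hle (norm_nonneg _) (by linarith) (b3 z hz w hw)⟩
  have hseg : segment ℝ z w ⊆ Metric.closedBall (0 : E e) ρ :=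
    (convex_closedBall _ _).segment_subset hz hw
  have hd : Differentiable ℝ f := hf.differentiable (by norm_num)
  -- Along the segment the derivative stays within `L2 * ‖w - z‖` of its value at `z`, so the mean
  -- value inequality gives the quadratic Taylor bound.
  have := (convex_segment (𝕜 := ℝ) z w).norm_image_sub_le_of_norm_hasFDerivWithin_le'
    (f := f) (φ := fderiv ℝ f z) (C := L2 * ‖w - z‖)
    (fun x _ => (hd x).hasFDerivAt.hasFDerivWithinAt)
    (fun x hx => (b2 z hz x (hseg hx)).trans (mul_le_mul_of_nonneg_left
      (by
        obtain ⟨θ, hθ, rfl⟩ := (segment_eq_image' ℝ z w ▸ hx)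
        simp only [add_sub_cancel_left, norm_smul, Real.norm_of_nonneg hθ.1]
        exact mul_le_of_le_one_left (norm_nonneg _) hθ.2) p2))
    (left_mem_segment ℝ z w) (right_mem_segment ℝ z w)
  refine hle (sq_nonneg _) (by linarith : L2 ≤ L) (this.trans_eq (by ring))

end Field

/-! ### Variation bounds and sewing for the rough integral germ -/

section GermBound

variable {d e : ℕ}

/-- A common bound for the variation of the two levels of a rough path. -/
structure RoughBound (p T : ℝ) (X : RoughData d) (F : ℝ → ℝ) : Prop where
  mono : Monotone F
  path : ∀ s t, 0 ≤ s → s ≤ t → t ≤ T → ‖incr X.path s t‖ ≤ (F t - F s) ^ p⁻¹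
  second : ∀ s t, 0 ≤ s → s ≤ t → t ≤ T → ‖X.second s t‖ ≤ ((F t - F s) ^ p⁻¹) ^ 2

/-- A common bound for the variation of a controlled path and of its remainder. -/
structure ControlBound (p T : ℝ) (f : E e → (E d →L[ℝ] E e)) (X : RoughData d) (Z : ℝ → E e)
    (F : ℝ → ℝ) : Prop where
  mono : Monotone F
  path : ∀ s t, 0 ≤ s → s ≤ t → t ≤ T → ‖incr Z s t‖ ≤ (F t - F s) ^ p⁻¹
  remainder : ∀ s t, 0 ≤ s → s ≤ t → t ≤ T →
    ‖incr Z s t - f (Z s) (incr X.path s t)‖ ≤ ((F t - F s) ^ p⁻¹) ^ 2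

theorem rpow_inv_half {x p : ℝ} (hx : 0 ≤ x) : x ^ (p / 2)⁻¹ = (x ^ p⁻¹) ^ 2 := by
  rw [← Real.rpow_natCast, ← Real.rpow_mul hx]
  congr 1
  push_cast
  rw [inv_div]
  ring

theorem rpow_increment_mono {p : ℝ} (hp : 0 ≤ p) {F G : ℝ → ℝ} {s t : ℝ} (hF : F s ≤ F t)
    (h : F t - F s ≤ G t - G s) : (F t - F s) ^ p⁻¹ ≤ (G t - G s) ^ p⁻¹ :=
  Real.rpow_le_rpow (sub_nonneg.2 hF) h (inv_nonneg.2 hp)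

theorem RoughBound.of_le {p T : ℝ} {X : RoughData d} {F G : ℝ → ℝ} (hp : 0 ≤ p)
    (h : RoughBound p T X F) (hG : Monotone G)
    (hFG : ∀ s t, s ≤ t → F t - F s ≤ G t - G s) : RoughBound p T X G := by
  have key : ∀ s t, s ≤ t → (F t - F s) ^ p⁻¹ ≤ (G t - G s) ^ p⁻¹ := fun s t hst =>
    rpow_increment_mono hp (h.mono hst) (hFG s t hst)
  exact ⟨hG, fun s t h1 h2 h3 => (h.path s t h1 h2 h3).trans (key s t h2),
    fun s t h1 h2 h3 => (h.second s t h1 h2 h3).trans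
      (pow_le_pow_left₀ (Real.rpow_nonneg (sub_nonneg.2 (h.mono h2)) _) (key s t h2) 2)⟩

theorem ControlBound.of_le {p T : ℝ} {f : E e → (E d →L[ℝ] E e)} {X : RoughData d} {Z : ℝ → E e}
    {F G : ℝ → ℝ} (hp : 0 ≤ p) (h : ControlBound p T f X Z F) (hG : Monotone G)
    (hFG : ∀ s t, s ≤ t → F t - F s ≤ G t - G s) : ControlBound p T f X Z G := by
  have key : ∀ s t, s ≤ t → (F t - F s) ^ p⁻¹ ≤ (G t - G s) ^ p⁻¹ := fun s t hst =>
    rpow_increment_mono hp (h.mono hst) (hFG s t hst)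
  exact ⟨hG, fun s t h1 h2 h3 => (h.path s t h1 h2 h3).trans (key s t h2),
    fun s t h1 h2 h3 => (h.remainder s t h1 h2 h3).trans
      (pow_le_pow_left₀ (Real.rpow_nonneg (sub_nonneg.2 (h.mono h2)) _) (key s t h2) 2)⟩

theorem IsRough.exists_roughBound {p T : ℝ} (hp : 0 < p) {X : RoughData d} (hX : IsRough p T X) :
    ∃ F, RoughBound p T X F := by
  obtain ⟨F, hF, h1⟩ := hX.pvar.exists_monotone_norm_le hp
  obtain ⟨G, hG, h2⟩ := hX.pvar₂.exists_monotone_norm_le (half_pos hp)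
  refine ⟨fun t => F t + G t, hF.add hG, fun s t a b c => (h1 s t a b c).trans ?_,
    fun s t a b c => (h2 s t a b c).trans ?_⟩
  · exact Real.rpow_le_rpow (sub_nonneg.2 (hF b)) (by linarith [hG b]) (inv_nonneg.2 hp.le)
  · have := hF b
    have := hG b
    rw [← rpow_inv_half (by linarith)]
    exact Real.rpow_le_rpow (by linarith) (by linarith) (inv_nonneg.2 (half_pos hp).le)

theorem IsControlled.exists_controlBound {p T : ℝ} (hp : 0 < p) {f : E e → (E d →L[ℝ] E e)}
    {X : RoughData d} {Z : ℝ → E e} (hZ : IsControlled p T X Z fun t => f (Z t)) :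
    ∃ F, ControlBound p T f X Z F := by
  obtain ⟨F, hF, h1⟩ := hZ.pvar.exists_monotone_norm_le hp
  obtain ⟨G, hG, h2⟩ := hZ.remainder.exists_monotone_norm_le (half_pos hp)
  refine ⟨fun t => F t + G t, hF.add hG, fun s t a b c => (h1 s t a b c).trans ?_,
    fun s t a b c => (h2 s t a b c).trans ?_⟩
  · exact Real.rpow_le_rpow (sub_nonneg.2 (hF b)) (by linarith [hG b]) (inv_nonneg.2 hp.le)
  · have := hF b
    have := hG b
    rw [← rpow_inv_half (by linarith)]
    exact Real.rpow_le_rpow (by linarith) (by linarith) (inv_nonneg.2 (half_pos hp).le)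

theorem exists_common_bound {p T : ℝ} (hp : 0 < p) {f : E e → (E d →L[ℝ] E e)}
    {X : RoughData d} {Z : ℝ → E e} (hX : IsRough p T X)
    (hZ : IsControlled p T X Z fun t => f (Z t)) :
    ∃ F, RoughBound p T X F ∧ ControlBound p T f X Z F := by
  obtain ⟨F, hF⟩ := hX.exists_roughBound hp
  obtain ⟨G, hG⟩ := hZ.exists_controlBound hp
  refine ⟨fun t => F t + G t, hF.of_le hp.le (hF.mono.add hG.mono) fun s t h => ?_,
    hG.of_le hp.le (hF.mono.add hG.mono) fun s t h => ?_⟩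
  · linarith [hG.mono h]
  · linarith [hF.mono h]

theorem ControlBound.exists_mem_closedBall {p T : ℝ} (hp : 0 < p) {f : E e → (E d →L[ℝ] E e)}
    {X : RoughData d} {Z : ℝ → E e} {F : ℝ → ℝ} (h : ControlBound p T f X Z F) :
    ∃ ρ, ∀ t ∈ Icc 0 T, Z t ∈ Metric.closedBall (0 : E e) ρ := by
  refine ⟨‖Z 0‖ + (F T - F 0) ^ p⁻¹, fun t ht => ?_⟩
  rw [mem_closedBall_zero_iff]
  have h1 := h.path 0 t le_rfl ht.1 ht.2
  have h2 : (F t - F 0) ^ p⁻¹ ≤ (F T - F 0) ^ p⁻¹ :=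
    Real.rpow_le_rpow (sub_nonneg.2 (h.mono ht.1)) (by linarith [h.mono ht.2])
      (inv_nonneg.2 hp.le)
  have h3 : ‖Z t‖ ≤ ‖Z 0‖ + ‖incr Z 0 t‖ := by
    have := norm_add_le (Z 0) (incr Z 0 t)
    simpa [incr] using this
  linarith

/-- By Chen's relation and `derivTerm_tensor`, what survives is a Taylor remainder of f, the
derivative applied to the controlled remainder, and the change of the coefficients in front of the
second level. Each has three orders of smallness. -/
theorem roughGerm_defect {T : ℝ} (f : E e → (E d →L[ℝ] E e)) {p : ℝ} {X : RoughData d}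
    (hX : IsRough p T X) (Z : ℝ → E e) {s u t : ℝ} (h1 : 0 ≤ s) (h2 : s ≤ u) (h3 : u ≤ t)
    (h4 : t ≤ T) :
    roughGerm f X Z s t - roughGerm f X Z s u - roughGerm f X Z u t =
      -((f (Z u) - f (Z s) - fderiv ℝ f (Z s) (Z u - Z s)) (incr X.path u t) +
        (fderiv ℝ f (Z s) (incr Z s u - f (Z s) (incr X.path s u))) (incr X.path u t) +
        (field f (Z u) - field f (Z s)) (0, X.second u t)) := by
  have hch := hX.chen s u t h1 h2 h3 h4
  have e1 : X.second s t = X.second s u + X.second u t +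
      tensor (incr X.path s u) (incr X.path u t) := by rw [← hch]; abel
  have e2 : incr X.path s t = incr X.path s u + incr X.path u t := by simp [incr]
  simp only [roughGerm, derivTerm_eq_field, e1, e2]
  have e3 : ((0 : E d), X.second s u + X.second u t +
      tensor (incr X.path s u) (incr X.path u t)) =
      (0, X.second s u) + (0, X.second u t) + (0, tensor (incr X.path s u) (incr X.path u t)) := by
    simp
  rw [e3, map_add, map_add, ← derivTerm_eq_field f (Z s) (tensor _ _), derivTerm_tensor]
  simp only [sub_apply, map_add, map_sub]
  simp only [incr, map_sub, sub_apply]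
  abel

/-- Interpolation: a part ε of the homogeneity in x is given up for a positive power of the
oscillation η. -/
theorem le_rpow_mul_rpow {x y η ε : ℝ} (hy : 0 ≤ y) (hyx : y ≤ x) (hyη : y ≤ η) (hε : 0 < ε)
    (hε1 : ε < 1) : y ≤ η ^ ε * x ^ (1 - ε) := by
  calc y = y ^ ε * y ^ (1 - ε) := by
        rw [← Real.rpow_add' hy (by simp), add_sub_cancel, Real.rpow_one]
    _ ≤ _ := mul_le_mul (Real.rpow_le_rpow hy hyη hε.le)
        (Real.rpow_le_rpow hy hyx (by linarith)) (Real.rpow_nonneg hy _)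
        (Real.rpow_nonneg (hy.trans hyη) _)

/-- With x = (F t - F s)^(1/p) and ε = (3-p)/2, each term of the defect is at most L x² · η^ε
x^(1-ε). The resulting exponent (3-ε)/p = (3+p)/(2p) of the increment of F exceeds 1 exactly because
p < 3, and a positive power of η is left over. That power supplies the smallness on short intervals,
since F itself may jump. -/
theorem norm_roughGerm_defect_le {p T ρ L : ℝ} (hp : 2 ≤ p) (hp' : p < 3)
    {f : E e → (E d →L[ℝ] E e)} (hf : FieldBounds f ρ L) {X : RoughData d} (hX : IsRough p T X)
    {Z : ℝ → E e} {F : ℝ → ℝ} (hXF : RoughBound p T X F) (hZF : ControlBound p T f X Z F)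
    (hZ : ∀ t ∈ Icc 0 T, Z t ∈ Metric.closedBall (0 : E e) ρ) {s u t η : ℝ} (h1 : 0 ≤ s)
    (h2 : s ≤ u) (h3 : u ≤ t) (h4 : t ≤ T) (hη : ‖incr X.path u t‖ ≤ η)
    (hη' : ‖incr Z s u‖ ≤ η) :
    ‖roughGerm f X Z s t - roughGerm f X Z s u - roughGerm f X Z u t‖ ≤
      3 * L * η ^ ((3 - p) / 2) * (F t - F s) ^ ((3 + p) / (2 * p)) := by
  have hp0 : 0 < p := by linarith
  have hL := hf.pos
  set x := (F t - F s) ^ p⁻¹ with hx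
  have hd : 0 ≤ F t - F s := sub_nonneg.2 (hXF.mono (h2.trans h3))
  have hx0 : 0 ≤ x := Real.rpow_nonneg hd _
  have hsu : (F u - F s) ^ p⁻¹ ≤ x := Real.rpow_le_rpow (sub_nonneg.2 (hXF.mono h2))
    (by linarith [hXF.mono h3]) (inv_nonneg.2 hp0.le)
  have hut : (F t - F u) ^ p⁻¹ ≤ x := Real.rpow_le_rpow (sub_nonneg.2 (hXF.mono h3))
    (by linarith [hXF.mono h2]) (inv_nonneg.2 hp0.le)
  have h5 : 0 ≤ u := h1.trans h2
  have h6 : u ≤ T := h3.trans h4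
  set y := η ^ ((3 - p) / 2) * x ^ (1 - (3 - p) / 2) with hy
  have bX : ‖incr X.path u t‖ ≤ y := le_rpow_mul_rpow (norm_nonneg _)
    ((hXF.path u t h5 h3 h4).trans hut) hη (by linarith) (by linarith)
  have bZ : ‖incr Z s u‖ ≤ y := le_rpow_mul_rpow (norm_nonneg _)
    ((hZF.path s u h1 h2 h6).trans hsu) hη' (by linarith) (by linarith)
  have bZ' : ‖incr Z s u‖ ^ 2 ≤ x ^ 2 := pow_le_pow_left₀ (norm_nonneg _)
    ((hZF.path s u h1 h2 h6).trans hsu) 2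
  have bR : ‖incr Z s u - f (Z s) (incr X.path s u)‖ ≤ x ^ 2 :=
    (hZF.remainder s u h1 h2 h6).trans (pow_le_pow_left₀
      (Real.rpow_nonneg (sub_nonneg.2 (hXF.mono h2)) _) hsu 2)
  have bS : ‖X.second u t‖ ≤ x ^ 2 :=
    (hXF.second u t h5 h3 h4).trans (pow_le_pow_left₀
      (Real.rpow_nonneg (sub_nonneg.2 (hXF.mono h3)) _) hut 2)
  have ms := hZ s ⟨h1, h2.trans h6⟩
  have mu := hZ u ⟨h5, h6⟩
  have hy0 : 0 ≤ y := (norm_nonneg _).trans bX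
  rw [roughGerm_defect f hX Z h1 h2 h3 h4, norm_neg]
  have t1 : ‖(f (Z u) - f (Z s) - fderiv ℝ f (Z s) (Z u - Z s)) (incr X.path u t)‖ ≤
      L * x ^ 2 * y :=
    (ContinuousLinearMap.le_opNorm _ _).trans (mul_le_mul
      ((hf.taylor _ ms _ mu).trans (mul_le_mul_of_nonneg_left bZ' hL)) bX (norm_nonneg _)
      (by positivity))
  have t2 : ‖(fderiv ℝ f (Z s) (incr Z s u - f (Z s) (incr X.path s u))) (incr X.path u t)‖ ≤
      L * x ^ 2 * y :=
    (ContinuousLinearMap.le_opNorm _ _).trans (mul_le_mul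
      ((ContinuousLinearMap.le_opNorm _ _).trans
        (mul_le_mul (hf.norm_fderiv _ ms) bR (norm_nonneg _) hL)) bX (norm_nonneg _)
      (by positivity))
  have t3 : ‖(field f (Z u) - field f (Z s)) (0, X.second u t)‖ ≤ L * y * x ^ 2 := by
    have hn : ‖((0 : E d), X.second u t)‖ ≤ x ^ 2 := by
      rw [Prod.norm_def]
      simpa using bS
    exact (ContinuousLinearMap.le_opNorm _ _).trans (mul_le_mul
      ((hf.field_lip _ ms _ mu).trans (mul_le_mul_of_nonneg_left bZ hL)) hn (norm_nonneg _)
      (by positivity))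
  have hxe : x ^ 2 * x ^ (1 - (3 - p) / 2) = (F t - F s) ^ ((3 + p) / (2 * p)) := by
    rw [← Real.rpow_natCast, ← Real.rpow_add' hx0 (by push_cast; linarith), hx,
      ← Real.rpow_mul hd]
    congr 1
    push_cast
    field_simp
    ring
  calc _ ≤ L * x ^ 2 * y + L * x ^ 2 * y + L * y * x ^ 2 :=
        (norm_add_le _ _).trans (add_le_add ((norm_add_le _ _).trans (add_le_add t1 t2)) t3)
    _ = 3 * L * η ^ ((3 - p) / 2) * (x ^ 2 * x ^ (1 - (3 - p) / 2)) := by rw [hy]; ring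
    _ = _ := by rw [hxe]

/-- The excess of the sewing exponent over 1 is absorbed by the total increment of F, so that the
bound is linear in the increment and can be telescoped. -/
theorem norm_partSum_roughGerm_sub_le {p T ρ L : ℝ} (hp : 2 ≤ p) (hp' : p < 3)
    {f : E e → (E d →L[ℝ] E e)} (hf : FieldBounds f ρ L) {X : RoughData d} (hX : IsRough p T X)
    {Z : ℝ → E e} {F : ℝ → ℝ} (hXF : RoughBound p T X F) (hZF : ControlBound p T f X Z F)
    (hZ : ∀ t ∈ Icc 0 T, Z t ∈ Metric.closedBall (0 : E e) ρ) :
    ∃ C, 0 ≤ C ∧ ∀ s t η, 0 ≤ η → 0 ≤ s → s ≤ t → t ≤ T →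
      (∀ u v, s ≤ u → u ≤ v → v ≤ t → ‖incr X.path u v‖ ≤ η ∧ ‖incr Z u v‖ ≤ η) →
      ∀ n u, IsPartition s t n u →
        ‖partSum (roughGerm f X Z) n u - roughGerm f X Z s t‖ ≤
          C * η ^ ((3 - p) / 2) * (F t - F s) := by
  have hL := hf.pos
  set θ := (3 + p) / (2 * p) with hθdef
  have hθ : 1 < θ := by
    rw [hθdef, one_lt_div (by linarith)]; linarith
  have h2 : (2 : ℝ) ^ (1 - θ) < 1 := Real.rpow_lt_one_of_one_lt_of_neg one_lt_two (by linarith)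
  set A := 2 / (1 - (2 : ℝ) ^ (1 - θ)) with hA
  have hA0 : 0 ≤ A := div_nonneg two_pos.le (by linarith)
  have hG : ∀ {x : ℝ}, 0 ≤ x → 0 ≤ x ^ (θ - 1) := fun h => Real.rpow_nonneg h _
  refine ⟨A * (3 * L) * |F T - F 0| ^ (θ - 1), by positivity, fun s t η hη h0 hst hT hosc n u hu =>
      ?_⟩
  have hηp : 0 ≤ η ^ ((3 - p) / 2) := Real.rpow_nonneg hη _
  have := sewing_sum_le hXF.mono (K := 3 * L * η ^ ((3 - p) / 2)) (by positivity) hθ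
    (Ξ := roughGerm f X Z) (fun a b c h1 h2 h3 h4 =>
      norm_roughGerm_defect_le hp hp' hf hX hXF hZF hZ (h0.trans h1) h2 h3 (h4.trans hT)
        (hosc b c (h1.trans h2) h3 h4).1 (hosc a b h1 h2 (h3.trans h4)).2) hu
  have hd : 0 ≤ F t - F s := sub_nonneg.2 (hXF.mono hst)
  have hdG : F t - F s ≤ |F T - F 0| := by
    have := le_abs_self (F T - F 0)
    linarith [hXF.mono hT, hXF.mono h0]
  have hpow : (F t - F s) ^ θ ≤ |F T - F 0| ^ (θ - 1) * (F t - F s) := by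
    calc (F t - F s) ^ θ = (F t - F s) ^ (θ - 1 + 1) := by rw [sub_add_cancel]
      _ = (F t - F s) ^ (θ - 1) * (F t - F s) := by
          rw [Real.rpow_add' hd (by linarith), Real.rpow_one]
      _ ≤ _ := mul_le_mul_of_nonneg_right (Real.rpow_le_rpow hd hdG (by linarith)) hd
  refine this.trans ?_
  calc A * (3 * L * η ^ ((3 - p) / 2)) * (F t - F s) ^ θ
      ≤ A * (3 * L * η ^ ((3 - p) / 2)) * (|F T - F 0| ^ (θ - 1) * (F t - F s)) :=
        mul_le_mul_of_nonneg_left hpow (by positivity)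
    _ = _ := by ring

theorem sewable_roughGerm {p T : ℝ} (hp : 2 ≤ p) (hp' : p < 3)
    {f : E e → (E d →L[ℝ] E e)} (hf : ContDiff ℝ 2 f) {X : RoughData d} (hX : IsRough p T X)
    (hXc : ContinuousOn X.path (Icc 0 T)) {Z : ℝ → E e} (hZc : ContinuousOn Z (Icc 0 T))
    (hZ : IsControlled p T X Z fun t => f (Z t)) :
    ∃ F, Sewable T (roughGerm f X Z) F := by
  have hp0 : 0 < p := by linarith
  obtain ⟨F, hXF, hZF⟩ := exists_common_bound hp0 hX hZ
  obtain ⟨ρ, hρ⟩ := hZF.exists_mem_closedBall hp0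
  obtain ⟨L, hL⟩ := exists_fieldBounds hf ρ
  obtain ⟨C, hC, hb⟩ := norm_partSum_roughGerm_sub_le hp hp' hL hX hXF hZF hρ
  refine ⟨F, hXF.mono, ⟨C * (|F T - F 0| ^ p⁻¹) ^ ((3 - p) / 2), by positivity,
    fun s t h1 h2 h3 => hb s t _ (by positivity) h1 h2 h3 fun u v h4 h5 h6 => ?_⟩, fun κ hκ => ?_⟩
  · have key : (F v - F u) ^ p⁻¹ ≤ |F T - F 0| ^ p⁻¹ := by
      refine Real.rpow_le_rpow (sub_nonneg.2 (hXF.mono h5)) ?_ (inv_nonneg.2 hp0.le)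
      have := le_abs_self (F T - F 0)
      linarith [hXF.mono (h6.trans h3), hXF.mono (h1.trans h4)]
    exact ⟨(hXF.path u v (h1.trans h4) h5 (h6.trans h3)).trans key,
      (hZF.path u v (h1.trans h4) h5 (h6.trans h3)).trans key⟩
  · obtain ⟨η, hη, hηκ⟩ : ∃ η > 0, C * η ^ ((3 - p) / 2) ≤ κ := by
      have hε : 0 < (3 - p) / 2 := by linarith
      have : Tendsto (fun η : ℝ => C * η ^ ((3 - p) / 2)) (𝓝[>] 0) (𝓝 (C * 0 ^ ((3 - p) / 2))) :=
        ((Real.continuousAt_rpow_const 0 _ (Or.inr hε.le)).tendsto.const_mul C).mono_left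
          nhdsWithin_le_nhds
      rw [Real.zero_rpow hε.ne', mul_zero] at this
      obtain ⟨η, h1, h2⟩ := ((this.eventually (gt_mem_nhds hκ)).and self_mem_nhdsWithin).exists
      exact ⟨η, h2, h1.le⟩
    have uX := Metric.uniformContinuousOn_iff.1
      (isCompact_Icc.uniformContinuousOn_of_continuous hXc) η hη
    have uZ := Metric.uniformContinuousOn_iff.1
      (isCompact_Icc.uniformContinuousOn_of_continuous hZc) η hη
    obtain ⟨r1, hr1, b1⟩ := uX
    obtain ⟨r2, hr2, b2⟩ := uZ
    refine ⟨min r1 r2, lt_min hr1 hr2, fun s t h1 h2 h3 h4 n u hu => ?_⟩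
    refine (hb s t η hη.le h1 h2 h3 (fun u v h5 h6 h7 => ?_) n u hu).trans
      (mul_le_mul_of_nonneg_right hηκ (sub_nonneg.2 (hXF.mono h2)))
    have mu : u ∈ Icc 0 T := ⟨h1.trans h5, h6.trans (h7.trans h3)⟩
    have mv : v ∈ Icc 0 T := ⟨h1.trans (h5.trans h6), h7.trans h3⟩
    have hd : dist v u < min r1 r2 := by
      rw [Real.dist_eq, abs_of_nonneg (sub_nonneg.2 h6)]
      linarith
    have c1 := b1 v mv u mu (hd.trans_le (min_le_left _ _))
    have c2 := b2 v mv u mu (hd.trans_le (min_le_right _ _))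
    rw [dist_eq_norm] at c1 c2
    exact ⟨c1.le, c2.le⟩

end GermBound

/-! ### The time change and the decomposition of the stretched interval -/

section TimeChange

variable {d : ℕ} {T : ℝ} {X : RoughData d} {δ : ℝ → ℝ}

theorem IsStretchLength.summable_ite (hδ : IsStretchLength T X δ) (P : ℝ → Prop)
    [DecidablePred P] : Summable fun s : X.jumpTimes T => if P s then δ s else 0 := by
  refine Summable.of_nonneg_of_le (fun s => ?_) (fun s => ?_) hδ.2 <;> split_ifs
  · exact (hδ.1 s s.2).le
  · exact le_rfl
  · exact le_rfl
  · exact (hδ.1 s s.2).le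

theorem IsStretchLength.tsum_ite_le (hδ : IsStretchLength T X δ) (P Q : ℝ → Prop)
    [DecidablePred P] [DecidablePred Q] (h : ∀ s, P s → Q s) :
    ∑' s : X.jumpTimes T, (if P s then δ s else 0) ≤
      ∑' s : X.jumpTimes T, if Q s then δ s else 0 := by
  refine (hδ.summable_ite P).tsum_le_tsum (fun s => ?_) (hδ.summable_ite Q)
  have := (hδ.1 s s.2).le
  by_cases hP : P s
  · simp [hP, h _ hP]
  · by_cases hQ : Q s <;> simp [hP, hQ, this]

theorem timeChangeLeft_le (hδ : IsStretchLength T X δ) (t : ℝ) :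
    timeChangeLeft T X δ t ≤ timeChange T X δ t := by
  have := hδ.tsum_ite_le (fun r => r < t) (fun r => r ≤ t) fun _ h => le_of_lt h
  unfold timeChange timeChangeLeft
  linarith

theorem timeChange_add_le (hδ : IsStretchLength T X δ) {s t : ℝ} (h : s < t) :
    timeChange T X δ s + (t - s) ≤ timeChangeLeft T X δ t := by
  have := hδ.tsum_ite_le (fun r => r ≤ s) (fun r => r < t) fun _ h' => h'.trans_lt h
  unfold timeChange timeChangeLeft
  linarith

theorem timeChange_lt_left (hδ : IsStretchLength T X δ) {s t : ℝ} (h : s < t) :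
    timeChange T X δ s < timeChangeLeft T X δ t := by
  have := timeChange_add_le hδ h
  linarith

theorem timeChange_strictMono (hδ : IsStretchLength T X δ) : StrictMono (timeChange T X δ) :=
  fun _ _ h => (timeChange_lt_left hδ h).trans_le (timeChangeLeft_le hδ _)

theorem timeChangeLeft_strictMono (hδ : IsStretchLength T X δ) :
    StrictMono (timeChangeLeft T X δ) :=
  fun _ _ h => (timeChangeLeft_le hδ _).trans_lt (timeChange_lt_left hδ h)

theorem timeChange_sub_left (hδ : IsStretchLength T X δ) {t : ℝ} (ht : t ∈ X.jumpTimes T) :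
    timeChange T X δ t - timeChangeLeft T X δ t = δ t := by
  unfold timeChange timeChangeLeft
  rw [add_sub_add_left_eq_sub, ← (hδ.summable_ite fun r => r ≤ t).tsum_sub
    (hδ.summable_ite fun r => r < t), tsum_eq_single ⟨t, ht⟩]
  · simp
  · intro s hs
    have hs : (s : ℝ) ≠ t := fun h => hs (Subtype.ext h)
    rcases lt_or_gt_of_ne hs with h | h
    · simp [h, h.le]
    · simp [h.not_ge, h.le.not_gt]

theorem timeChange_eq_left {t : ℝ} (ht : t ∉ X.jumpTimes T) :
    timeChangeLeft T X δ t = timeChange T X δ t := by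
  unfold timeChange timeChangeLeft
  congr 1
  refine tsum_congr fun s => ?_
  have hs : (s : ℝ) ≠ t := fun h => ht (h ▸ s.2)
  simp [le_iff_lt_or_eq, hs]

theorem zero_notMem_jumpTimes : (0 : ℝ) ∉ X.jumpTimes T := fun h => lt_irrefl _ h.1.1

theorem timeChange_zero : timeChange T X δ 0 = 0 := by
  have : ∀ s : X.jumpTimes T, ¬ (s : ℝ) ≤ 0 := fun s => not_le.2 s.2.1.1
  simp [timeChange, this]

theorem timeChangeLeft_zero : timeChangeLeft T X δ 0 = 0 := by
  rw [timeChange_eq_left zero_notMem_jumpTimes, timeChange_zero]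

theorem timeChange_nonneg (hδ : IsStretchLength T X δ) {t : ℝ} (ht : 0 ≤ t) :
    0 ≤ timeChange T X δ t := by
  have := (timeChange_strictMono hδ).monotone ht
  rwa [timeChange_zero] at this

theorem timeChangeLeft_nonneg (hδ : IsStretchLength T X δ) {t : ℝ} (ht : 0 ≤ t) :
    0 ≤ timeChangeLeft T X δ t := by
  have := (timeChangeLeft_strictMono hδ).monotone ht
  rwa [timeChangeLeft_zero] at this

theorem timeChange_mem (hδ : IsStretchLength T X δ) {t : ℝ} (ht : t ∈ Icc 0 T) :
    timeChange T X δ t ∈ Icc 0 (stretchedLength T X δ) :=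
  ⟨timeChange_nonneg hδ ht.1, (timeChange_strictMono hδ).monotone ht.2⟩

theorem timeChangeLeft_mem (hδ : IsStretchLength T X δ) {t : ℝ} (ht : t ∈ Icc 0 T) :
    timeChangeLeft T X δ t ∈ Icc 0 (stretchedLength T X δ) :=
  ⟨timeChangeLeft_nonneg hδ ht.1, (timeChangeLeft_le hδ t).trans (timeChange_mem hδ ht).2⟩

theorem segment_subset (hδ : IsStretchLength T X δ) {t : ℝ} (ht : t ∈ Icc 0 T) :
    Icc (timeChangeLeft T X δ t) (timeChange T X δ t) ⊆ Icc 0 (stretchedLength T X δ) :=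
  Icc_subset_Icc (timeChangeLeft_mem hδ ht).1 (timeChange_mem hδ ht).2

theorem jumpTimes_subset {t : ℝ} (ht : t ∈ X.jumpTimes T) : t ∈ Icc 0 T := ⟨ht.1.1.le, ht.1.2⟩

theorem stretchedLength_pos (hδ : IsStretchLength T X δ) (hT : 0 < T) :
    0 < stretchedLength T X δ := by
  have := timeChange_strictMono hδ hT
  rwa [timeChange_zero] at this

theorem tendsto_timeChange_right (hδ : IsStretchLength T X δ) (t : ℝ) :
    Tendsto (timeChange T X δ) (𝓝[>] t) (𝓝 (timeChange T X δ t)) := by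
  unfold timeChange
  refine (tendsto_id.mono_left nhdsWithin_le_nhds).add
    (tendsto_tsum_of_dominated_convergence hδ.2 (fun s => ?_) (Eventually.of_forall fun r s => ?_))
  · by_cases hs : (s : ℝ) ≤ t
    · refine tendsto_const_nhds.congr' ?_
      filter_upwards [self_mem_nhdsWithin] with r hr
      rw [if_pos hs, if_pos (hs.trans (le_of_lt hr))]
    · refine tendsto_const_nhds.congr' ?_
      filter_upwards [nhdsWithin_le_nhds (gt_mem_nhds (not_le.1 hs))] with r hr
      rw [if_neg hs, if_neg (not_le.2 hr)]
  · have := hδ.1 s s.2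
    split_ifs
    · rw [Real.norm_of_nonneg this.le]
    · simpa using this.le

/-- Dominated convergence with the summable family δ: as r increases to t, the indicator of s ≤ r
tends to that of s < t, so only the length of a jump at t is lost. -/
theorem tendsto_timeChange_left (hδ : IsStretchLength T X δ) (t : ℝ) :
    Tendsto (timeChange T X δ) (𝓝[<] t) (𝓝 (timeChangeLeft T X δ t)) := by
  unfold timeChange timeChangeLeft
  refine (tendsto_id.mono_left nhdsWithin_le_nhds).add
    (tendsto_tsum_of_dominated_convergence hδ.2 (fun s => ?_) (Eventually.of_forall fun r s => ?_))
  · by_cases hs : (s : ℝ) < t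
    · refine tendsto_const_nhds.congr' ?_
      filter_upwards [nhdsWithin_le_nhds (lt_mem_nhds hs)] with r hr
      rw [if_pos hs, if_pos (le_of_lt hr)]
    · refine tendsto_const_nhds.congr' ?_
      filter_upwards [self_mem_nhdsWithin] with r hr
      rw [if_neg hs, if_neg (not_le.2 (lt_of_lt_of_le hr (not_lt.1 hs)))]
  · have := hδ.1 s s.2
    split_ifs
    · rw [Real.norm_of_nonneg this.le]
    · simpa using this.le

theorem exists_originalTime (hδ : IsStretchLength T X δ) (hT : 0 < T) {r : ℝ}
    (hr : r ∈ Icc 0 (stretchedLength T X δ)) :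
    ∃ t ∈ Icc 0 T, r ∈ Icc (timeChangeLeft T X δ t) (timeChange T X δ t) := by
  set S := {t | t ∈ Icc 0 T ∧ r ≤ timeChange T X δ t} with hS
  have hne : S.Nonempty := ⟨T, right_mem_Icc.2 hT.le, hr.2⟩
  have hbd : BddBelow S := ⟨0, fun t ht => ht.1.1⟩
  have h0 : 0 ≤ sInf S := le_csInf hne fun t ht => ht.1.1
  have hTle : sInf S ≤ T := csInf_le hbd ⟨right_mem_Icc.2 hT.le, hr.2⟩
  refine ⟨sInf S, ⟨h0, hTle⟩, ?_, ?_⟩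
  · rcases h0.eq_or_lt with h | h
    · rw [← h, timeChangeLeft_zero]
      exact hr.1
    · refine le_of_tendsto (tendsto_timeChange_left hδ (sInf S)) ?_
      filter_upwards [Ioo_mem_nhdsLT h] with s hs
      by_contra hcon
      exact notMem_of_lt_csInf hs.2 hbd ⟨⟨hs.1.le, hs.2.le.trans hTle⟩, (not_le.1 hcon).le⟩
  · refine ge_of_tendsto (tendsto_timeChange_right hδ (sInf S)) ?_
    filter_upwards [self_mem_nhdsWithin] with s hs
    obtain ⟨t, ht, hts⟩ := exists_lt_of_csInf_lt hne (show sInf S < s from hs)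
    exact ht.2.trans ((timeChange_strictMono hδ).monotone hts.le)

theorem originalTime_eq (hδ : IsStretchLength T X δ) {t r : ℝ} (ht : t ∈ Icc 0 T)
    (hr : r ∈ Icc (timeChangeLeft T X δ t) (timeChange T X δ t)) :
    originalTime T X δ r = t := by
  refine IsLeast.csInf_eq ⟨⟨ht, hr.2⟩, fun s hs => ?_⟩
  by_contra hcon
  have := timeChange_lt_left hδ (not_le.1 hcon)
  linarith [hs.2, hr.1]

theorem le_of_timeChangeLeft_le (hδ : IsStretchLength T X δ) {s t u v : ℝ}
    (hu : timeChangeLeft T X δ s ≤ u) (hv : v ≤ timeChange T X δ t) (huv : u ≤ v) : s ≤ t := by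
  by_contra hcon
  have := timeChange_lt_left hδ (not_le.1 hcon)
  linarith

/-- A criterion for continuity of a path on the stretched interval. -/
theorem continuousOn_stretched (hδ : IsStretchLength T X δ) (hT : 0 < T) {V : Type*}
    [PseudoMetricSpace V] {g : ℝ → V}
    (hseg : ∀ t ∈ X.jumpTimes T,
      ContinuousOn g (Icc (timeChangeLeft T X δ t) (timeChange T X δ t)))
    (hright : ∀ t ∈ Ico 0 T, ∀ ε > 0, ∃ b > t, ∀ s ∈ Ioo t b, s ≤ T →
      ∀ r ∈ Icc (timeChangeLeft T X δ s) (timeChange T X δ s),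
        dist (g r) (g (timeChange T X δ t)) < ε)
    (hleft : ∀ t ∈ Ioc 0 T, ∀ ε > 0, ∃ a < t, ∀ s ∈ Ioo a t, 0 ≤ s →
      ∀ r ∈ Icc (timeChangeLeft T X δ s) (timeChange T X δ s),
        dist (g r) (g (timeChangeLeft T X δ t)) < ε) :
    ContinuousOn g (Icc 0 (stretchedLength T X δ)) := by
  intro r₀ hr₀
  obtain ⟨t, ht, hrt⟩ := exists_originalTime hδ hT hr₀
  -- The two sides of `r₀` are treated separately. Either the jump interval of `t` is a
  -- neighbourhood of `r₀` on that side, or `r₀` is its endpoint there and nearby points belong to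
  -- times `s` close to `t`.
  have hsplit : Icc 0 (stretchedLength T X δ) =
      (Icc 0 (stretchedLength T X δ) ∩ Iic r₀) ∪ (Icc 0 (stretchedLength T X δ) ∩ Ici r₀) := by
    rw [← inter_union_distrib_left, Iic_union_Ici, inter_univ]
  rw [hsplit]
  have hJ : timeChangeLeft T X δ t < timeChange T X δ t → t ∈ X.jumpTimes T := fun h => by
    by_contra hcon
    rw [timeChange_eq_left hcon] at h
    exact lt_irrefl _ h
  refine ContinuousWithinAt.union ?_ ?_
  · rcases hrt.1.eq_or_lt with h | h
    · rw [← h] at hr₀ ⊢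
      rcases ht.1.eq_or_lt with h0 | h0
      · have hs : Icc 0 (stretchedLength T X δ) ∩ Iic (timeChangeLeft T X δ t) ⊆
            {timeChangeLeft T X δ t} := by
          rintro x ⟨hx, hx'⟩
          rw [← h0, timeChangeLeft_zero] at *
          exact le_antisymm hx' hx.1
        exact continuousWithinAt_singleton.mono hs
      · rw [Metric.continuousWithinAt_iff']
        intro ε hε
        obtain ⟨a, ha, hb⟩ := hleft t ⟨h0, ht.2⟩ ε hε
        have hlt : timeChange T X δ a < timeChangeLeft T X δ t := timeChange_lt_left hδ ha
        filter_upwards [self_mem_nhdsWithin, nhdsWithin_le_nhds (lt_mem_nhds hlt)] with r hr hra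
        rcases eq_or_lt_of_le (mem_Iic.1 hr.2) with h' | h'
        · rw [h', dist_self]; exact hε
        obtain ⟨s, hs, hrs⟩ := exists_originalTime hδ hT hr.1
        refine hb s ⟨?_, ?_⟩ hs.1 r hrs
        · exact (timeChange_strictMono hδ).lt_iff_lt.1 (hra.trans_le hrs.2)
        · exact (timeChangeLeft_strictMono hδ).lt_iff_lt.1 (hrs.1.trans_lt h')
    · have htJ := hJ (h.trans_le hrt.2)
      refine ((hseg t htJ) r₀ hrt).mono_of_mem_nhdsWithin ?_
      filter_upwards [self_mem_nhdsWithin, nhdsWithin_le_nhds (lt_mem_nhds h)] with r hr hr'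
      exact ⟨le_of_lt hr', (mem_Iic.1 hr.2).trans hrt.2⟩
  · rcases hrt.2.eq_or_lt with h | h
    · rw [h] at hr₀ ⊢
      rcases ht.2.eq_or_lt with h0 | h0
      · have hs : Icc 0 (stretchedLength T X δ) ∩ Ici (timeChange T X δ t) ⊆
            {timeChange T X δ t} := by
          rintro x ⟨hx, hx'⟩
          rw [h0] at *
          exact le_antisymm hx.2 hx'
        exact continuousWithinAt_singleton.mono hs
      · rw [Metric.continuousWithinAt_iff']
        intro ε hε
        obtain ⟨b, hbt, hb⟩ := hright t ⟨ht.1, h0⟩ ε hε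
        have hlt : timeChange T X δ t < timeChangeLeft T X δ b := timeChange_lt_left hδ hbt
        filter_upwards [self_mem_nhdsWithin, nhdsWithin_le_nhds (gt_mem_nhds hlt)] with r hr hra
        rcases eq_or_lt_of_le (mem_Ici.1 hr.2) with h' | h'
        · rw [← h', dist_self]; exact hε
        obtain ⟨s, hs, hrs⟩ := exists_originalTime hδ hT hr.1
        refine hb s ⟨?_, ?_⟩ hs.2 r hrs
        · exact (timeChange_strictMono hδ).lt_iff_lt.1 (h'.trans_le hrs.2)
        · exact (timeChangeLeft_strictMono hδ).lt_iff_lt.1 (hrs.1.trans_lt hra)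
    · have htJ := hJ (hrt.1.trans_lt h)
      refine ((hseg t htJ) r₀ hrt).mono_of_mem_nhdsWithin ?_
      filter_upwards [self_mem_nhdsWithin, nhdsWithin_le_nhds (gt_mem_nhds h)] with r hr hr'
      exact ⟨hrt.1.trans (mem_Ici.1 hr.2), le_of_lt hr'⟩

end TimeChange

/-! ### Algebra and continuity of the stretched path -/

section Stretched

variable {d : ℕ} {p T : ℝ} {X : RoughData d} {δ : ℝ → ℝ}

theorem CadlagOn.tendsto_leftLim {V : Type*} [TopologicalSpace V] [T2Space V] {x : ℝ → V}
    (hx : CadlagOn T x) {t : ℝ} (ht : t ∈ Ioc 0 T) :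
    Tendsto x (𝓝[<] t) (𝓝 (Function.leftLim x t)) := by
  obtain ⟨l, hl⟩ := hx.2 t ht
  rwa [leftLim_eq_of_tendsto hl]

theorem IsRough.inc_eq (hX : IsRough p T X) {s t : ℝ} (hs : 0 ≤ s) (hst : s ≤ t) (ht : t ≤ T) :
    X.inc s t = tmul (tinv (X.inc 0 s)) (X.inc 0 t) := by
  have h := hX.chen 0 s t le_rfl hs hst ht
  have e : X.second s t = X.second 0 t - X.second 0 s -
      tensor (incr X.path 0 s) (incr X.path s t) := by rw [← h]; abel
  ext
  · simp [RoughData.inc, incr, tmul, tinv]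
  · simp [RoughData.inc, incr, tmul, tinv, e]; ring

theorem IsCadlagGeometric.tendsto_inc (hX : IsCadlagGeometric p T X) {t : ℝ} (ht : t ∈ Ioc 0 T) :
    Tendsto (fun s => X.inc s t) (𝓝[<] t)
      (𝓝 (tmul (tinv (Function.leftLim (X.inc 0) t)) (X.inc 0 t))) := by
  have h1 := (continuous_tinv.tendsto _).comp (hX.cadlag.tendsto_leftLim ht)
  have h2 := (continuous_tmul.tendsto _).comp (h1.prodMk_nhds (tendsto_const_nhds (x := X.inc 0 t)))
  refine h2.congr' ?_
  filter_upwards [Ioo_mem_nhdsLT ht.1] with s hs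
  exact (hX.rough.inc_eq hs.1.le hs.2.le ht.2).symm

theorem IsCadlagGeometric.jump_eq (hX : IsCadlagGeometric p T X) {t : ℝ} (ht : t ∈ Ioc 0 T) :
    X.jump t = tmul (tinv (Function.leftLim (X.inc 0) t)) (X.inc 0 t) :=
  leftLim_eq_of_tendsto (hX.tendsto_inc ht)

theorem IsCadlagGeometric.tendsto_jump (hX : IsCadlagGeometric p T X) {t : ℝ} (ht : t ∈ Ioc 0 T) :
    Tendsto (fun s => X.inc s t) (𝓝[<] t) (𝓝 (X.jump t)) :=
  hX.jump_eq ht ▸ hX.tendsto_inc ht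

theorem IsCadlagGeometric.inc_mem (hX : IsCadlagGeometric p T X) {t : ℝ} (ht : t ∈ Icc 0 T) :
    X.inc 0 t ∈ G2 d := hX.geometric 0 t le_rfl ht.1 ht.2

theorem IsCadlagGeometric.leftLim_mem (hX : IsCadlagGeometric p T X) {t : ℝ} (ht : t ∈ Ioc 0 T) :
    Function.leftLim (X.inc 0) t ∈ G2 d := by
  refine isClosed_G2.mem_of_tendsto (hX.cadlag.tendsto_leftLim ht) ?_
  filter_upwards [Ioo_mem_nhdsLT ht.1] with s hs
  exact hX.inc_mem ⟨hs.1.le, hs.2.le.trans ht.2⟩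

theorem IsCadlagGeometric.jump_mem (hX : IsCadlagGeometric p T X) {t : ℝ} (ht : t ∈ Ioc 0 T) :
    X.jump t ∈ G2 d := by
  rw [hX.jump_eq ht]
  exact tmul_mem_G2 (tinv_mem_G2 (hX.leftLim_mem ht)) (hX.inc_mem ⟨ht.1.le, ht.2⟩)

theorem jump_eq_zero {t : ℝ} (ht : t ∈ Ioc 0 T) (hJ : t ∉ X.jumpTimes T) : X.jump t = 0 := by
  by_contra h
  exact hJ ⟨ht, h⟩

theorem IsCadlagGeometric.leftLim_eq (hX : IsCadlagGeometric p T X) {t : ℝ} (ht : t ∈ Ioc 0 T)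
    (hJ : t ∉ X.jumpTimes T) : Function.leftLim (X.inc 0) t = X.inc 0 t := by
  have h := hX.jump_eq ht
  rw [jump_eq_zero ht hJ] at h
  have h2 : tmul (Function.leftLim (X.inc 0) t) (0 : T2 d) = X.inc 0 t := by
    rw [h, ← tmul_assoc]
    have : tmul (Function.leftLim (X.inc 0) t) (tinv (Function.leftLim (X.inc 0) t)) = 0 :=
      tmul_tinv _
    rw [this, zero_tmul]
  rwa [tmul_zero] at h2

/-- On the interval of a jump time the stretched path is log-linear. -/
theorem stretchedPath_segment (hδ : IsStretchLength T X δ) {t r : ℝ} (ht : t ∈ X.jumpTimes T)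
    (hr : r ∈ Icc (timeChangeLeft T X δ t) (timeChange T X δ t)) :
    stretchedPath T X δ r = texp (tlog (Function.leftLim (X.inc 0) t) +
      ((r - timeChangeLeft T X δ t) / δ t) •
        (tlog (X.inc 0 t) - tlog (Function.leftLim (X.inc 0) t))) := by
  have h0 : δ t ≠ 0 := (hδ.1 t ht).ne'
  have h1 : (timeChange T X δ t - r) / δ t = 1 - (r - timeChangeLeft T X δ t) / δ t := by
    rw [eq_sub_iff_add_eq, ← add_div, div_eq_one_iff_eq h0, ← timeChange_sub_left hδ ht]
    ring
  have e := originalTime_eq hδ (jumpTimes_subset ht) hr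
  simp only [stretchedPath]
  rw [if_pos (by rwa [e]), e]
  congr 1
  rw [h1, sub_smul, one_smul, smul_sub]
  abel

theorem stretchedPath_timeChange (hδ : IsStretchLength T X δ) {t : ℝ} (ht : t ∈ Icc 0 T) :
    stretchedPath T X δ (timeChange T X δ t) = X.inc 0 t := by
  by_cases hJ : t ∈ X.jumpTimes T
  · rw [stretchedPath_segment hδ hJ ⟨timeChangeLeft_le hδ t, le_rfl⟩, timeChange_sub_left hδ hJ,
      div_self (hδ.1 t hJ).ne', one_smul, add_sub_cancel, texp_tlog]
  · have e := originalTime_eq hδ ht ⟨timeChangeLeft_le hδ t, le_rfl⟩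
    simp only [stretchedPath]
    rw [if_neg (by rwa [e]), e]

theorem stretchedPath_timeChangeLeft (hX : IsCadlagGeometric p T X) (hδ : IsStretchLength T X δ)
    {t : ℝ} (ht : t ∈ Ioc 0 T) :
    stretchedPath T X δ (timeChangeLeft T X δ t) = Function.leftLim (X.inc 0) t := by
  by_cases hJ : t ∈ X.jumpTimes T
  · rw [stretchedPath_segment hδ hJ ⟨le_rfl, timeChangeLeft_le hδ t⟩, sub_self, zero_div,
      zero_smul, add_zero, texp_tlog]
  · rw [timeChange_eq_left hJ, stretchedPath_timeChange hδ ⟨ht.1.le, ht.2⟩, hX.leftLim_eq ht hJ]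

theorem stretched_inc (u v : ℝ) : (stretched T X δ).inc u v =
    tmul (tinv (stretchedPath T X δ u)) (stretchedPath T X δ v) := by
  ext
  · simp [RoughData.inc, stretched, incr, tmul, tinv]; ring
  · simp [RoughData.inc, stretched]

theorem stretched_inc_timeChange (hX : IsCadlagGeometric p T X) (hδ : IsStretchLength T X δ)
    {s t : ℝ} (hs : 0 ≤ s) (hst : s ≤ t) (ht : t ≤ T) :
    (stretched T X δ).inc (timeChange T X δ s) (timeChange T X δ t) = X.inc s t := by
  rw [stretched_inc, stretchedPath_timeChange hδ ⟨hs, hst.trans ht⟩,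
    stretchedPath_timeChange hδ ⟨hs.trans hst, ht⟩, hX.rough.inc_eq hs hst ht]

theorem stretched_inc_jump (hX : IsCadlagGeometric p T X) (hδ : IsStretchLength T X δ)
    {t : ℝ} (ht : t ∈ Ioc 0 T) :
    (stretched T X δ).inc (timeChangeLeft T X δ t) (timeChange T X δ t) = X.jump t := by
  rw [stretched_inc, stretchedPath_timeChange hδ ⟨ht.1.le, ht.2⟩,
    stretchedPath_timeChangeLeft hX hδ ht, hX.jump_eq ht]

theorem stretched_inc_segment (hX : IsCadlagGeometric p T X) (hδ : IsStretchLength T X δ)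
    {t u v : ℝ} (ht : t ∈ X.jumpTimes T)
    (hu : u ∈ Icc (timeChangeLeft T X δ t) (timeChange T X δ t))
    (hv : v ∈ Icc (timeChangeLeft T X δ t) (timeChange T X δ t)) :
    (stretched T X δ).inc u v = texp (((v - u) / δ t) • tlog (X.jump t)) := by
  rw [stretched_inc, stretchedPath_segment hδ ht hu, stretchedPath_segment hδ ht hv,
    tinv_tmul_interpolate, hX.jump_eq ht.1, add_sub_cancel, texp_tlog, texp_tlog, ← sub_div,
    sub_sub_sub_cancel_right]

theorem stretchedPath_mem_segment (hδ : IsStretchLength T X δ)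
    {t r : ℝ} (ht : t ∈ Ioc 0 T)
    (hr : r ∈ Icc (timeChangeLeft T X δ t) (timeChange T X δ t)) :
    tlog (stretchedPath T X δ r) ∈
      segment ℝ (tlog (Function.leftLim (X.inc 0) t)) (tlog (X.inc 0 t)) := by
  by_cases hJ : t ∈ X.jumpTimes T
  · rw [stretchedPath_segment hδ hJ hr, tlog_texp, segment_eq_image']
    have h0 := hδ.1 t hJ
    refine ⟨_, ⟨div_nonneg (sub_nonneg.2 hr.1) h0.le, ?_⟩, rfl⟩
    rw [div_le_one h0, ← timeChange_sub_left hδ hJ]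
    linarith [hr.2]
  · rw [timeChange_eq_left hJ] at hr
    rw [le_antisymm hr.2 hr.1, stretchedPath_timeChange hδ ⟨ht.1.le, ht.2⟩]
    exact right_mem_segment _ _ _

theorem stretchedPath_mem (hX : IsCadlagGeometric p T X) (hδ : IsStretchLength T X δ)
    (hT : 0 < T) {r : ℝ} (hr : r ∈ Icc 0 (stretchedLength T X δ)) :
    stretchedPath T X δ r ∈ G2 d := by
  obtain ⟨t, ht, hrt⟩ := exists_originalTime hδ hT hr
  by_cases hJ : t ∈ X.jumpTimes T
  · obtain ⟨a, b, -, -, -, h⟩ := stretchedPath_mem_segment hδ hJ.1 hrt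
    rw [← texp_tlog (stretchedPath T X δ r), ← h]
    exact texp_mem_G2 (g2_add_smul (tlog_mem_g2 (hX.leftLim_mem hJ.1))
      (tlog_mem_g2 (hX.inc_mem ht)) a b)
  · rw [timeChange_eq_left hJ] at hrt
    rw [le_antisymm hrt.2 hrt.1, stretchedPath_timeChange hδ ht]
    exact hX.inc_mem ht

theorem continuousOn_stretchedPath (hX : IsCadlagGeometric p T X) (hδ : IsStretchLength T X δ)
    (hT : 0 < T) : ContinuousOn (stretchedPath T X δ) (Icc 0 (stretchedLength T X δ)) := by
  have key : ContinuousOn (fun r => tlog (stretchedPath T X δ r))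
      (Icc 0 (stretchedLength T X δ)) := by
    -- In logarithmic coordinates the extra pieces are straight segments. If the logarithms of the
    -- original path lie in a closed ball, so do their left limits and, by convexity, the segments
    -- in between.
    have hball : ∀ (l : T2 d) (ε : ℝ) (a b : ℝ), 0 < ε → 0 ≤ a →
        (∀ s ∈ Ioo a b, s ≤ T → dist (tlog (X.inc 0 s)) l ≤ ε / 2) →
        ∀ s ∈ Ioo a b, s ≤ T → ∀ r ∈ Icc (timeChangeLeft T X δ s) (timeChange T X δ s),
          dist (tlog (stretchedPath T X δ r)) l < ε := by
      intro l ε a b hε ha h s hs hsT r hr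
      have hs0 : s ∈ Ioc 0 T := ⟨ha.trans_lt hs.1, hsT⟩
      have h1 : tlog (X.inc 0 s) ∈ Metric.closedBall l (ε / 2) := h s hs hsT
      have h2 : tlog (Function.leftLim (X.inc 0) s) ∈ Metric.closedBall l (ε / 2) := by
        refine Metric.isClosed_closedBall.mem_of_tendsto
          ((continuous_tlog.tendsto _).comp (hX.cadlag.tendsto_leftLim hs0)) ?_
        filter_upwards [Ioo_mem_nhdsLT hs.1] with s' hs'
        exact h s' ⟨hs'.1, hs'.2.trans hs.2⟩ (hs'.2.le.trans hsT)
      have := (convex_closedBall l (ε / 2)).segment_subset h2 h1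
        (stretchedPath_mem_segment hδ hs0 hr)
      exact lt_of_le_of_lt this (half_lt_self hε)
    refine continuousOn_stretched hδ hT (fun t ht => ?_) (fun t ht ε hε => ?_)
      fun t ht ε hε => ?_
    · have : ContinuousOn (fun r => tlog (Function.leftLim (X.inc 0) t) +
        ((r - timeChangeLeft T X δ t) / δ t) •
        (tlog (X.inc 0 t) - tlog (Function.leftLim (X.inc 0) t)))
        (Icc (timeChangeLeft T X δ t) (timeChange T X δ t)) := by fun_prop
      refine this.congr fun r hr => ?_
      simp only [stretchedPath_segment hδ ht hr, tlog_texp]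
    · rw [stretchedPath_timeChange hδ ⟨ht.1, ht.2.le⟩]
      have h1 : Tendsto (fun s => tlog (X.inc 0 s)) (𝓝[>] t) (𝓝 (tlog (X.inc 0 t))) :=
        (continuous_tlog.tendsto _).comp
          ((hX.cadlag.1 t ht).tendsto.mono_left (nhdsWithin_mono _ Ioi_subset_Ici_self))
      have h2 := h1.eventually (Metric.closedBall_mem_nhds _ (half_pos hε))
      obtain ⟨b, hb, hb'⟩ := mem_nhdsGT_iff_exists_Ioo_subset.1 h2
      exact ⟨b, hb, hball _ ε t b hε ht.1 fun s hs _ => hb' hs⟩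
    · rw [stretchedPath_timeChangeLeft hX hδ ht]
      have h1 := (continuous_tlog.tendsto _).comp (hX.cadlag.tendsto_leftLim ht)
      have h2 := h1.eventually (Metric.closedBall_mem_nhds _ (half_pos hε))
      obtain ⟨a, ha, ha'⟩ := mem_nhdsLT_iff_exists_Ioo_subset.1 h2
      refine ⟨max a 0, max_lt ha ht.1, fun s hs _ => ?_⟩
      exact hball _ ε (max a 0) t hε (le_max_right _ _)
        (fun s hs _ => ha' ⟨(le_max_left _ _).trans_lt hs.1, hs.2⟩) s hs (hs.2.le.trans ht.2)
  have := continuous_texp.comp_continuousOn key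
  simpa [Function.comp_def] using this

theorem continuousOn_stretched_inc (hX : IsCadlagGeometric p T X) (hδ : IsStretchLength T X δ)
    (hT : 0 < T) (u : ℝ) :
    ContinuousOn ((stretched T X δ).inc u) (Icc 0 (stretchedLength T X δ)) := by
  have : (stretched T X δ).inc u =
      fun v => tmul (tinv (stretchedPath T X δ u)) (stretchedPath T X δ v) :=
    funext fun v => stretched_inc u v
  rw [this]
  exact continuous_tmul.comp_continuousOn
    (continuousOn_const.prodMk (continuousOn_stretchedPath hX hδ hT))

theorem stretched_chen (s u t : ℝ) :
    (stretched T X δ).second s t - (stretched T X δ).second s u - (stretched T X δ).second u t =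
      tensor (incr (stretched T X δ).path s u) (incr (stretched T X δ).path u t) := by
  ext
  simp [stretched, incr, tmul, tinv]
  ring

theorem stretched_geometric (hX : IsCadlagGeometric p T X) (hδ : IsStretchLength T X δ)
    (hT : 0 < T) : IsGeometric (stretchedLength T X δ) (stretched T X δ) := by
  intro s t hs hst ht
  rw [stretched_inc]
  exact tmul_mem_G2 (tinv_mem_G2 (stretchedPath_mem hX hδ hT ⟨hs, hst.trans ht⟩))
    (stretchedPath_mem hX hδ hT ⟨hs.trans hst, ht⟩)

end Stretched

/-! ### Transfer of variation bounds to the stretched interval -/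

section StretchedVariation

variable {d : ℕ} {p T : ℝ} {X : RoughData d} {δ : ℝ → ℝ}

open Classical in
/-- The real function `F` on `[0,T]`, interpolated linearly on the extra intervals. -/
def stretchFun (T : ℝ) (X : RoughData d) (δ : ℝ → ℝ) (F : ℝ → ℝ) (r : ℝ) : ℝ :=
  let t := originalTime T X δ r
  if t ∈ X.jumpTimes T then
    Function.leftLim F t +
      ((r - timeChangeLeft T X δ t) / δ t) * (F t - Function.leftLim F t)
  else F t

theorem stretchFun_segment (hδ : IsStretchLength T X δ) (F : ℝ → ℝ) {t r : ℝ}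
    (ht : t ∈ X.jumpTimes T) (hr : r ∈ Icc (timeChangeLeft T X δ t) (timeChange T X δ t)) :
    stretchFun T X δ F r = Function.leftLim F t +
      ((r - timeChangeLeft T X δ t) / δ t) * (F t - Function.leftLim F t) := by
  have e := originalTime_eq hδ (jumpTimes_subset ht) hr
  simp only [stretchFun]
  rw [if_pos (by rwa [e]), e]

theorem stretchFun_timeChange (hδ : IsStretchLength T X δ) (F : ℝ → ℝ) {t : ℝ}
    (ht : t ∈ Icc 0 T) : stretchFun T X δ F (timeChange T X δ t) = F t := by
  by_cases hJ : t ∈ X.jumpTimes T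
  · rw [stretchFun_segment hδ F hJ ⟨timeChangeLeft_le hδ t, le_rfl⟩, timeChange_sub_left hδ hJ,
      div_self (hδ.1 t hJ).ne']
    ring
  · have e := originalTime_eq hδ ht ⟨timeChangeLeft_le hδ t, le_rfl⟩
    simp only [stretchFun]
    rw [if_neg (by rwa [e]), e]

theorem stretchFun_monotoneOn_segment (hδ : IsStretchLength T X δ) {F : ℝ → ℝ} (hF : Monotone F)
    (t : ℝ) : MonotoneOn (stretchFun T X δ F)
      (Icc (timeChangeLeft T X δ t) (timeChange T X δ t)) := by
  intro u hu v hv huv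
  by_cases hJ : t ∈ X.jumpTimes T
  · rw [stretchFun_segment hδ F hJ hu, stretchFun_segment hδ F hJ hv]
    have h0 := hδ.1 t hJ
    have h1 : 0 ≤ F t - Function.leftLim F t := sub_nonneg.2 (hF.leftLim_le le_rfl)
    have h2 : (u - timeChangeLeft T X δ t) / δ t ≤ (v - timeChangeLeft T X δ t) / δ t :=
      div_le_div_of_nonneg_right (by linarith) h0.le
    linarith [mul_le_mul_of_nonneg_right h2 h1]
  · rw [timeChange_eq_left hJ] at hu hv
    rw [le_antisymm hu.2 hu.1, le_antisymm hv.2 hv.1]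

/-- Equality can fail: F may jump at a time where the rough path does not, and no interval is
inserted there. -/
theorem leftLim_le_stretchFun (hδ : IsStretchLength T X δ) {F : ℝ → ℝ} (hF : Monotone F)
    {t : ℝ} (ht : t ∈ Icc 0 T) :
    Function.leftLim F t ≤ stretchFun T X δ F (timeChangeLeft T X δ t) := by
  by_cases hJ : t ∈ X.jumpTimes T
  · rw [stretchFun_segment hδ F hJ ⟨le_rfl, timeChangeLeft_le hδ t⟩]
    simp
  · rw [timeChange_eq_left hJ, stretchFun_timeChange hδ F ht]
    exact hF.leftLim_le le_rfl

theorem stretchFun_monotoneOn (hδ : IsStretchLength T X δ) (hT : 0 < T) {F : ℝ → ℝ}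
    (hF : Monotone F) : MonotoneOn (stretchFun T X δ F) (Icc 0 (stretchedLength T X δ)) := by
  intro u hu v hv huv
  obtain ⟨s, hs, hus⟩ := exists_originalTime hδ hT hu
  obtain ⟨t, ht, hvt⟩ := exists_originalTime hδ hT hv
  rcases (le_of_timeChangeLeft_le hδ hus.1 hvt.2 huv).eq_or_lt with rfl | hst
  · exact stretchFun_monotoneOn_segment hδ hF s hus hvt huv
  · calc stretchFun T X δ F u ≤ stretchFun T X δ F (timeChange T X δ s) :=
          stretchFun_monotoneOn_segment hδ hF s hus ⟨timeChangeLeft_le hδ s, le_rfl⟩ hus.2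
      _ = F s := stretchFun_timeChange hδ F hs
      _ ≤ Function.leftLim F t := hF.le_leftLim hst
      _ ≤ stretchFun T X δ F (timeChangeLeft T X δ t) := leftLim_le_stretchFun hδ hF ht
      _ ≤ stretchFun T X δ F v :=
          stretchFun_monotoneOn_segment hδ hF t ⟨le_rfl, timeChangeLeft_le hδ t⟩ hvt hvt.1

/-- Variation bounds on `[0,T]` and on the jump intervals give variation bounds on the whole
stretched interval, for two-parameter functions that are almost additive. -/
theorem norm_le_stretchFun (hδ : IsStretchLength T X δ) (hT : 0 < T) {F : ℝ → ℝ}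
    (hF : Monotone F) {V : Type*} [NormedAddCommGroup V] {A : ℝ → ℝ → V} {α C K : ℝ}
    (hα : 0 < α) (hC : 0 ≤ C) (hK : 0 ≤ K)
    (h1 : ∀ s t, 0 ≤ s → s ≤ t → t ≤ T →
      ‖A (timeChange T X δ s) (timeChange T X δ t)‖ ≤ C * (F t - F s) ^ α)
    (h2 : ∀ t ∈ X.jumpTimes T, ∀ u v, timeChangeLeft T X δ t ≤ u → u ≤ v →
      v ≤ timeChange T X δ t → ‖A u v‖ ≤ C * ((v - u) / δ t * (F t - Function.leftLim F t)) ^ α)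
    (h3 : ∀ u v w, 0 ≤ u → u ≤ v → v ≤ w → w ≤ stretchedLength T X δ →
      ‖A u w‖ ≤ ‖A u v‖ + ‖A v w‖ + K * (stretchFun T X δ F w - stretchFun T X δ F u) ^ α)
    (h4 : ∀ u ∈ Icc 0 (stretchedLength T X δ),
      ContinuousOn (A u) (Icc 0 (stretchedLength T X δ)))
    (u v : ℝ) (hu : 0 ≤ u) (huv : u ≤ v) (hv : v ≤ stretchedLength T X δ) :
    ‖A u v‖ ≤ (3 * C + 2 * K) * (stretchFun T X δ F v - stretchFun T X δ F u) ^ α := by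
  have hm := stretchFun_monotoneOn hδ hT hF
  have hseg : ∀ t ∈ Icc 0 T, ∀ u v, timeChangeLeft T X δ t ≤ u → u ≤ v → v ≤ timeChange T X δ t →
      ‖A u v‖ ≤ C * (stretchFun T X δ F v - stretchFun T X δ F u) ^ α := by
    intro t ht u v hu huv hv
    by_cases hJ : t ∈ X.jumpTimes T
    · refine (h2 t hJ u v hu huv hv).trans_eq ?_
      rw [stretchFun_segment hδ F hJ ⟨hu, huv.trans hv⟩,
        stretchFun_segment hδ F hJ ⟨hu.trans huv, hv⟩]
      congr 2
      ring
    · rw [timeChange_eq_left hJ] at hu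
      obtain rfl : u = timeChange T X δ t := le_antisymm (huv.trans hv) hu
      obtain rfl : v = timeChange T X δ t := le_antisymm hv huv
      have := h1 t t ht.1 le_rfl ht.2
      rwa [sub_self, ← sub_self (stretchFun T X δ F (timeChange T X δ t))] at this
  -- The bound on original times is pushed to the start τ(t-) of a jump interval by letting t'
  -- increase to t, using continuity of `A` in its second argument.
  have hmid : ∀ s t, 0 ≤ s → s < t → t ≤ T →
      ‖A (timeChange T X δ s) (timeChangeLeft T X δ t)‖ ≤
        C * (Function.leftLim F t - F s) ^ α := by
    intro s t hs hst ht
    have hcont := (h4 _ (timeChange_mem hδ ⟨hs, hst.le.trans ht⟩)) _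
      (timeChangeLeft_mem hδ ⟨hs.trans hst.le, ht⟩)
    have hlim : Tendsto (fun t' => A (timeChange T X δ s) (timeChange T X δ t')) (𝓝[<] t)
        (𝓝 (A (timeChange T X δ s) (timeChangeLeft T X δ t))) := by
      refine hcont.tendsto.comp (tendsto_nhdsWithin_iff.2 ⟨tendsto_timeChange_left hδ t, ?_⟩)
      filter_upwards [Ioo_mem_nhdsLT hst] with t' ht'
      exact timeChange_mem hδ ⟨hs.trans ht'.1.le, ht'.2.le.trans ht⟩
    refine le_of_tendsto hlim.norm ?_
    filter_upwards [Ioo_mem_nhdsLT hst] with t' ht'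
    refine (h1 s t' hs ht'.1.le (ht'.2.le.trans ht)).trans (mul_le_mul_of_nonneg_left ?_ hC)
    exact Real.rpow_le_rpow (sub_nonneg.2 (hF ht'.1.le)) (by linarith [hF.le_leftLim ht'.2]) hα.le
  obtain ⟨s, hs, hus⟩ := exists_originalTime hδ hT ⟨hu, huv.trans hv⟩
  obtain ⟨t, ht, hvt⟩ := exists_originalTime hδ hT ⟨hu.trans huv, hv⟩
  set G := stretchFun T X δ F with hG
  have muv := hm ⟨hu, huv.trans hv⟩ ⟨hu.trans huv, hv⟩ huv
  have hx0 : 0 ≤ (G v - G u) ^ α := Real.rpow_nonneg (sub_nonneg.2 muv) _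
  rcases (le_of_timeChangeLeft_le hδ hus.1 hvt.2 huv).eq_or_lt with rfl | hst
  · refine (hseg s hs u v hus.1 huv hvt.2).trans ?_
    nlinarith [mul_nonneg hC hx0, mul_nonneg hK hx0]
  have hord := timeChange_lt_left hδ hst
  have ms := timeChange_mem hδ hs
  have mt := timeChangeLeft_mem hδ ht
  have g1 := hm ⟨hu, huv.trans hv⟩ ms hus.2
  have g2 := hm ms mt hord.le
  have g3 := hm mt ⟨hu.trans huv, hv⟩ hvt.1
  have pw : ∀ {x : ℝ}, 0 ≤ x → x ≤ G v - G u → C * x ^ α ≤ C * (G v - G u) ^ α := fun h h' =>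
    mul_le_mul_of_nonneg_left (Real.rpow_le_rpow h h' hα.le) hC
  have b1 := (hseg s hs u _ hus.1 hus.2 le_rfl).trans (pw (sub_nonneg.2 g1) (by linarith))
  have b2 := (hmid s t hs.1 hst ht.2).trans (pw (sub_nonneg.2 (hF.le_leftLim hst)) (by
    have e1 := leftLim_le_stretchFun hδ hF ht
    have e2 := stretchFun_timeChange hδ F hs
    rw [← hG] at e1 e2
    linarith))
  have b3 := (hseg t ht _ v le_rfl hvt.1 hvt.2).trans (pw (sub_nonneg.2 g3) (by linarith))
  -- Cutting at τ(s) and τ(t-) leaves three pieces and two failures of additivity: hence `3 * C + 2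
  -- * K`.
  have c1 := h3 u _ v hu hus.2 (hord.le.trans hvt.1) hv
  have c2 := h3 _ _ v ms.1 hord.le hvt.1 hv
  have c3 : K * (G v - G (timeChange T X δ s)) ^ α ≤ K * (G v - G u) ^ α :=
    mul_le_mul_of_nonneg_left (Real.rpow_le_rpow (by linarith) (by linarith) hα.le) hK
  linarith

theorem RoughBound.jump_le (hp : 0 < p) (hX : IsCadlagGeometric p T X) {F : ℝ → ℝ}
    (hF : RoughBound p T X F) {t : ℝ} (ht : t ∈ Ioc 0 T) :
    ‖(X.jump t).1‖ ≤ (F t - Function.leftLim F t) ^ p⁻¹ ∧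
      ‖(X.jump t).2‖ ≤ ((F t - Function.leftLim F t) ^ p⁻¹) ^ 2 := by
  have hlim : Tendsto (fun s => (F t - F s) ^ p⁻¹) (𝓝[<] t)
      (𝓝 ((F t - Function.leftLim F t) ^ p⁻¹)) :=
    (tendsto_const_nhds.sub (hF.mono.tendsto_leftLim t)).rpow_const (Or.inr (inv_nonneg.2 hp.le))
  have hj := hX.tendsto_jump ht
  constructor
  · refine le_of_tendsto_of_tendsto ((continuous_fst.tendsto _).comp hj).norm hlim ?_
    filter_upwards [Ioo_mem_nhdsLT ht.1] with s hs
    exact hF.path s t hs.1.le hs.2.le ht.2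
  · refine le_of_tendsto_of_tendsto ((continuous_snd.tendsto _).comp hj).norm (hlim.pow 2) ?_
    filter_upwards [Ioo_mem_nhdsLT ht.1] with s hs
    exact hF.second s t hs.1.le hs.2.le ht.2

/-- Traversing a fraction θ of a jump linearly costs no more than the same fraction of the control,
raised to the power α. It is applied with α = 1/p and α = 2/p, where p ≥ 2 ensures α ≤ 1. -/
theorem le_rpow_mul_of_le_one {θ x α : ℝ} (h0 : 0 ≤ θ) (h1 : θ ≤ 1) (hx : 0 ≤ x)
    (hα1 : α ≤ 1) : θ * x ^ α ≤ (θ * x) ^ α := by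
  rw [Real.mul_rpow h0 hx]
  refine mul_le_mul_of_nonneg_right ?_ (Real.rpow_nonneg hx _)
  rcases h0.eq_or_lt with rfl | h
  · exact Real.rpow_nonneg le_rfl _
  · exact Real.self_le_rpow_of_le_one h0 h1 hα1

theorem RoughBound.stretched (hp : 2 ≤ p) (hX : IsCadlagGeometric p T X)
    (hδ : IsStretchLength T X δ) (hT : 0 < T) {F : ℝ → ℝ} (hF : RoughBound p T X F) :
    ∃ C, 0 ≤ C ∧ ∀ u v, 0 ≤ u → u ≤ v → v ≤ stretchedLength T X δ →
      ‖incr (stretched T X δ).path u v‖ ≤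
        C * (stretchFun T X δ F v - stretchFun T X δ F u) ^ p⁻¹ ∧
      ‖(stretched T X δ).second u v‖ ≤
        C * (stretchFun T X δ F v - stretchFun T X δ F u) ^ (p / 2)⁻¹ := by
  have hp0 : 0 < p := by linarith
  have hp1 : p⁻¹ ≤ 1 := inv_le_one_of_one_le₀ (by linarith)
  have hp2 : (p / 2)⁻¹ ≤ 1 := inv_le_one_of_one_le₀ (by linarith)
  have hm := stretchFun_monotoneOn hδ hT hF.mono
  have hinc : ∀ s t, 0 ≤ s → s ≤ t → t ≤ T →
      incr (CadlagRDE.stretched T X δ).path (timeChange T X δ s) (timeChange T X δ t) =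
        incr X.path s t ∧
      (CadlagRDE.stretched T X δ).second (timeChange T X δ s) (timeChange T X δ t) =
        X.second s t := fun s t h1 h2 h3 =>
    Prod.ext_iff.1 (stretched_inc_timeChange hX hδ h1 h2 h3)
  have hgap : ∀ t, 0 ≤ F t - Function.leftLim F t := fun t =>
    sub_nonneg.2 (hF.mono.leftLim_le le_rfl)
  have hθ : ∀ t ∈ X.jumpTimes T, ∀ u v, timeChangeLeft T X δ t ≤ u → u ≤ v →
      v ≤ timeChange T X δ t → 0 ≤ (v - u) / δ t ∧ (v - u) / δ t ≤ 1 := by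
    intro t ht u v hu huv hv
    have h0 := hδ.1 t ht
    refine ⟨div_nonneg (by linarith) h0.le, ?_⟩
    rw [div_le_one h0, ← timeChange_sub_left hδ ht]
    linarith
  have hseg : ∀ t ∈ X.jumpTimes T, ∀ u v, timeChangeLeft T X δ t ≤ u → u ≤ v →
      v ≤ timeChange T X δ t → (CadlagRDE.stretched T X δ).inc u v =
        texp (((v - u) / δ t) • tlog (X.jump t)) := fun t ht u v hu huv hv =>
    stretched_inc_segment hX hδ ht ⟨hu, huv.trans hv⟩ ⟨hu.trans huv, hv⟩
  have B1 : ∀ u v, 0 ≤ u → u ≤ v → v ≤ stretchedLength T X δ →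
      ‖incr (CadlagRDE.stretched T X δ).path u v‖ ≤
        (3 * 1 + 2 * 0) * (stretchFun T X δ F v - stretchFun T X δ F u) ^ p⁻¹ := by
    refine norm_le_stretchFun hδ hT hF.mono (inv_pos.2 hp0) zero_le_one le_rfl ?_ ?_ ?_ ?_
    · intro s t h1 h2 h3
      rw [(hinc s t h1 h2 h3).1, one_mul]
      exact hF.path s t h1 h2 h3
    · intro t ht u v hu huv hv
      obtain ⟨q0, q1⟩ := hθ t ht u v hu huv hv
      have e : incr (CadlagRDE.stretched T X δ).path u v = ((v - u) / δ t) • (X.jump t).1 :=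
        congrArg Prod.fst (hseg t ht u v hu huv hv)
      rw [e, norm_smul, Real.norm_of_nonneg q0, one_mul]
      exact (mul_le_mul_of_nonneg_left (hF.jump_le hp0 hX ht.1).1 q0).trans
        (le_rpow_mul_of_le_one q0 q1 (hgap t) hp1)
    · intro u v w _ _ _ _
      rw [zero_mul, add_zero]
      have : incr (CadlagRDE.stretched T X δ).path u w =
          incr (CadlagRDE.stretched T X δ).path u v +
            incr (CadlagRDE.stretched T X δ).path v w := by simp [incr]
      rw [this]
      exact norm_add_le _ _
    · intro u _
      exact (continuousOn_stretched_inc hX hδ hT u).fst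
  -- The 9 is 3 · 3: the failure of additivity is Chen's cross term, a product of two first-level
  -- increments bounded by `B1`. The other 3 dominates 2 + 1/2, from the logarithm and the quadratic
  -- part of the exponential on a jump interval.
  have B2 : ∀ u v, 0 ≤ u → u ≤ v → v ≤ stretchedLength T X δ →
      ‖(CadlagRDE.stretched T X δ).second u v‖ ≤
        (3 * 3 + 2 * 9) * (stretchFun T X δ F v - stretchFun T X δ F u) ^ (p / 2)⁻¹ := by
    refine norm_le_stretchFun hδ hT hF.mono (inv_pos.2 (half_pos hp0)) (by norm_num) (by norm_num)
      ?_ ?_ ?_ ?_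
    · intro s t h1 h2 h3
      rw [(hinc s t h1 h2 h3).2]
      have := hF.second s t h1 h2 h3
      have h0 := sub_nonneg.2 (hF.mono h2)
      rw [← rpow_inv_half h0] at this
      have := Real.rpow_nonneg h0 (p / 2)⁻¹
      linarith
    · intro t ht u v hu huv hv
      obtain ⟨q0, q1⟩ := hθ t ht u v hu huv hv
      have e : (CadlagRDE.stretched T X δ).second u v =
          (texp (((v - u) / δ t) • tlog (X.jump t))).2 :=
        (Prod.ext_iff.1 (hseg t ht u v hu huv hv)).2
      obtain ⟨j1, j2⟩ := hF.jump_le hp0 hX ht.1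
      set θ := (v - u) / δ t
      set x := (F t - Function.leftLim F t) ^ p⁻¹ with hx
      have hx0 : 0 ≤ x := (norm_nonneg _).trans j1
      have n1 : ‖(tlog (X.jump t)).2‖ ≤ 2 * x ^ 2 := by
        have a1 : ‖tensor (X.jump t).1 (X.jump t).1‖ ≤ x * x := by
          rw [norm_tensor]
          exact mul_le_mul j1 j1 (norm_nonneg _) hx0
        simp only [tlog]
        refine (norm_sub_le _ _).trans ?_
        rw [norm_smul, Real.norm_of_nonneg (by norm_num)]
        nlinarith
      have n2 : ‖tensor (θ • (X.jump t).1) (θ • (X.jump t).1)‖ ≤ θ * x ^ 2 := by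
        rw [norm_tensor, norm_smul, Real.norm_of_nonneg q0]
        have a1 : θ * ‖(X.jump t).1‖ ≤ θ * x := mul_le_mul_of_nonneg_left j1 q0
        have a2 : θ * ‖(X.jump t).1‖ ≤ 1 * x := mul_le_mul q1 j1 (norm_nonneg _) zero_le_one
        calc _ ≤ (θ * x) * (1 * x) := mul_le_mul a1 a2 (by positivity) (by positivity)
          _ = θ * x ^ 2 := by ring
      have hy : θ * x ^ 2 ≤ (θ * (F t - Function.leftLim F t)) ^ (p / 2)⁻¹ := by
        rw [hx, ← rpow_inv_half (hgap t)]
        exact le_rpow_mul_of_le_one q0 q1 (hgap t) hp2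
      rw [e]
      simp only [texp, Prod.smul_fst, Prod.smul_snd]
      change ‖θ • (tlog (X.jump t)).2 +
        (1 / 2 : ℝ) • tensor (θ • (X.jump t).1) (θ • (X.jump t).1)‖ ≤ _
      refine (norm_add_le _ _).trans ?_
      rw [norm_smul, norm_smul, Real.norm_of_nonneg q0, Real.norm_of_nonneg (by norm_num)]
      have := mul_le_mul_of_nonneg_left n1 q0
      have := mul_nonneg q0 (sq_nonneg x)
      nlinarith
    · intro u v w h1 h2 h3 h4
      have hch := stretched_chen (T := T) (X := X) (δ := δ) u v w
      have e : (CadlagRDE.stretched T X δ).second u w =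
          (CadlagRDE.stretched T X δ).second u v + (CadlagRDE.stretched T X δ).second v w +
          tensor (incr (CadlagRDE.stretched T X δ).path u v)
            (incr (CadlagRDE.stretched T X δ).path v w) := by rw [← hch]; abel
      have mu : u ∈ Icc 0 (stretchedLength T X δ) := ⟨h1, h2.trans (h3.trans h4)⟩
      have mv : v ∈ Icc 0 (stretchedLength T X δ) := ⟨h1.trans h2, h3.trans h4⟩
      have mw : w ∈ Icc 0 (stretchedLength T X δ) := ⟨h1.trans (h2.trans h3), h4⟩
      have guv := hm mu mv h2
      have gvw := hm mv mw h3
      set y := (stretchFun T X δ F w - stretchFun T X δ F u) ^ p⁻¹ with hy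
      have b1 : ‖incr (CadlagRDE.stretched T X δ).path u v‖ ≤ 3 * y := by
        refine (B1 u v h1 h2 (h3.trans h4)).trans ?_
        rw [show (3 * 1 + 2 * 0 : ℝ) = 3 by norm_num]
        exact mul_le_mul_of_nonneg_left (Real.rpow_le_rpow (by linarith) (by linarith)
          (inv_nonneg.2 hp0.le)) (by norm_num)
      have b2 : ‖incr (CadlagRDE.stretched T X δ).path v w‖ ≤ 3 * y := by
        refine (B1 v w (h1.trans h2) h3 h4).trans ?_
        rw [show (3 * 1 + 2 * 0 : ℝ) = 3 by norm_num]
        exact mul_le_mul_of_nonneg_left (Real.rpow_le_rpow (by linarith) (by linarith)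
          (inv_nonneg.2 hp0.le)) (by norm_num)
      rw [e, rpow_inv_half (by linarith), ← hy]
      refine (norm_add₃_le).trans ?_
      rw [norm_tensor]
      have := mul_le_mul b1 b2 (norm_nonneg _) ((norm_nonneg _).trans b1)
      nlinarith
    · intro u _
      exact (continuousOn_stretched_inc hX hδ hT u).snd
  refine ⟨27, by norm_num, fun u v h1 h2 h3 => ⟨(B1 u v h1 h2 h3).trans ?_,
    (B2 u v h1 h2 h3).trans_eq (by norm_num)⟩⟩
  have h0 := hm ⟨h1, h2.trans h3⟩ ⟨h1.trans h2, h3⟩ h2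
  exact mul_le_mul_of_nonneg_right (by norm_num) (Real.rpow_nonneg (sub_nonneg.2 h0) _)

theorem stretched_isRough (hp : 2 ≤ p) (hX : IsCadlagGeometric p T X)
    (hδ : IsStretchLength T X δ) (hT : 0 < T) :
    IsRough p (stretchedLength T X δ) (stretched T X δ) := by
  have hp0 : 0 < p := by linarith
  obtain ⟨F, hF⟩ := hX.rough.exists_roughBound hp0
  obtain ⟨C, hC, hb⟩ := hF.stretched hp hX hδ hT
  have hm := stretchFun_monotoneOn hδ hT hF.mono
  exact ⟨fun s u t _ _ _ _ => stretched_chen s u t,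
    finiteVar_of_norm_le hp0 hC hm fun s t h1 h2 h3 => (hb s t h1 h2 h3).1,
    finiteVar_of_norm_le (half_pos hp0) hC hm fun s t h1 h2 h3 => (hb s t h1 h2 h3).2⟩

theorem stretched_isContinuousGeometric (hp : 2 ≤ p) (hX : IsCadlagGeometric p T X)
    (hδ : IsStretchLength T X δ) (hT : 0 < T) :
    IsContinuousGeometric p (stretchedLength T X δ) (stretched T X δ) :=
  ⟨stretched_isRough hp hX hδ hT, continuousOn_stretched_inc hX hδ hT 0,
    stretched_geometric hX hδ hT⟩

end StretchedVariation

/-! ### Uniqueness, a priori bounds and time rescaling for ODEs -/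

section ODE

theorem hasDerivWithinAt_Ici_of_Icc {V : Type*} [NormedAddCommGroup V] [NormedSpace ℝ V]
    {y : ℝ → V} {y' : V} {a b r : ℝ} (hr : r ∈ Ico a b)
    (h : HasDerivWithinAt y y' (Icc a b) r) : HasDerivWithinAt y y' (Ici r) r :=
  h.mono_of_mem_nhdsWithin (Icc_mem_nhdsGE_of_mem hr)

theorem ode_unique {e : ℕ} {g : E e → E e} (hg : ContDiff ℝ 1 g) {a b : ℝ} {y z : ℝ → E e}
    (hy : ∀ r ∈ Icc a b, HasDerivWithinAt y (g (y r)) (Icc a b) r)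
    (hz : ∀ r ∈ Icc a b, HasDerivWithinAt z (g (z r)) (Icc a b) r) (h : y a = z a) :
    EqOn y z (Icc a b) := by
  have cy : ContinuousOn y (Icc a b) := fun r hr => (hy r hr).continuousWithinAt
  have cz : ContinuousOn z (Icc a b) := fun r hr => (hz r hr).continuousWithinAt
  obtain ⟨ρ₁, h1⟩ := isCompact_Icc.exists_bound_of_continuousOn cy
  obtain ⟨ρ₂, h2⟩ := isCompact_Icc.exists_bound_of_continuousOn cz
  obtain ⟨K, hK⟩ := hg.contDiffOn.exists_lipschitzOnWith
    (s := Metric.closedBall (0 : E e) (max ρ₁ ρ₂))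
    one_ne_zero (convex_closedBall _ _) (isCompact_closedBall _ _)
  refine ODE_solution_unique_of_mem_Icc_right (v := fun _ => g)
    (s := fun _ => Metric.closedBall (0 : E e) (max ρ₁ ρ₂)) (fun _ _ => hK) cy
    (fun r hr => hasDerivWithinAt_Ici_of_Icc hr (hy r (Ico_subset_Icc_self hr))) (fun r hr => ?_)
    cz (fun r hr => hasDerivWithinAt_Ici_of_Icc hr (hz r (Ico_subset_Icc_self hr)))
    (fun r hr => ?_) h
  · rw [mem_closedBall_zero_iff]
    exact (h1 r (Ico_subset_Icc_self hr)).trans (le_max_left _ _)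
  · rw [mem_closedBall_zero_iff]
    exact (h2 r (Ico_subset_Icc_self hr)).trans (le_max_right _ _)

/-- A solution of an ODE stays close to its initial value as long as the vector field is small on a
neighbourhood of the initial value. -/
theorem norm_sub_le_of_small_field {V : Type*} [NormedAddCommGroup V] [NormedSpace ℝ V]
    {g : V → V} {a b ρ m m' : ℝ} {y : ℝ → V} (hm : m < m') (hm1 : m' * (b - a) ≤ 1)
    (hm0 : 0 ≤ m') (hya : ‖y a‖ ≤ ρ) (hg : ∀ z ∈ Metric.closedBall (0 : V) (ρ + 1), ‖g z‖ ≤ m)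
    (hy : ∀ r ∈ Icc a b, HasDerivWithinAt y (g (y r)) (Icc a b) r) :
    ∀ r ∈ Icc a b, ‖y r - y a‖ ≤ m' * (r - a) := by
  have cy : ContinuousOn y (Icc a b) := fun r hr => (hy r hr).continuousWithinAt
  intro r hr
  -- The strict inequality of derivatives is needed only at contact with the boundary function;
  -- there the displacement equals `m' * (r - a) ≤ 1`, so `y r` is in the ball where `g` is bounded.
  refine image_norm_le_of_norm_deriv_right_lt_deriv_boundary (f := fun r => y r - y a)
    (f' := fun r => g (y r)) (B := fun r => m' * (r - a)) (B' := fun _ => m')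
        (cy.sub continuousOn_const)
    (fun r hr => (hasDerivWithinAt_Ici_of_Icc hr (hy r (Ico_subset_Icc_self hr))).sub_const _)
    (by simp) (fun r => ?_) (fun r hr h => ?_) hr
  · simpa using ((hasDerivAt_id r).sub_const a).const_mul m'
  · refine (hg (y r) ?_).trans_lt hm
    rw [mem_closedBall_zero_iff]
    have h1 : m' * (r - a) ≤ m' * (b - a) := mul_le_mul_of_nonneg_left (by linarith [hr.2]) hm0
    have h2 := norm_add_le (y r - y a) (y a)
    rw [sub_add_cancel] at h2
    linarith

theorem hasDerivWithinAt_rescale {V : Type*} [NormedAddCommGroup V] [NormedSpace ℝ V]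
    {g : V → V} {y : ℝ → V} {a b c : ℝ} (hc : 0 < c) (hab : b - a = c)
    (hy : ∀ θ ∈ Icc (0 : ℝ) 1, HasDerivWithinAt y (g (y θ)) (Icc 0 1) θ) :
    ∀ r ∈ Icc a b, HasDerivWithinAt (fun r => y ((r - a) / c)) (c⁻¹ • g (y ((r - a) / c)))
      (Icc a b) r := by
  intro r hr
  have hmaps : MapsTo (fun r => (r - a) / c) (Icc a b) (Icc 0 1) := fun x hx =>
    ⟨div_nonneg (sub_nonneg.2 hx.1) hc.le, by rw [div_le_one hc]; linarith [hx.2]⟩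
  have h1 : HasDerivWithinAt (fun r => (r - a) / c) c⁻¹ (Icc a b) r := by
    have := ((hasDerivWithinAt_id r (Icc a b)).sub_const a).div_const c
    rwa [one_div] at this
  exact (hy _ (hmaps hr)).scomp r h1 hmaps

theorem hasDerivWithinAt_unscale {V : Type*} [NormedAddCommGroup V] [NormedSpace ℝ V]
    {g : V → V} {y : ℝ → V} {a b c : ℝ} (hc : 0 < c) (hab : b - a = c)
    (hy : ∀ r ∈ Icc a b, HasDerivWithinAt y (c⁻¹ • g (y r)) (Icc a b) r) :
    ∀ θ ∈ Icc (0 : ℝ) 1, HasDerivWithinAt (fun θ => y (a + θ * c)) (g (y (a + θ * c)))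
      (Icc 0 1) θ := by
  intro θ hθ
  have hmaps : MapsTo (fun θ => a + θ * c) (Icc 0 1) (Icc a b) := fun x hx =>
    ⟨by nlinarith [hx.1], by nlinarith [hx.2]⟩
  have h1 : HasDerivWithinAt (fun θ => a + θ * c) c (Icc 0 1) θ := by
    simpa using ((hasDerivWithinAt_id θ (Icc 0 1)).mul_const c).const_add a
  have := (hy _ (hmaps hθ)).scomp θ h1 hmaps
  rwa [smul_smul, mul_inv_cancel₀ hc.ne', one_smul] at this

end ODE

/-! ### The rough integral along a jump interval -/

section Segment

variable {d e : ℕ} {p T : ℝ} {X : RoughData d} {δ : ℝ → ℝ}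

/-- The quadratic part is of order θ², so it disappears from fine Riemann sums and only the linear
part contributes. -/
theorem texp_smul (θ : ℝ) (x : T2 d) :
    texp (θ • x) = θ • x + (θ ^ 2 / 2) • ((0 : E d), tensor x.1 x.1) := by
  ext
  · simp [texp]
  · simp [texp]; ring

theorem contDiff_smul_jumpField {f : E e → (E d →L[ℝ] E e)} (hf : ContDiff ℝ 2 f)
    (hX : IsCadlagGeometric p T X) {t : ℝ} (ht : t ∈ Ioc 0 T) (c : ℝ) :
    ContDiff ℝ 1 fun z => c • jumpField f (X.jump t) z := by
  have : (fun z => c • jumpField f (X.jump t) z) = fun z => c • field f z (tlog (X.jump t)) :=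
    funext fun z => by rw [jumpField_eq_field hf (hX.jump_mem ht)]
  rw [this]
  exact ((contDiff_field hf).clm_apply contDiff_const).const_smul c

/-- On the interval of a jump, rough integrals are Riemann integrals. -/
theorem hasDerivWithinAt_integral_segment {f : E e → (E d →L[ℝ] E e)} (hf : ContDiff ℝ 2 f)
    (hX : IsCadlagGeometric p T X) (hδ : IsStretchLength T X δ) {t : ℝ} (ht : t ∈ X.jumpTimes T)
    {Z I : ℝ → E e} (hZ : ContinuousOn Z (Icc (timeChangeLeft T X δ t) (timeChange T X δ t)))
    (hI : ∀ u v, timeChangeLeft T X δ t ≤ u → u ≤ v → v ≤ timeChange T X δ t →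
      MRSLim u v (roughGerm f (stretched T X δ) Z) (I v - I u)) :
    ∀ r ∈ Icc (timeChangeLeft T X δ t) (timeChange T X δ t),
      HasDerivWithinAt I ((δ t)⁻¹ • jumpField f (X.jump t) (Z r))
        (Icc (timeChangeLeft T X δ t) (timeChange T X δ t)) r := by
  set a := timeChangeLeft T X δ t with ha
  set b := timeChange T X δ t with hb
  have hδ0 := hδ.1 t ht
  set l := tlog (X.jump t) with hl
  have hfc : Continuous (field f) := (contDiff_field hf).continuous
  have hc : ContinuousOn (fun r => field f (Z r)) (Icc a b) := hfc.comp_continuousOn hZ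
  obtain ⟨M, hM⟩ := isCompact_Icc.exists_bound_of_continuousOn hc
  have key : ∀ r ∈ Icc a b, ∀ κ > 0, ∀ u v, a ≤ u → u ≤ v → v ≤ b →
      (∀ w ∈ Icc u v, ‖field f (Z w) l - field f (Z r) l‖ ≤ κ) →
      ‖(I v - I u) - ((v - u) / δ t) • field f (Z r) l‖ ≤ κ * ((v - u) / δ t) := by
    intro r hr κ hκ u v hu huv hv hw
    refine le_of_forall_pos_le_add fun ε hε => ?_
    set Q := ‖((0 : E d), tensor l.1 l.1)‖ with hQ
    -- With mesh below `ε / B`, the quadratic terms of all intervals add up to at most `ε`; the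
    -- added ones keep `B` positive.
    set B := (|M| * Q + 1) * ((v - u) / δ t + 1) / δ t with hB
    have hvu : 0 ≤ (v - u) / δ t := div_nonneg (sub_nonneg.2 huv) hδ0.le
    have hB0 : 0 < B := by positivity
    refine (hI u v hu huv hv).norm_sub_le_of_fine huv (div_pos hε hB0) fun n w hwp hmesh => ?_
    have e1 : ((v - u) / δ t) • field f (Z r) l =
        ∑ i ∈ Finset.range n, ((w (i + 1) - w i) / δ t) • field f (Z r) l := by
      rw [← Finset.sum_smul, ← Finset.sum_div, Finset.sum_range_sub, hwp.2.1, hwp.2.2]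
    have e2 : κ * ((v - u) / δ t) + ε / B * (|M| * Q * ((v - u) / δ t) / δ t) =
        ∑ i ∈ Finset.range n, (κ * ((w (i + 1) - w i) / δ t) +
          ε / B * (|M| * Q * ((w (i + 1) - w i) / δ t) / δ t)) := by
      rw [Finset.sum_add_distrib, ← Finset.mul_sum, ← Finset.mul_sum, ← Finset.sum_div,
        ← Finset.sum_div, ← Finset.mul_sum, ← Finset.sum_div, Finset.sum_range_sub,
        hwp.2.1, hwp.2.2]
    have e3 : ε / B * (|M| * Q * ((v - u) / δ t) / δ t) ≤ ε := by
      rw [div_mul_eq_mul_div, div_le_iff₀ hB0]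
      refine mul_le_mul_of_nonneg_left ?_ hε.le
      rw [hB]
      refine div_le_div_of_nonneg_right ?_ hδ0.le
      have : 0 ≤ |M| * Q := by positivity
      nlinarith
    refine le_trans ?_ (add_le_add_right e3 _)
    rw [e2, e1, partSum, ← Finset.sum_sub_distrib]
    refine norm_sum_le_of_le _ fun i hi => ?_
    have hi := Finset.mem_range.1 hi
    have m1 := hwp.mem_Icc hi.le
    have m2 := hwp.mem_Icc (i := i + 1) hi
    have h12 := hwp.1 (Nat.le_succ i)
    have s1 : w i ∈ Icc a b := ⟨hu.trans m1.1, m1.2.trans hv⟩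
    have s2 : w (i + 1) ∈ Icc a b := ⟨hu.trans m2.1, m2.2.trans hv⟩
    set θ := (w (i + 1) - w i) / δ t with hθ
    have hθ0 : 0 ≤ θ := div_nonneg (sub_nonneg.2 h12) hδ0.le
    rw [roughGerm_eq_field, stretched_inc_segment hX hδ ht s1 s2, texp_smul, map_add, map_smul,
      map_smul, ← hl, ← hθ, add_sub_right_comm, ← smul_sub]
    refine (norm_add_le _ _).trans (add_le_add ?_ ?_)
    · rw [norm_smul, Real.norm_of_nonneg hθ0, mul_comm]
      exact mul_le_mul_of_nonneg_right (hw _ m1) hθ0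
    · rw [norm_smul, Real.norm_of_nonneg (by positivity)]
      have n1 : ‖field f (Z (w i)) ((0 : E d), tensor l.1 l.1)‖ ≤ |M| * Q :=
        (ContinuousLinearMap.le_opNorm _ _).trans (mul_le_mul_of_nonneg_right
          ((hM _ s1).trans (le_abs_self M)) (norm_nonneg _))
      have n2 : θ ≤ ε / B / δ t := div_le_div_of_nonneg_right (hmesh i hi).le hδ0.le
      calc θ ^ 2 / 2 * ‖field f (Z (w i)) ((0 : E d), tensor l.1 l.1)‖
          ≤ θ * θ * (|M| * Q) := by
            refine mul_le_mul ?_ n1 (norm_nonneg _) (by positivity)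
            nlinarith
        _ ≤ (ε / B / δ t) * θ * (|M| * Q) := by gcongr
        _ = ε / B * (|M| * Q * θ / δ t) := by ring
  intro r hr
  have hjf : jumpField f (X.jump t) (Z r) = field f (Z r) l := jumpField_eq_field hf
    (hX.jump_mem ht.1) _
  rw [hjf, hasDerivWithinAt_iff_isLittleO, Asymptotics.isLittleO_iff]
  intro c hc0
  have hcl : ContinuousWithinAt (fun w => field f (Z w) l) (Icc a b) r :=
    (hc.clm_apply continuousOn_const) r hr
  obtain ⟨ρ, hρ, hρ'⟩ := Metric.continuousWithinAt_iff.1 hcl (c * δ t) (by positivity)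
  filter_upwards [self_mem_nhdsWithin, nhdsWithin_le_nhds (Metric.ball_mem_nhds r hρ)] with x hx hxr
  have hfin : c * δ t * (|x - r| / δ t) = c * ‖x - r‖ := by
    rw [Real.norm_eq_abs]; field_simp
  rcases le_total r x with h | h
  · have := key r hr (c * δ t) (by positivity) r x hr.1 h hx.2 fun w hw => by
      rw [← dist_eq_norm]
      refine (hρ' ⟨hr.1.trans hw.1, hw.2.trans hx.2⟩ ?_).le
      refine lt_of_le_of_lt ?_ hxr
      rw [Real.dist_eq, Real.dist_eq, abs_of_nonneg (sub_nonneg.2 hw.1),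
        abs_of_nonneg (sub_nonneg.2 h)]
      linarith [hw.2]
    rw [← hfin, abs_of_nonneg (sub_nonneg.2 h), smul_smul, ← div_eq_mul_inv]
    exact this
  · have := key r hr (c * δ t) (by positivity) x r hx.1 h hr.2 fun w hw => by
      rw [← dist_eq_norm]
      refine (hρ' ⟨hx.1.trans hw.1, hw.2.trans hr.2⟩ ?_).le
      refine lt_of_le_of_lt ?_ hxr
      rw [Real.dist_eq, Real.dist_eq, abs_of_nonpos (sub_nonpos.2 hw.2),
        abs_of_nonpos (sub_nonpos.2 h)]
      linarith [hw.1]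
    rw [← hfin, abs_of_nonpos (sub_nonpos.2 h), smul_smul, ← div_eq_mul_inv, neg_sub, ← norm_neg]
    have hneg : -(I x - I r - ((x - r) / δ t) • field f (Z r) l) =
        I r - I x - ((r - x) / δ t) • field f (Z r) l := by
      rw [show (x - r) / δ t = -((r - x) / δ t) by ring, neg_smul]
      abel
    rw [hneg]
    exact this

end Segment

/-! ### Refinement limits of a defect that survives only across jumps -/

section JumpSum

variable {d : ℕ} {T : ℝ} {X : RoughData d} {δ : ℝ → ℝ}

/-- The intervals [H s, G s] are ordered as their indices and do not overlap; the induction adds the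
largest index last. -/
theorem sum_gaps_le {G H : ℝ → ℝ} (h0 : ∀ a, 0 < a → G 0 ≤ H a) (hGH : ∀ a b, a < b → G a ≤ H b)
    (S : Finset ℝ) : ∀ b, 0 < b → (∀ x ∈ S, 0 < x ∧ x < b) →
      ∑ s ∈ S, (G s - H s) ≤ H b - G 0 := by
  classical
  induction S using Finset.induction_on_max with
  | empty => intro b hb _; simpa using h0 b hb
  | insert a S hlt ih =>
    intro b hb hS
    have ha := hS a (Finset.mem_insert_self a S)
    rw [Finset.sum_insert fun h => lt_irrefl _ (hlt a h)]
    have h1 := ih a ha.1 fun x hx => ⟨(hS x (Finset.mem_insert_of_mem hx)).1, hlt x hx⟩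
    have h2 := hGH a b ha.2
    linarith

/-- The increments of a monotone function over the extra intervals are summable. -/
theorem summable_gaps (hδ : IsStretchLength T X δ) {F : ℝ → ℝ} (hF : Monotone F) (t : ℝ) :
    Summable fun s : Ioc 0 t => F (timeChange T X δ s) - F (timeChangeLeft T X δ s) := by
  refine summable_of_sum_le (c := F (timeChangeLeft T X δ (|t| + 1)) - F (timeChange T X δ 0))
    (fun s => sub_nonneg.2 (hF (timeChangeLeft_le hδ s))) fun u => ?_
  have h := sum_gaps_le (G := fun s => F (timeChange T X δ s))
    (H := fun s => F (timeChangeLeft T X δ s)) (fun a ha => hF (timeChange_lt_left hδ ha).le)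
    (fun a b hab => hF (timeChange_lt_left hδ hab).le) (u.map (Function.Embedding.subtype _))
    (|t| + 1) (by positivity) (fun x hx => by
      obtain ⟨s, -, rfl⟩ := Finset.mem_map.1 hx
      exact ⟨s.2.1, by
        have := s.2.2; have := le_abs_self t
        simp only [Function.Embedding.subtype_apply]; linarith⟩)
  simpa using h

/-- The grid consists of the original times of a fine partition of [0, T̃], cut off at t. The
distance ends at τ(b-) rather than τ(b), since no partition of the original interval can subdivide a
jump at b. -/
theorem exists_grid (hδ : IsStretchLength T X δ) (hT : 0 < T) {t ρ : ℝ} (ht : t ∈ Icc 0 T)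
    (hρ : 0 < ρ) : ∃ P : Finset ℝ, (P : Set ℝ) ⊆ Icc 0 t ∧ ∀ a b, 0 ≤ a → a < b → b ≤ t →
      (∀ x ∈ P, x ∉ Ioo a b) → timeChangeLeft T X δ b - timeChange T X δ a < ρ := by
  classical
  obtain ⟨n, q, hq, hmesh⟩ := exists_fine_partition (stretchedLength_pos hδ hT).le hρ
  have hex : ∀ i ≤ n, ∃ s ∈ Icc 0 T, q i ∈ Icc (timeChangeLeft T X δ s) (timeChange T X δ s) :=
    fun i hi => exists_originalTime hδ hT (hq.mem_Icc hi)
  choose! o ho ho' using hex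
  refine ⟨(Finset.range (n + 1)).image fun i => min (o i) t, ?_, fun a b ha hab hb hP => ?_⟩
  · intro x hx
    simp only [Finset.coe_image, Finset.coe_range, mem_image, mem_Iio] at hx
    obtain ⟨i, hi, rfl⟩ := hx
    exact ⟨le_min (ho i (by omega)).1 ht.1, min_le_right _ _⟩
  have hlt := timeChange_lt_left hδ hab
  have hbT := (timeChangeLeft_mem hδ ⟨ha.trans hab.le, hb.trans ht.2⟩).2
  have hn : ∃ k, timeChange T X δ a < q k := ⟨n, by rw [hq.2.2]; exact hlt.trans_le hbT⟩
  -- The first fine point beyond τ(a) is within ρ of its predecessor, which is at most τ(a). If the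
  -- distance to τ(b-) were at least ρ, its original time would be a grid point strictly between `a`
  -- and `b`.
  set k := Nat.find hn with hk
  have hk1 : timeChange T X δ a < q k := Nat.find_spec hn
  have hkn : k ≤ n := Nat.find_min' hn (by rw [hq.2.2]; exact hlt.trans_le hbT)
  have hk0 : k ≠ 0 := by
    intro h
    rw [h, hq.2.1] at hk1
    exact (timeChange_nonneg hδ ha).not_gt hk1
  obtain ⟨l, hl⟩ := Nat.exists_eq_succ_of_ne_zero hk0
  have hl1 : q l ≤ timeChange T X δ a := not_lt.1 (Nat.find_min hn (by omega : l < Nat.find hn))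
  have hm := hmesh l (by omega)
  rw [hl, Nat.succ_eq_add_one] at hk1
  by_contra hcon
  have hqb : q (l + 1) < timeChangeLeft T X δ b := by linarith
  have h1 := ho' (l + 1) (by omega)
  have oa : a < o (l + 1) := (timeChange_strictMono hδ).lt_iff_lt.1 (hk1.trans_le h1.2)
  have ob : o (l + 1) < b := (timeChangeLeft_strictMono hδ).lt_iff_lt.1 (h1.1.trans_lt hqb)
  refine hP (o (l + 1)) (Finset.mem_image.2 ⟨l + 1, by simp; omega, ?_⟩) ⟨oa, ob⟩
  exact min_eq_left (ob.le.trans hb)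

/-- Partitions may repeat points, but each selected time is the right endpoint of exactly one
nondegenerate interval, the one that ends at its first occurrence. This turns a sum over intervals
into a sum over jumps. -/
theorem jump_intervals {t : ℝ} {n : ℕ} {u : ℕ → ℝ} (hu : IsPartition 0 t n u) (JR : Finset ℝ)
    (hJR : ∀ x ∈ JR, 0 < x ∧ ∃ i ≤ n, u i = x)
    [DecidablePred fun i => u i < u (i + 1) ∧ u (i + 1) ∈ JR] :
    InjOn (fun i => u (i + 1))
      ((Finset.range n).filter fun i => u i < u (i + 1) ∧ u (i + 1) ∈ JR) ∧
    ((Finset.range n).filter fun i => u i < u (i + 1) ∧ u (i + 1) ∈ JR).image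
      (fun i => u (i + 1)) = JR := by
  set I := (Finset.range n).filter fun i => u i < u (i + 1) ∧ u (i + 1) ∈ JR with hI
  have aux : ∀ i ∈ I, ∀ j ∈ I, i < j → u (i + 1) ≠ u (j + 1) := by
    intro i hi j hj hij h
    have := (Finset.mem_filter.1 hj).2.1
    exact ((hu.1 (Nat.succ_le_of_lt hij)).trans_lt this).ne h
  refine ⟨fun i hi j hj h => ?_, ?_⟩
  · rcases lt_trichotomy i j with h' | h' | h'
    · exact absurd h (aux i hi j hj h')
    · exact h'
    · exact absurd h.symm (aux j hj i hi h')
  · ext x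
    constructor
    · intro hx
      obtain ⟨i, hi, rfl⟩ := Finset.mem_image.1 hx
      exact (Finset.mem_filter.1 hi).2.2
    · intro hx
      obtain ⟨hx0, k, hkn, hk⟩ := hJR x hx
      have hex : ∃ k, u k = x := ⟨k, hk⟩
      have hkn : Nat.find hex ≤ n := (Nat.find_min' hex hk).trans hkn
      have hspec := Nat.find_spec hex
      have hk0 : Nat.find hex ≠ 0 := by
        intro h
        rw [h, hu.2.1] at hspec
        exact hx0.ne hspec
      obtain ⟨l, hl⟩ := Nat.exists_eq_succ_of_ne_zero hk0
      rw [hl, Nat.succ_eq_add_one] at hspec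
      refine Finset.mem_image.2 ⟨l, Finset.mem_filter.2 ⟨Finset.mem_range.2 (by omega), ?_, ?_⟩,
        hspec⟩
      · rw [hspec]
        refine lt_of_le_of_ne (hspec ▸ hu.1 (Nat.le_succ l)) fun h => ?_
        exact Nat.find_min hex (by omega : l < Nat.find hex) h
      · rw [hspec]; exact hx

theorem div_mul_le_quarter {ε c : ℝ} (hε : 0 ≤ ε) (hc : 0 ≤ c) : ε / (4 * (c + 1)) * c ≤ ε / 4 := by
  rw [div_mul_eq_mul_div, div_le_div_iff₀ (by positivity) (by positivity)]
  nlinarith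

set_option maxHeartbeats 400000 in
/-- Refinement limits of sums of a remainder which is small except across jumps. -/
theorem exists_hasSum_rrsLim (hδ : IsStretchLength T X δ) (hT : 0 < T) {V : Type*}
    [NormedAddCommGroup V] [CompleteSpace V] {D : ℝ → ℝ → V} {F : ℝ → ℝ} (hF : Monotone F)
    {C : ℝ}
    (hD : ∀ u v, 0 ≤ u → u ≤ v → v ≤ stretchedLength T X δ → ‖D u v‖ ≤ C * (F v - F u))
    (hs : ∀ κ > 0, ∃ ρ > 0, ∀ u v, 0 ≤ u → u ≤ v → v ≤ stretchedLength T X δ → v - u < ρ →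
      ‖D u v‖ ≤ κ * (F v - F u))
    (hcont : ∀ v ∈ Icc 0 (stretchedLength T X δ),
      ContinuousOn (fun u => D u v) (Icc 0 (stretchedLength T X δ)))
    {t : ℝ} (ht : t ∈ Icc 0 T) :
    ∃ S, HasSum (fun s : Ioc 0 t => D (timeChangeLeft T X δ s) (timeChange T X δ s)) S ∧
      RRSLim 0 t (fun s s' => D (timeChange T X δ s) (timeChange T X δ s')) S := by
  classical
  have hmem : ∀ s ∈ Ioc 0 t, s ∈ Icc 0 T := fun s hs => ⟨hs.1.le, hs.2.trans ht.2⟩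
  set τ := timeChange T X δ with hτ
  set σ := timeChangeLeft T X δ with hσ
  have hsum : Summable fun s : Ioc 0 t => D (σ s) (τ s) := by
    refine Summable.of_norm_bounded ((summable_gaps hδ hF t).mul_left C) fun s => ?_
    exact hD _ _ (timeChangeLeft_nonneg hδ s.2.1.le) (timeChangeLeft_le hδ s)
      (timeChange_mem hδ (hmem s s.2)).2
  obtain ⟨S, hS⟩ := hsum
  refine ⟨S, hS, fun ε hε => ?_⟩
  set Ftot := |F (stretchedLength T X δ) - F 0| with hFtot
  obtain ⟨ρ, hρ, hsmall⟩ := hs (ε / (4 * (Ftot + 1))) (by positivity)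
  obtain ⟨s₀, hs₀⟩ : ∃ s₀ : Finset (Ioc 0 t), ∀ J, s₀ ⊆ J →
      ‖∑ s ∈ J, D (σ s) (τ s) - S‖ < ε / 4 := by
    have := (Metric.tendsto_atTop.1 hS (ε / 4) (by positivity))
    simpa only [dist_eq_norm] using this
  have hgap : ∀ᶠ s : Ioc 0 t in cofinite, τ s - σ s < ρ / 3 :=
    (summable_gaps hδ monotone_id t).tendsto_cofinite_zero.eventually (gt_mem_nhds (by positivity))
  -- `J` contains enough times to approximate the whole sum, and every jump of stretched length at
  -- least ρ/3. A step not ending in `J` then has stretched length below ρ₁ + ρ/3 < ρ.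
  set J : Finset (Ioc 0 t) := s₀ ∪ (eventually_cofinite.1 hgap).toFinset with hJ
  have hJgap : ∀ s : Ioc 0 t, s ∉ J → τ s - σ s < ρ / 3 := by
    intro s hs
    by_contra hcon
    exact hs (Finset.mem_union_right _ ((eventually_cofinite.1 hgap).mem_toFinset.2 hcon))
  set ε' := ε / (4 * (J.card + 1)) with hε'
  have hε'0 : 0 < ε' := by positivity
  -- A step ending at `s` in `J` starts slightly before τ(s-); continuity of `D` in its first
  -- argument allows the start to be moved there. One ρ₁ suffices because `J` is finite.
  obtain ⟨ρ₁, hρ₁0, hρ₁ρ, hnear⟩ : ∃ ρ₁ > 0, ρ₁ ≤ ρ / 3 ∧ ∀ s ∈ J, ∀ v, 0 ≤ v → v ≤ σ s →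
      σ s - v < ρ₁ → ‖D v (τ s) - D (σ s) (τ s)‖ ≤ ε' := by
    have : ∀ᶠ r in 𝓝[>] (0 : ℝ), ∀ s ∈ J, ∀ v, 0 ≤ v → v ≤ σ s →
        σ s - v < r → ‖D v (τ s) - D (σ s) (τ s)‖ ≤ ε' := by
      refine (Finset.eventually_all J).2 fun s _ => ?_
      have hc := hcont (τ s) (timeChange_mem hδ (hmem s s.2)) (σ s)
        (timeChangeLeft_mem hδ (hmem s s.2))
      obtain ⟨r, hr, hr'⟩ := Metric.continuousWithinAt_iff.1 hc ε' hε'0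
      filter_upwards [Ioo_mem_nhdsGT hr] with x hx v hv0 hv hvx
      rw [← dist_eq_norm]
      refine (hr' ⟨hv0, hv.trans (timeChangeLeft_mem hδ (hmem s s.2)).2⟩ ?_).le
      rw [Real.dist_eq, abs_of_nonpos (sub_nonpos.2 hv)]
      linarith [hx.2]
    obtain ⟨r, h1, h2⟩ := (this.and (Ioc_mem_nhdsGT (show (0 : ℝ) < ρ / 3 by positivity))).exists
    exact ⟨r, h2.1, h2.2, h1⟩
  obtain ⟨P, hP, hgrid⟩ := exists_grid hδ hT ht hρ₁0
  refine ⟨P ∪ J.map (Function.Embedding.subtype _), ?_, fun n u hu hPu => ?_⟩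
  · intro x hx
    rcases Finset.mem_union.1 hx with hx | hx
    · exact hP hx
    · obtain ⟨s, -, rfl⟩ := Finset.mem_map.1 hx
      exact Ioc_subset_Icc_self s.2
  have hstep : ∀ i < n, u i < u (i + 1) → σ (u (i + 1)) - τ (u i) < ρ₁ := by
    intro i hi hlt
    refine hgrid _ _ (hu.mem_Icc hi.le).1 hlt (hu.mem_Icc (i := i + 1) hi).2 fun x hx hx' => ?_
    obtain ⟨j, -, rfl⟩ := hPu x (Finset.mem_union_left _ hx)
    rcases le_or_gt j i with hj | hj
    · exact (hu.1 hj).not_gt hx'.1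
    · exact (hu.1 (Nat.succ_le_of_lt hj)).not_gt hx'.2
  set JR : Finset ℝ := J.map (Function.Embedding.subtype _) with hJR
  set I := (Finset.range n).filter fun i => u i < u (i + 1) ∧ u (i + 1) ∈ JR with hI
  obtain ⟨hIinj, hIimg⟩ := jump_intervals hu JR fun x hx => by
    refine ⟨?_, hPu x (Finset.mem_union_right _ hx)⟩
    obtain ⟨s, -, rfl⟩ := Finset.mem_map.1 hx
    exact s.2.1
  rw [← hI] at hIinj hIimg
  have hIcard : I.card = J.card := by
    rw [← Finset.card_map (Function.Embedding.subtype _), ← hJR, ← hIimg,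
      Finset.card_image_of_injOn hIinj]
  have hmono : ∀ i, F (τ (u i)) ≤ F (τ (u (i + 1))) := fun i =>
    hF ((timeChange_strictMono hδ).monotone (hu.1 (Nat.le_succ i)))
  have hmemT : ∀ i ≤ n, τ (u i) ∈ Icc 0 (stretchedLength T X δ) := fun i hi =>
    timeChange_mem hδ ⟨(hu.mem_Icc hi).1, (hu.mem_Icc hi).2.trans ht.2⟩
  have b1 : ‖∑ i ∈ (Finset.range n).filter (fun i => ¬(u i < u (i + 1) ∧ u (i + 1) ∈ JR)),
      D (τ (u i)) (τ (u (i + 1)))‖ ≤ ε / 4 := by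
    have e1 : ∑ i ∈ Finset.range n, (F (τ (u (i + 1))) - F (τ (u i))) ≤ Ftot := by
      rw [Finset.sum_range_sub (fun i => F (τ (u i)))]
      refine le_trans ?_ (le_abs_self _)
      exact sub_le_sub (hF (hmemT n le_rfl).2) (hF (hmemT 0 (Nat.zero_le n)).1)
    have e2 : ∑ i ∈ (Finset.range n).filter (fun i => ¬(u i < u (i + 1) ∧ u (i + 1) ∈ JR)),
        (F (τ (u (i + 1))) - F (τ (u i))) ≤ Ftot :=
      (Finset.sum_le_sum_of_subset_of_nonneg (Finset.filter_subset _ _)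
        fun i _ _ => sub_nonneg.2 (hmono i)).trans e1
    have e3 := div_mul_le_quarter hε.le (abs_nonneg (F (stretchedLength T X δ) - F 0))
    refine le_trans ?_ ((mul_le_mul_of_nonneg_left e2 (by positivity)).trans e3)
    rw [Finset.mul_sum]
    refine norm_sum_le_of_le _ fun i hi => ?_
    obtain ⟨hin, hi⟩ := Finset.mem_filter.1 hi
    have hin := Finset.mem_range.1 hin
    have hle := hu.1 (Nat.le_succ i)
    refine hsmall _ _ (hmemT i hin.le).1 ((timeChange_strictMono hδ).monotone hle)
      (hmemT (i + 1) hin).2 ?_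
    rcases hle.eq_or_lt with h | h
    · rw [Nat.succ_eq_add_one] at h
      rw [← h, sub_self]; exact hρ
    · have hm : u (i + 1) ∈ Ioc 0 t :=
        ⟨(hu.mem_Icc hin.le).1.trans_lt h, (hu.mem_Icc (i := i + 1) hin).2⟩
      have hnot : (⟨u (i + 1), hm⟩ : Ioc 0 t) ∉ J := fun hmJ =>
        hi ⟨h, Finset.mem_map.2 ⟨_, hmJ, rfl⟩⟩
      have g1 := hJgap _ hnot
      have g2 := hstep i hin h
      simp only at g1
      linarith
  have b2 : ‖∑ i ∈ I, (D (τ (u i)) (τ (u (i + 1))) - D (σ (u (i + 1))) (τ (u (i + 1))))‖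
      ≤ ε / 4 := by
    have e1 : ∑ _i ∈ I, ε' ≤ ε / 4 := by
      rw [Finset.sum_const, hIcard, nsmul_eq_mul, mul_comm]
      exact div_mul_le_quarter hε.le (Nat.cast_nonneg _)
    refine le_trans (norm_sum_le_of_le _ fun i hi => ?_) e1
    obtain ⟨hin, hlt, hiJ⟩ := Finset.mem_filter.1 hi
    have hin := Finset.mem_range.1 hin
    obtain ⟨s, hsJ, hsu⟩ := Finset.mem_map.1 hiJ
    have hsu : (s : ℝ) = u (i + 1) := hsu
    rw [← hsu]
    refine hnear s hsJ _ (hmemT i hin.le).1 ?_ ?_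
    · rw [hsu]; exact (timeChange_lt_left hδ hlt).le
    · rw [hsu]; exact hstep i hin hlt
  have e3 : ∑ i ∈ I, D (σ (u (i + 1))) (τ (u (i + 1))) = ∑ s ∈ J, D (σ s) (τ s) := by
    rw [← Finset.sum_image (f := fun x => D (σ x) (τ x)) hIinj, hIimg,
      hJR, Finset.sum_map]
    rfl
  have b3 := hs₀ J Finset.subset_union_left
  -- Three errors of at most ε/4 each: the short steps, the shift of the starting points to τ(s-),
  -- and the tail of the jump sum.
  have e4 : partSum (fun s s' => D (τ s) (τ s')) n u - S =
      ∑ i ∈ (Finset.range n).filter (fun i => ¬(u i < u (i + 1) ∧ u (i + 1) ∈ JR)),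
        D (τ (u i)) (τ (u (i + 1))) +
      ∑ i ∈ I, (D (τ (u i)) (τ (u (i + 1))) - D (σ (u (i + 1))) (τ (u (i + 1)))) +
      (∑ s ∈ J, D (σ s) (τ s) - S) := by
    rw [partSum, ← Finset.sum_filter_add_sum_filter_not (Finset.range n)
      (fun i => u i < u (i + 1) ∧ u (i + 1) ∈ JR), Finset.sum_sub_distrib, e3]
    abel
  rw [e4]
  refine (norm_add₃_le).trans_lt ?_
  linarith

end JumpSum

/-! ### From the continuous equation to the canonical equation -/

section StretchedIntegral

variable {d e : ℕ} {p T : ℝ} {X : RoughData d} {δ : ℝ → ℝ} {f : E e → (E d →L[ℝ] E e)}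

theorem hasSum_of_forall_eq {ι V : Type*} [AddCommMonoid V] [TopologicalSpace V] {g h : ι → V}
    {a : V} (hgh : ∀ i, g i = h i) (hh : HasSum h a) : HasSum g a := funext hgh ▸ hh

theorem continuousOn_stretched_path (hX : IsCadlagGeometric p T X) (hδ : IsStretchLength T X δ)
    (hT : 0 < T) : ContinuousOn (stretched T X δ).path (Icc 0 (stretchedLength T X δ)) :=
  (continuousOn_stretchedPath hX hδ hT).fst

theorem continuousOn_stretched_inc_left (hX : IsCadlagGeometric p T X)
    (hδ : IsStretchLength T X δ) (hT : 0 < T) (v : ℝ) :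
    ContinuousOn (fun u => (stretched T X δ).inc u v) (Icc 0 (stretchedLength T X δ)) := by
  simp only [stretched_inc]
  exact continuous_tmul.comp_continuousOn
    ((continuous_tinv.comp_continuousOn (continuousOn_stretchedPath hX hδ hT)).prodMk
      continuousOn_const)

theorem stretched_inc_self (u : ℝ) : (stretched T X δ).inc u u = 0 := by
  rw [stretched_inc]; exact tinv_tmul _

theorem continuousOn_roughGerm_left (hf : ContDiff ℝ 2 f) (hX : IsCadlagGeometric p T X)
    (hδ : IsStretchLength T X δ) (hT : 0 < T) {Zt : ℝ → E e}
    (hZc : ContinuousOn Zt (Icc 0 (stretchedLength T X δ))) (v : ℝ) :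
    ContinuousOn (fun u => roughGerm f (stretched T X δ) Zt u v)
      (Icc 0 (stretchedLength T X δ)) := by
  simp only [roughGerm_eq_field]
  exact ((contDiff_field hf).continuous.comp_continuousOn hZc).clm_apply
    (continuousOn_stretched_inc_left hX hδ hT v)

theorem continuousOn_roughGerm_right (hX : IsCadlagGeometric p T X)
    (hδ : IsStretchLength T X δ) (hT : 0 < T) (Zt : ℝ → E e) (u : ℝ) :
    ContinuousOn (roughGerm f (stretched T X δ) Zt u) (Icc 0 (stretchedLength T X δ)) := by
  have : roughGerm f (stretched T X δ) Zt u = fun v =>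
    field f (Zt u) ((stretched T X δ).inc u v) := funext fun v => roughGerm_eq_field _ _ _ _ _
  rw [this]
  exact continuousOn_const.clm_apply (continuousOn_stretched_inc hX hδ hT u)

/-- On short intervals the increment of I is the germ up to a small error, and the germ is
continuous in each argument and vanishes on the diagonal. -/
theorem continuousOn_integral (hf : ContDiff ℝ 2 f) (hX : IsCadlagGeometric p T X)
    (hδ : IsStretchLength T X δ) (hT : 0 < T) {Zt I : ℝ → E e} {F : ℝ → ℝ}
    (hZc : ContinuousOn Zt (Icc 0 (stretchedLength T X δ)))
    (hF : Sewable (stretchedLength T X δ) (roughGerm f (stretched T X δ) Zt) F)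
    (hI : ∀ r ∈ Icc 0 (stretchedLength T X δ),
      MRSLim 0 r (roughGerm f (stretched T X δ) Zt) (I r)) :
    ContinuousOn I (Icc 0 (stretchedLength T X δ)) := by
  intro r hr
  rw [Metric.continuousWithinAt_iff']
  intro ε hε
  set Ftot := |F (stretchedLength T X δ) - F 0| with hFtot
  obtain ⟨ρ, hρ, hb⟩ := hF.integral_small hI (κ := ε / (4 * (Ftot + 1))) (by positivity)
  have hb' : ∀ u v, 0 ≤ u → u ≤ v → v ≤ stretchedLength T X δ → v - u < ρ →
      ‖I v - I u‖ ≤ ε / 4 + ‖roughGerm f (stretched T X δ) Zt u v‖ := by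
    intro u v h1 h2 h3 h4
    have a1 := hb u v h1 h2 h3 h4
    have a2 : F v - F u ≤ Ftot :=
      (sub_le_sub (hF.mono h3) (hF.mono h1)).trans (le_abs_self _)
    have a3 := (mul_le_mul_of_nonneg_left a2 (show 0 ≤ ε / (4 * (Ftot + 1)) by positivity)).trans
      (div_mul_le_quarter hε.le (abs_nonneg _))
    have a4 := norm_add_le (I v - I u - roughGerm f (stretched T X δ) Zt u v)
      (roughGerm f (stretched T X δ) Zt u v)
    rw [sub_add_cancel] at a4
    linarith
  have h0 : roughGerm f (stretched T X δ) Zt r r = 0 := by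
    rw [roughGerm_eq_field, stretched_inc_self, map_zero]
  have c1 := (continuousOn_roughGerm_left hf hX hδ hT hZc r r hr).norm.tendsto
  have c2 := (continuousOn_roughGerm_right (f := f) hX hδ hT Zt r r hr).norm.tendsto
  rw [h0, norm_zero] at c1 c2
  filter_upwards [self_mem_nhdsWithin, nhdsWithin_le_nhds (Metric.ball_mem_nhds r hρ),
    c1.eventually (gt_mem_nhds (half_pos hε)), c2.eventually (gt_mem_nhds (half_pos hε))]
    with x hx hxr h1 h2
  rw [Metric.mem_ball, Real.dist_eq] at hxr
  rcases le_total x r with h | h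
  · have := hb' x r hx.1 h hr.2 (by rw [abs_of_nonpos (sub_nonpos.2 h)] at hxr; linarith)
    rw [dist_comm, dist_eq_norm]
    linarith
  · have := hb' r x hr.1 h hx.2 (by rw [abs_of_nonneg (sub_nonneg.2 h)] at hxr; linarith)
    rw [dist_eq_norm]
    linarith

theorem integral_zero {Zt I : ℝ → E e}
    (hI : MRSLim 0 0 (roughGerm f (stretched T X δ) Zt) (I 0)) : I 0 = 0 := by
  have := hI.norm_sub_le le_rfl (x := 0) (C := 0) fun n u hu => by
    rw [sub_zero, partSum, Finset.sum_eq_zero, norm_zero]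
    intro i hi
    have hi := Finset.mem_range.1 hi
    have h1 := hu.mem_Icc hi.le
    have h2 := hu.mem_Icc (i := i + 1) hi
    rw [le_antisymm h1.2 h1.1, le_antisymm h2.2 h2.1, roughGerm_eq_field, stretched_inc_self,
      map_zero]
  simpa using this

/-- The rough integral over the stretched interval splits into the refinement rough integral over
the original interval and the sum of the contributions of the jumps. -/
theorem exists_hasSum_rrsLim_integral (hf : ContDiff ℝ 2 f) (hX : IsCadlagGeometric p T X)
    (hδ : IsStretchLength T X δ) (hT : 0 < T) {Z Zt I : ℝ → E e} {F : ℝ → ℝ}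
    (hZc : ContinuousOn Zt (Icc 0 (stretchedLength T X δ)))
    (hF : Sewable (stretchedLength T X δ) (roughGerm f (stretched T X δ) Zt) F)
    (hI : ∀ r ∈ Icc 0 (stretchedLength T X δ),
      MRSLim 0 r (roughGerm f (stretched T X δ) Zt) (I r))
    (hagree : ∀ t ∈ Icc 0 T, Zt (timeChange T X δ t) = Z t) {t : ℝ} (ht : t ∈ Icc 0 T) :
    ∃ S, HasSum (fun s : Ioc 0 t => I (timeChange T X δ s) - I (timeChangeLeft T X δ s) -
        field f (Zt (timeChangeLeft T X δ s)) (X.jump s)) S ∧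
      RRSLim 0 t (roughGerm f X Z) (I (timeChange T X δ t) - I 0 - S) := by
  obtain ⟨C, -, hC⟩ := hF.integral_bound hI
  have hIc := continuousOn_integral hf hX hδ hT hZc hF hI
  -- For the sewing defect, the sum along the image of a partition under τ telescopes to the
  -- increment of I minus the Riemann sum of the original germ.
  obtain ⟨S, hS, hlim⟩ := exists_hasSum_rrsLim hδ hT
    (D := fun u v => I v - I u - roughGerm f (stretched T X δ) Zt u v) hF.mono hC
    (fun κ hκ => hF.integral_small hI hκ)
    (fun v _ => (continuousOn_const.sub hIc).sub (continuousOn_roughGerm_left hf hX hδ hT hZc v)) ht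
  refine ⟨S, ?_, fun ε hε => ?_⟩
  · refine hasSum_of_forall_eq (fun s => ?_) hS
    rw [roughGerm_eq_field, stretched_inc_jump hX hδ ⟨s.2.1, s.2.2.trans ht.2⟩]
  · obtain ⟨P, hP, hb⟩ := hlim ε hε
    refine ⟨P, hP, fun n u hu hPu => ?_⟩
    have hD := hb n u hu hPu
    have e1 : partSum (fun s s' => I (timeChange T X δ s') - I (timeChange T X δ s) -
        roughGerm f (stretched T X δ) Zt (timeChange T X δ s) (timeChange T X δ s')) n u =
        I (timeChange T X δ t) - I 0 - partSum (roughGerm f X Z) n u := by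
      rw [partSum, Finset.sum_sub_distrib, Finset.sum_range_sub
          (fun i => I (timeChange T X δ (u i))),
        hu.2.1, hu.2.2, timeChange_zero, partSum]
      congr 1
      refine Finset.sum_congr rfl fun i hi => ?_
      have hi := Finset.mem_range.1 hi
      have m1 := hu.mem_Icc hi.le
      have m2 := hu.mem_Icc (i := i + 1) hi
      rw [roughGerm_eq_field, roughGerm_eq_field, hagree _ ⟨m1.1, m1.2.trans ht.2⟩,
        stretched_inc_timeChange hX hδ m1.1 (hu.1 (Nat.le_succ i)) (m2.2.trans ht.2)]
    rw [e1] at hD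
    rw [← norm_neg, neg_sub, sub_right_comm]
    exact hD

theorem jumpField_zero (z : E e) : jumpField f 0 z = 0 := by simp [jumpField]

theorem FiniteVar.comp_timeChange (hδ : IsStretchLength T X δ) {V : Type*} [Norm V] {q : ℝ}
    {A B : ℝ → ℝ → V} (h : FiniteVar q (stretchedLength T X δ) B)
    (hAB : ∀ s t, 0 ≤ s → s ≤ t → t ≤ T →
      A s t = B (timeChange T X δ s) (timeChange T X δ t)) : FiniteVar q T A := by
  obtain ⟨C, hC⟩ := h
  refine ⟨C, fun n u hu => ?_⟩
  have := hC n (fun i => timeChange T X δ (u i))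
    ⟨(timeChange_strictMono hδ).monotone.comp hu.1, by simp only [hu.2.1, timeChange_zero],
      by simp only [hu.2.2]; rfl⟩
  refine le_trans (le_of_eq (Finset.sum_congr rfl fun i hi => ?_)) this
  have hi := Finset.mem_range.1 hi
  simp only
  rw [hAB _ _ (hu.mem_Icc hi.le).1 (hu.1 (Nat.le_succ i)) (hu.mem_Icc (i := i + 1) hi).2]

theorem tendsto_comp_timeChange_left (hδ : IsStretchLength T X δ) {V : Type*} [TopologicalSpace V]
    {Zt Z : ℝ → V} (hZc : ContinuousOn Zt (Icc 0 (stretchedLength T X δ)))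
    (hagree : ∀ t ∈ Icc 0 T, Zt (timeChange T X δ t) = Z t) {t : ℝ} (ht : t ∈ Ioc 0 T) :
    Tendsto Z (𝓝[<] t) (𝓝 (Zt (timeChangeLeft T X δ t))) := by
  have hev : ∀ᶠ s in 𝓝[<] t, s ∈ Icc 0 T := by
    filter_upwards [Ioo_mem_nhdsLT ht.1] with s hs
    exact ⟨hs.1.le, hs.2.le.trans ht.2⟩
  have h1 : Tendsto (timeChange T X δ) (𝓝[<] t)
      (𝓝[Icc 0 (stretchedLength T X δ)] (timeChangeLeft T X δ t)) :=
    tendsto_nhdsWithin_iff.2 ⟨tendsto_timeChange_left hδ t,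
      hev.mono fun s hs => timeChange_mem hδ hs⟩
  refine ((hZc _ (timeChangeLeft_mem hδ ⟨ht.1.le, ht.2⟩)).tendsto.comp h1).congr' ?_
  exact hev.mono fun s hs => hagree s hs

theorem cadlagOn_comp_timeChange (hδ : IsStretchLength T X δ) {V : Type*} [TopologicalSpace V]
    {Zt Z : ℝ → V} (hZc : ContinuousOn Zt (Icc 0 (stretchedLength T X δ)))
    (hagree : ∀ t ∈ Icc 0 T, Zt (timeChange T X δ t) = Z t) : CadlagOn T Z := by
  refine ⟨fun t ht => ?_, fun t ht => ⟨_, tendsto_comp_timeChange_left hδ hZc hagree ht⟩⟩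
  rw [← continuousWithinAt_Ioi_iff_Ici]
  have hev : ∀ᶠ s in 𝓝[>] t, s ∈ Icc 0 T := by
    filter_upwards [Ioo_mem_nhdsGT ht.2] with s hs
    exact ⟨ht.1.trans hs.1.le, hs.2.le⟩
  have h1 : Tendsto (timeChange T X δ) (𝓝[>] t)
      (𝓝[Icc 0 (stretchedLength T X δ)] (timeChange T X δ t)) :=
    tendsto_nhdsWithin_iff.2 ⟨tendsto_timeChange_right hδ t,
      hev.mono fun s hs => timeChange_mem hδ hs⟩
  have htm : t ∈ Icc 0 T := ⟨ht.1, ht.2.le⟩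
  have h2 := ((hZc _ (timeChange_mem hδ htm)).tendsto.comp h1).congr'
    (hev.mono fun s hs => hagree s hs)
  rwa [hagree t htm] at h2

theorem SolvesRDE.sewable (hp : 2 ≤ p) (hp' : p < 3) (hf : ContDiff ℝ 2 f)
    (hX : IsCadlagGeometric p T X) (hδ : IsStretchLength T X δ) (hT : 0 < T) {z₀ : E e}
    {Zt : ℝ → E e} (h : SolvesRDE p (stretchedLength T X δ) f (stretched T X δ) z₀ Zt) :
    ∃ F, Sewable (stretchedLength T X δ) (roughGerm f (stretched T X δ) Zt) F :=
  sewable_roughGerm hp hp' hf (stretched_isRough hp hX hδ hT)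
    (continuousOn_stretched_path hX hδ hT) h.continuous h.controlled

/-- A solution is, up to the constant z₀, its own rough integral, so the derivative of the integral
on a jump interval is the flow equation. -/
theorem SolvesRDE.isTimeStretch (hf : ContDiff ℝ 2 f)
    (hX : IsCadlagGeometric p T X) (hδ : IsStretchLength T X δ) {z₀ : E e}
    {Zt : ℝ → E e} (h : SolvesRDE p (stretchedLength T X δ) f (stretched T X δ) z₀ Zt) :
    IsTimeStretch T f X δ (fun t => Zt (timeChange T X δ t)) Zt := by
  refine ⟨fun t _ => rfl, fun t ht => tendsto_comp_timeChange_left hδ h.continuous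
    (fun _ _ => rfl) ht.1, fun t ht r hr => ?_⟩
  have hsub := segment_subset hδ (jumpTimes_subset ht)
  have := hasDerivWithinAt_integral_segment hf hX hδ ht (I := fun r => Zt r - z₀)
    (h.continuous.mono hsub) (fun u v hu huv hv =>
      MRSLim.sub (hsub ⟨hu, huv.trans hv⟩).1 (h.equation u (hsub ⟨hu, huv.trans hv⟩))
        (h.equation v (hsub ⟨hu.trans huv, hv⟩))) r hr
  simpa using this.add_const z₀

theorem SolvesRDE.solvesCanonical (hp : 2 ≤ p) (hp' : p < 3) (hf : ContDiff ℝ 2 f)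
    (hX : IsCadlagGeometric p T X) (hδ : IsStretchLength T X δ) (hT : 0 < T) {z₀ : E e}
    {Z Zt : ℝ → E e} (h : SolvesRDE p (stretchedLength T X δ) f (stretched T X δ) z₀ Zt)
    (hst : IsTimeStretch T f X δ Z Zt) : SolvesCanonical p T f X z₀ Z := by
  have hleft : ∀ t ∈ Ioc 0 T, Function.leftLim Z t = Zt (timeChangeLeft T X δ t) := fun t ht =>
    leftLim_eq_of_tendsto (tendsto_comp_timeChange_left hδ h.continuous hst.agree ht)
  have h0 : Z 0 = z₀ := by
    rw [← hst.agree 0 ⟨le_rfl, hT.le⟩, timeChange_zero, h.init]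
  have hag : ∀ s t, 0 ≤ s → s ≤ t → t ≤ T → Zt (timeChange T X δ s) = Z s ∧
      Zt (timeChange T X δ t) = Z t := fun s t h1 h2 h3 =>
    ⟨hst.agree s ⟨h1, h2.trans h3⟩, hst.agree t ⟨h1.trans h2, h3⟩⟩
  -- The endpoint of the flow at time s is Z_s itself, so `Z` serves as Φ; at times without a jump
  -- the field is zero and the flow constant.
  refine ⟨h0, cadlagOn_comp_timeChange hδ h.continuous hst.agree, ⟨?_, ?_, ?_⟩, Z,
    fun s hs => ?_, fun t ht => ?_⟩
  · refine h.controlled.pvar.comp_timeChange hδ fun s t h1 h2 h3 => ?_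
    simp only [incr, (hag s t h1 h2 h3).1, (hag s t h1 h2 h3).2]
  · refine h.controlled.pvar'.comp_timeChange hδ fun s t h1 h2 h3 => ?_
    simp only [incr, (hag s t h1 h2 h3).1, (hag s t h1 h2 h3).2]
  · refine h.controlled.remainder.comp_timeChange hδ fun s t h1 h2 h3 => ?_
    have := congrArg Prod.fst (stretched_inc_timeChange hX hδ h1 h2 h3)
    simp only [RoughData.inc] at this
    rw [this]
    simp only [incr, (hag s t h1 h2 h3).1, (hag s t h1 h2 h3).2]
  · rw [hleft s hs]
    by_cases hJ : s ∈ X.jumpTimes T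
    · have hgap := timeChange_sub_left hδ hJ
      refine ⟨fun θ => Zt (timeChangeLeft T X δ s + θ * δ s), by simp, ?_,
        hasDerivWithinAt_unscale (hδ.1 s hJ) hgap (hst.flow s hJ)⟩
      simp only [one_mul]
      rw [← hgap, add_sub_cancel, hst.agree s ⟨hs.1.le, hs.2⟩]
    · rw [timeChange_eq_left hJ, hst.agree s ⟨hs.1.le, hs.2⟩, jump_eq_zero hs hJ]
      refine ⟨fun _ => Z s, rfl, rfl, fun θ _ => ?_⟩
      rw [jumpField_zero]
      exact hasDerivWithinAt_const _ _ _
  · obtain ⟨F, hF⟩ := h.sewable hp hp' hf hX hδ hT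
    obtain ⟨S, hS, hlim⟩ := exists_hasSum_rrsLim_integral hf hX hδ hT h.continuous hF
      (I := fun r => Zt r - z₀) h.equation hst.agree ht
    refine ⟨_, S, hlim, ?_, ?_⟩
    · refine hasSum_of_forall_eq (fun s => ?_) hS
      have hs : (s : ℝ) ∈ Ioc 0 T := ⟨s.2.1, s.2.2.trans ht.2⟩
      rw [hleft s hs, field_apply, hst.agree s ⟨hs.1.le, hs.2⟩]
      abel
    · simp only [h.init, hst.agree t ht]
      abel

end StretchedIntegral

/-! ### Jumps, existence, uniqueness and continuity of time-stretched versions -/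

section Canonical

variable {d e : ℕ} {p T : ℝ} {X : RoughData d} {δ : ℝ → ℝ} {f : E e → (E d →L[ℝ] E e)}

theorem tendsto_clm_apply {α V W : Type*} [NormedAddCommGroup V] [NormedSpace ℝ V]
    [NormedAddCommGroup W] [NormedSpace ℝ W] {l : Filter α} {φ : α → V →L[ℝ] W} {x : α → V}
    {φ₀ : V →L[ℝ] W} {x₀ : V} (hφ : Tendsto φ l (𝓝 φ₀)) (hx : Tendsto x l (𝓝 x₀)) :
    Tendsto (fun a => φ a (x a)) l (𝓝 (φ₀ x₀)) :=
  ((isBoundedBilinearMap_apply (𝕜 := ℝ) (E := V) (F := W)).continuous.tendsto (φ₀, x₀)).comp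
    (hφ.prodMk_nhds hx)

/-- In finite dimension summability is absolute, so dominated convergence applies, and just before t
only the term at t is missing. -/
theorem tendsto_hasSum_Ioc {V : Type*} [NormedAddCommGroup V] [NormedSpace ℝ V]
    [FiniteDimensional ℝ V] {g S : ℝ → V} {t : ℝ} (ht : 0 < t)
    (hS : ∀ s ∈ Ioc 0 t, HasSum (fun r : Ioc 0 s => g r) (S s)) :
    Tendsto S (𝓝[<] t) (𝓝 (S t - g t)) := by
  have : CompleteSpace V := FiniteDimensional.complete ℝ V
  have hS' : ∀ s ∈ Ioc 0 t, HasSum ((Ioc 0 s).indicator g) (S s) := fun s hs =>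
    hasSum_subtype_iff_indicator.1 (hS s hs)
  have ht' : t ∈ Ioc 0 t := ⟨ht, le_rfl⟩
  have hlim : HasSum ((Ioo 0 t).indicator g) (S t - g t) := by
    have h1 : HasSum (({t} : Set ℝ).indicator g) (g t) := by
      have := hasSum_single (f := ({t} : Set ℝ).indicator g) t fun r hr =>
        indicator_of_notMem (by simpa using hr) g
      rwa [indicator_of_mem (mem_singleton t)] at this
    refine hasSum_of_forall_eq (fun r => ?_) ((hS' t ht').sub h1)
    by_cases hr : r = t
    · subst hr; simp [ht]
    · by_cases h2 : r ∈ Ioo 0 t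
      · have h3 : r ∈ Ioc 0 t := Ioo_subset_Ioc_self h2
        simp [indicator_of_mem h2, indicator_of_mem h3, hr]
      · have h3 : r ∉ Ioc 0 t := fun h3 => h2 ⟨h3.1, lt_of_le_of_ne h3.2 hr⟩
        simp [indicator_of_notMem h2, indicator_of_notMem h3, hr]
  rw [← hlim.tsum_eq]
  have hbound : Summable fun r => ‖(Ioc 0 t).indicator g r‖ := (hS' t ht').summable.norm
  have hdom := tendsto_tsum_of_dominated_convergence (𝓕 := 𝓝[<] t)
    (f := fun s r => (Ioc 0 s).indicator g r) (g := (Ioo 0 t).indicator g) hbound (fun r => ?_) ?_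
  · refine hdom.congr' ?_
    filter_upwards [Ioo_mem_nhdsLT ht] with s hs
    exact (hS' s ⟨hs.1, hs.2.le⟩).tsum_eq
  · refine tendsto_const_nhds.congr' ?_
    by_cases hr : r < t
    · filter_upwards [nhdsWithin_le_nhds (lt_mem_nhds hr)] with s hs
      have : r ∈ Ioo 0 t ↔ r ∈ Ioc 0 s :=
        ⟨fun h => ⟨h.1, le_of_lt hs⟩, fun h => ⟨h.1, hr⟩⟩
      by_cases h : r ∈ Ioc 0 s
      · rw [indicator_of_mem (this.2 h), indicator_of_mem h]
      · rw [indicator_of_notMem (mt this.1 h), indicator_of_notMem h]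
    · filter_upwards [self_mem_nhdsWithin] with s hs
      have m1 : r ∉ Ioo 0 t := fun h => hr h.2
      have m2 : r ∉ Ioc 0 s := fun h => hr (h.2.trans_lt hs)
      rw [indicator_of_notMem m1, indicator_of_notMem m2]
  · filter_upwards [self_mem_nhdsWithin] with s hs r
    exact norm_indicator_le_of_subset (Ioc_subset_Ioc_right (le_of_lt hs)) g r

/-- Solutions of the canonical equation jump along the flows. -/
theorem SolvesCanonical.exists_flow (hf : ContDiff ℝ 2 f) (hX : IsCadlagGeometric p T X)
    {z₀ : E e} {Z : ℝ → E e} (h : SolvesCanonical p T f X z₀ Z) :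
    (∀ s ∈ Ioc 0 T, IsTimeOneFlow (jumpField f (X.jump s)) (Function.leftLim Z s) (Z s)) ∧
    ∀ t ∈ Icc 0 T, ∃ I S : E e,
      RRSLim 0 t (roughGerm f X Z) I ∧
      HasSum (fun s : Ioc 0 t => Z s - Function.leftLim Z s
        - field f (Function.leftLim Z s) (X.jump s)) S ∧
      Z t = z₀ + I + S := by
  obtain ⟨Φ, hΦ, heq⟩ := h.equation
  choose! I S hI hS hZ using heq
  set g : ℝ → E e := fun s => Φ s - Function.leftLim Z s - f (Function.leftLim Z s) (X.jump s).1
    - derivTerm f (Function.leftLim Z s) (X.jump s).2 with hg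
  have hgf : ∀ s, g s = Φ s - Function.leftLim Z s - field f (Function.leftLim Z s) (X.jump s) := by
    intro s
    simp only [hg, field_apply]
    abel
  -- Passing to the left limit at t removes f(Z_{t-}) ΔX_t + f'f(Z_{t-}) Δ𝕏_t from the integral and
  -- `g t` from the sum. Together these two make up Φ_t - Z_{t-}, which must equal Z_t - Z_{t-}.
  have key : ∀ t ∈ Ioc 0 T, Φ t = Z t := by
    intro t ht
    have hev : ∀ᶠ s in 𝓝[<] t, s ∈ Icc 0 T := by
      filter_upwards [Ioo_mem_nhdsLT ht.1] with s hs
      exact ⟨hs.1.le, hs.2.le.trans ht.2⟩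
    have hZlim := h.cadlag.tendsto_leftLim ht
    have hSlim : Tendsto S (𝓝[<] t) (𝓝 (S t - g t)) :=
      tendsto_hasSum_Ioc (g := g) ht.1 fun s hs => hS s ⟨hs.1.le, hs.2.trans ht.2⟩
    have hΞ : Tendsto (fun s => roughGerm f X Z s t) (𝓝[<] t)
        (𝓝 (field f (Function.leftLim Z t) (X.jump t))) := by
      simp only [roughGerm_eq_field]
      have hfl : Tendsto (fun s => field f (Z s)) (𝓝[<] t) (𝓝 (field f (Function.leftLim Z t))) :=
        ((contDiff_field hf).continuous.tendsto _).comp hZlim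
      exact tendsto_clm_apply hfl (hX.tendsto_jump ht)
    have herr : Tendsto (fun s => I t - I s - roughGerm f X Z s t) (𝓝[<] t) (𝓝 0) := by
      rw [Metric.tendsto_nhds]
      intro ε hε
      obtain ⟨s₀, hs₀, hb⟩ := (hI t ⟨ht.1.le, ht.2⟩).exists_near_left ht.1 (half_pos hε)
      filter_upwards [Ioo_mem_nhdsLT hs₀.2, hev] with s hs hsT
      rw [dist_zero_right]
      exact (hb s hs _ (hI s hsT)).trans_lt (half_lt_self hε)
    have hlim : Tendsto Z (𝓝[<] t) (𝓝 (z₀ + (I t - (0 + field f (Function.leftLim Z t)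
        (X.jump t))) + (S t - g t))) := by
      refine ((tendsto_const_nhds.add (tendsto_const_nhds.sub (herr.add hΞ))).add hSlim).congr' ?_
      filter_upwards [hev] with s hs
      rw [hZ s hs]
      abel
    have e1 := tendsto_nhds_unique hZlim hlim
    have e2 := hZ t ⟨ht.1.le, ht.2⟩
    rw [hgf] at e1
    have e3 : Z t - Φ t = z₀ + (I t - (0 + field f (Function.leftLim Z t) (X.jump t))) +
        (S t - (Φ t - Function.leftLim Z t - field f (Function.leftLim Z t) (X.jump t))) -
          Function.leftLim Z t := by
      rw [e2]; abel
    rw [sub_eq_zero.2 e1.symm] at e3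
    exact (sub_eq_zero.1 e3).symm
  refine ⟨fun s hs => key s hs ▸ hΦ s hs, fun t ht => ⟨I t, S t, hI t ht, ?_, hZ t ht⟩⟩
  refine hasSum_of_forall_eq (fun s => ?_) (hS t ht)
  rw [← key s ⟨s.2.1, s.2.2.trans ht.2⟩, ← hgf]

theorem IsTimeOneFlow.eq_of_zero {x x' : E e} (h : IsTimeOneFlow (jumpField f 0) x x') :
    x' = x := by
  obtain ⟨y, h0, h1, hy⟩ := h
  have hz : jumpField f 0 = fun _ => 0 := funext jumpField_zero
  rw [hz] at hy
  have := ode_unique (g := fun _ => (0 : E e)) contDiff_const hy (z := fun _ => x)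
    (fun r _ => hasDerivWithinAt_const _ _ _) h0 (right_mem_Icc.2 zero_le_one)
  rw [← h1, this]

/-- The field `start` covers only jump times of the driver; elsewhere the flow is trivial, which
forces Z to have no jump either. -/
theorem SolvesCanonical.tendsto_left (hf : ContDiff ℝ 2 f) (hX : IsCadlagGeometric p T X)
    {z₀ : E e} {Z Zt : ℝ → E e} (h : SolvesCanonical p T f X z₀ Z)
    (hst : IsTimeStretch T f X δ Z Zt) {t : ℝ} (ht : t ∈ Ioc 0 T) :
    Tendsto Z (𝓝[<] t) (𝓝 (Zt (timeChangeLeft T X δ t))) := by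
  by_cases hJ : t ∈ X.jumpTimes T
  · exact hst.start t hJ
  · have h1 := h.cadlag.tendsto_leftLim ht
    have h2 := (h.exists_flow hf hX).1 t ht
    rw [jump_eq_zero ht hJ] at h2
    rwa [← h2.eq_of_zero, ← hst.agree t ⟨ht.1.le, ht.2⟩, ← timeChange_eq_left hJ] at h1

/-- A jump is a limit of products x⁻¹ ⊗ y of two nearby values of the path, and this product is the
identity at x = y = l. -/
theorem exists_nhds_jump_small (hX : IsCadlagGeometric p T X) (l : T2 d) (L : ℝ) {η : ℝ}
    (hη : 0 < η) : ∃ U ∈ 𝓝 l, ∀ a b, 0 ≤ a → (∀ s ∈ Ioo a b, s ≤ T → X.inc 0 s ∈ U) →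
      ∀ s ∈ Ioo a b, s ≤ T → L * ‖tlog (X.jump s)‖ < η := by
  have hc : Continuous fun x : T2 d × T2 d => L * ‖tlog (tmul (tinv x.1) x.2)‖ :=
    continuous_const.mul (continuous_tlog.comp (continuous_tmul.comp
      ((continuous_tinv.comp continuous_fst).prodMk continuous_snd))).norm
  have h0 : L * ‖tlog (tmul (tinv l) l)‖ = 0 := by
    rw [tinv_tmul_self, tlog_zero, norm_zero, mul_zero]
  have hmem : {x : T2 d × T2 d | L * ‖tlog (tmul (tinv x.1) x.2)‖ < η / 2} ∈ 𝓝 (l, l) :=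
    (hc.tendsto (l, l)).eventually (gt_mem_nhds (by simp only [h0]; positivity))
  rw [nhds_prod_eq, mem_prod_self_iff] at hmem
  obtain ⟨U, hU, hsub⟩ := hmem
  refine ⟨U, hU, fun a b ha hab s hs hsT => ?_⟩
  have hs0 : s ∈ Ioc 0 T := ⟨ha.trans_lt hs.1, hsT⟩
  have hlim : Tendsto (fun s' => L * ‖tlog (X.inc s' s)‖) (𝓝[<] s)
      (𝓝 (L * ‖tlog (X.jump s)‖)) :=
    ((continuous_tlog.tendsto _).comp (hX.tendsto_jump hs0)).norm.const_mul L
  refine (le_of_tendsto hlim ?_).trans_lt (half_lt_self hη)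
  filter_upwards [Ioo_mem_nhdsLT hs.1] with s' hs'
  rw [hX.rough.inc_eq (ha.trans hs'.1.le) hs'.2.le hsT]
  have := @hsub (X.inc 0 s', X.inc 0 s) ⟨hab s' ⟨hs'.1, hs'.2.trans hs.2⟩ (hs'.2.le.trans hsT),
    hab s hs hsT⟩
  exact le_of_lt this

/-- Close to a given time, on either side, the jumps of the driver are small, so the inserted flow
pieces stay near their starting points Z_{s-}, which are themselves near the one-sided limit of Z.
-/
theorem SolvesCanonical.continuousOn_stretch (hp : 0 < p) (hf : ContDiff ℝ 2 f)
    (hX : IsCadlagGeometric p T X) (hδ : IsStretchLength T X δ) (hT : 0 < T)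
    {z₀ : E e} {Z Zt : ℝ → E e} (h : SolvesCanonical p T f X z₀ Z)
    (hst : IsTimeStretch T f X δ Z Zt) :
    ContinuousOn Zt (Icc 0 (stretchedLength T X δ)) := by
  obtain ⟨F, hF⟩ := h.controlled.exists_controlBound hp
  obtain ⟨ρ, hρ⟩ := hF.exists_mem_closedBall hp
  obtain ⟨L, hL⟩ := exists_fieldBounds hf (ρ + 1)
  have hZl : ∀ t ∈ Ioc 0 T, Tendsto Z (𝓝[<] t) (𝓝 (Zt (timeChangeLeft T X δ t))) := fun t ht =>
    h.tendsto_left hf hX hst ht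
  have hZin : ∀ t ∈ Ioc 0 T, ∀ (a : ℝ) (l : E e) (r : ℝ), 0 ≤ a → a < t →
      (∀ s ∈ Ioo a t, Z s ∈ Metric.closedBall l r) →
      Zt (timeChangeLeft T X δ t) ∈ Metric.closedBall l r := by
    intro t ht a l r ha hat hs
    refine Metric.isClosed_closedBall.mem_of_tendsto (hZl t ht) ?_
    filter_upwards [Ioo_mem_nhdsLT hat] with s hs'
    exact hs s hs'
  -- The speed carries a factor `(δ s)⁻¹` and the interval has length `δ s`, so the displacement
  -- bound does not depend on δ. The condition `η ≤ 1` keeps the flow in the ball of radius `ρ + 1`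
  -- where `L` is valid.
  have hosc : ∀ s ∈ Ioc 0 T, ∀ η, L * ‖tlog (X.jump s)‖ < η → η ≤ 1 →
      ∀ r ∈ Icc (timeChangeLeft T X δ s) (timeChange T X δ s),
        ‖Zt r - Zt (timeChangeLeft T X δ s)‖ ≤ η := by
    intro s hs η hη hη1 r hr
    have hη0 : 0 ≤ η := (mul_nonneg hL.pos (norm_nonneg _)).trans hη.le
    by_cases hJ : s ∈ X.jumpTimes T
    · have hδ0 := hδ.1 s hJ
      have hgap := timeChange_sub_left hδ hJ
      have := norm_sub_le_of_small_field (m := (δ s)⁻¹ * (L * ‖tlog (X.jump s)‖))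
        (m' := (δ s)⁻¹ * η) (ρ := ρ) (g := fun z => (δ s)⁻¹ • jumpField f (X.jump s) z)
        (mul_lt_mul_of_pos_left hη (inv_pos.2 hδ0))
        (by rw [hgap, mul_comm, mul_inv_cancel_left₀ hδ0.ne']; exact hη1)
        (mul_nonneg (inv_nonneg.2 hδ0.le) hη0)
        (mem_closedBall_zero_iff.1 (hZin s hs 0 0 ρ le_rfl hs.1 fun s' hs' =>
          hρ s' ⟨hs'.1.le, hs'.2.le.trans hs.2⟩))
        (fun z hz => by
          rw [jumpField_eq_field hf (hX.jump_mem hs), norm_smul,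
            Real.norm_of_nonneg (inv_nonneg.2 hδ0.le)]
          exact mul_le_mul_of_nonneg_left ((ContinuousLinearMap.le_opNorm _ _).trans
            (mul_le_mul_of_nonneg_right (hL.norm_field z hz) (norm_nonneg _)))
            (inv_nonneg.2 hδ0.le))
        (hst.flow s hJ) r hr
      refine this.trans ?_
      have h1 : r - timeChangeLeft T X δ s ≤ δ s := by linarith [hr.2]
      calc (δ s)⁻¹ * η * (r - timeChangeLeft T X δ s) ≤ (δ s)⁻¹ * η * δ s :=
            mul_le_mul_of_nonneg_left h1 (mul_nonneg (inv_nonneg.2 hδ0.le) hη0)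
        _ = η := by rw [mul_comm, mul_inv_cancel_left₀ hδ0.ne']
    · rw [timeChange_eq_left hJ] at hr ⊢
      rw [le_antisymm hr.2 hr.1, sub_self, norm_zero]
      exact hη0
  have hnear : ∀ (l : E e) (x : T2 d) (ε : ℝ), 0 < ε → ∃ U ∈ 𝓝 x, ∀ a b, 0 ≤ a →
      (∀ s ∈ Ioo a b, s ≤ T → X.inc 0 s ∈ U) →
      (∀ s ∈ Ioo a b, s ≤ T → Z s ∈ Metric.closedBall l (ε / 3)) →
      ∀ s ∈ Ioo a b, s ≤ T → ∀ r ∈ Icc (timeChangeLeft T X δ s) (timeChange T X δ s),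
        dist (Zt r) l < ε := by
    intro l x ε hε
    obtain ⟨U, hU, hU'⟩ := exists_nhds_jump_small hX x L
      (show 0 < min 1 (ε / 3) by positivity)
    refine ⟨U, hU, fun a b ha hab hZab s hs hsT r hr => ?_⟩
    have hs0 : s ∈ Ioc 0 T := ⟨ha.trans_lt hs.1, hsT⟩
    have h1 := hosc s hs0 _ (hU' a b ha hab s hs hsT) (min_le_left _ _) r hr
    have h2 : dist (Zt (timeChangeLeft T X δ s)) l ≤ ε / 3 :=
      hZin s hs0 a l (ε / 3) ha hs.1 fun s' hs' =>
        hZab s' ⟨hs'.1, hs'.2.trans hs.2⟩ (hs'.2.le.trans hsT)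
    rw [← dist_eq_norm] at h1
    have h3 := dist_triangle (Zt r) (Zt (timeChangeLeft T X δ s)) l
    have h4 := min_le_right 1 (ε / 3)
    linarith
  refine continuousOn_stretched hδ hT (fun t ht r hr => (hst.flow t ht r hr).continuousWithinAt)
    (fun t ht ε hε => ?_) fun t ht ε hε => ?_
  · rw [hst.agree t ⟨ht.1, ht.2.le⟩]
    obtain ⟨U, hU, hb⟩ := hnear (Z t) (X.inc 0 t) ε hε
    have h1 := ((hX.cadlag.1 t ht).tendsto.mono_left
      (nhdsWithin_mono _ Ioi_subset_Ici_self)).eventually hU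
    have h2 := ((h.cadlag.1 t ht).tendsto.mono_left
      (nhdsWithin_mono _ Ioi_subset_Ici_self)).eventually
        (Metric.closedBall_mem_nhds (Z t) (show 0 < ε / 3 by positivity))
    obtain ⟨b, hbt, hb'⟩ := mem_nhdsGT_iff_exists_Ioo_subset.1 (h1.and h2)
    exact ⟨b, hbt, hb t b ht.1 (fun s hs _ => (hb' hs).1) fun s hs _ => (hb' hs).2⟩
  · obtain ⟨U, hU, hb⟩ := hnear (Zt (timeChangeLeft T X δ t)) (Function.leftLim (X.inc 0) t) ε hε
    have h1 := (hX.cadlag.tendsto_leftLim ht).eventually hU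
    have h2 := (hZl t ht).eventually
        (Metric.closedBall_mem_nhds _ (show 0 < ε / 3 by positivity))
    obtain ⟨a, hat, ha'⟩ := mem_nhdsLT_iff_exists_Ioo_subset.1 (h1.and h2)
    have hsub : ∀ s ∈ Ioo (max a 0) t, s ∈ Ioo a t := fun s hs =>
      ⟨(le_max_left _ _).trans_lt hs.1, hs.2⟩
    refine ⟨max a 0, max_lt hat ht.1, fun s hs _ => ?_⟩
    exact hb (max a 0) t (le_max_right _ _) (fun s hs _ => (ha' (hsub s hs)).1)
      (fun s hs _ => (ha' (hsub s hs)).2) s hs (hs.2.le.trans ht.2)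

theorem SolvesCanonical.exists_isTimeStretch (hf : ContDiff ℝ 2 f)
    (hX : IsCadlagGeometric p T X) (hδ : IsStretchLength T X δ)
    {z₀ : E e} {Z : ℝ → E e} (h : SolvesCanonical p T f X z₀ Z) :
    ∃ Zt, IsTimeStretch T f X δ Z Zt := by
  classical
  choose! y hy0 hy1 hy using (h.exists_flow hf hX).1
  set Zt : ℝ → E e := fun r => if originalTime T X δ r ∈ X.jumpTimes T then
    y (originalTime T X δ r) ((r - timeChangeLeft T X δ (originalTime T X δ r)) /
      δ (originalTime T X δ r)) else Z (originalTime T X δ r) with hZt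
  have hseg : ∀ t ∈ X.jumpTimes T, ∀ r ∈ Icc (timeChangeLeft T X δ t) (timeChange T X δ t),
      Zt r = y t ((r - timeChangeLeft T X δ t) / δ t) := by
    intro t ht r hr
    have e := originalTime_eq hδ (jumpTimes_subset ht) hr
    simp only [hZt, e, if_pos ht]
  refine ⟨Zt, fun t ht => ?_, fun t ht => ?_, fun t ht r hr => ?_⟩
  · by_cases hJ : t ∈ X.jumpTimes T
    · rw [hseg t hJ _ ⟨timeChangeLeft_le hδ t, le_rfl⟩, timeChange_sub_left hδ hJ,
        div_self (hδ.1 t hJ).ne', hy1 t hJ.1]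
    · have e := originalTime_eq hδ ht ⟨timeChangeLeft_le hδ t, le_rfl⟩
      simp only [hZt, e, if_neg hJ]
  · rw [hseg t ht _ ⟨le_rfl, timeChangeLeft_le hδ t⟩, sub_self, zero_div, hy0 t ht.1]
    exact h.cadlag.tendsto_leftLim ht.1
  · have := hasDerivWithinAt_rescale (hδ.1 t ht) (timeChange_sub_left hδ ht) (hy t ht.1) r hr
    rw [hseg t ht r hr]
    exact this.congr (hseg t ht) (hseg t ht r hr)

theorem IsTimeStretch.unique (hf : ContDiff ℝ 2 f)
    (hX : IsCadlagGeometric p T X) (hδ : IsStretchLength T X δ) (hT : 0 < T)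
    {Z Zt₁ Zt₂ : ℝ → E e} (h₁ : IsTimeStretch T f X δ Z Zt₁) (h₂ : IsTimeStretch T f X δ Z Zt₂) :
    EqOn Zt₁ Zt₂ (Icc 0 (stretchedLength T X δ)) := by
  intro r hr
  obtain ⟨t, ht, hrt⟩ := exists_originalTime hδ hT hr
  by_cases hJ : t ∈ X.jumpTimes T
  · exact ode_unique (contDiff_smul_jumpField hf hX hJ.1 (δ t)⁻¹) (h₁.flow t hJ) (h₂.flow t hJ)
      (tendsto_nhds_unique (h₁.start t hJ) (h₂.start t hJ)) hrt
  · rw [timeChange_eq_left hJ] at hrt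
    rw [le_antisymm hrt.2 hrt.1, h₁.agree t ht, h₂.agree t ht]

end Canonical

/-! ### From the canonical equation to the continuous equation -/

section Controlled

variable {d e : ℕ} {p T : ℝ} {X : RoughData d} {δ : ℝ → ℝ} {f : E e → (E d →L[ℝ] E e)}

theorem norm_snd_tlog_le (x : T2 d) : ‖(tlog x).2‖ ≤ ‖x.2‖ + ‖x.1‖ ^ 2 := by
  simp only [tlog]
  refine (norm_sub_le _ _).trans (add_le_add_right ?_ _)
  rw [norm_smul, norm_tensor, ← sq, Real.norm_of_nonneg (by norm_num)]
  nlinarith [sq_nonneg ‖x.1‖]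

/-- Bounds for a path that follows the flow of the jump field over the interval of a jump, in terms
of the size `x` of the jump. -/
theorem IsTimeStretch.segment_bounds (hf : ContDiff ℝ 2 f) (hX : IsCadlagGeometric p T X)
    (hδ : IsStretchLength T X δ) {Z Zt : ℝ → E e} (hst : IsTimeStretch T f X δ Z Zt) {ρ L : ℝ}
    (hL : FieldBounds f ρ L)
    (hρ : ∀ r ∈ Icc 0 (stretchedLength T X δ), Zt r ∈ Metric.closedBall (0 : E e) ρ)
    {t x B : ℝ} (ht : t ∈ X.jumpTimes T) (h1 : ‖(X.jump t).1‖ ≤ x) (h2 : ‖(X.jump t).2‖ ≤ x ^ 2)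
    (hxB : x ≤ B) {u v : ℝ} (hu : timeChangeLeft T X δ t ≤ u) (huv : u ≤ v)
    (hv : v ≤ timeChange T X δ t) :
    ‖incr Zt u v‖ ≤ L * (1 + 2 * B) * ((v - u) / δ t * x) ∧
    ‖incr Zt u v - f (Zt u) (incr (stretched T X δ).path u v)‖ ≤
      L * (L * (1 + 2 * B) + 2) * ((v - u) / δ t * x ^ 2) := by
  have hδ0 := hδ.1 t ht
  have hgap := timeChange_sub_left hδ ht
  have hx0 : 0 ≤ x := (norm_nonneg _).trans h1
  have hB0 : 0 ≤ B := hx0.trans hxB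
  have hL0 := hL.pos
  have hsub := segment_subset hδ (jumpTimes_subset ht)
  set l := tlog (X.jump t) with hl
  have hl1 : ‖l.1‖ ≤ x := h1
  have hl2 : ‖l.2‖ ≤ 2 * x ^ 2 := by
    have := norm_snd_tlog_le (X.jump t)
    have := pow_le_pow_left₀ (norm_nonneg _) h1 2
    linarith
  have hln : ‖l‖ ≤ (1 + 2 * B) * x := by
    have e1 : 0 ≤ B * x := mul_nonneg hB0 hx0
    have e2 : x ^ 2 ≤ B * x := by rw [sq]; exact mul_le_mul_of_nonneg_right hxB hx0
    exact max_le (by linarith) (by linarith)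
  have hder : ∀ w ∈ Icc u v, HasDerivWithinAt Zt ((δ t)⁻¹ • field f (Zt w) l) (Icc u v) w := by
    intro w hw
    have := hst.flow t ht w ⟨hu.trans hw.1, hw.2.trans hv⟩
    rw [jumpField_eq_field hf (hX.jump_mem ht.1)] at this
    exact this.mono (Icc_subset_Icc hu hv)
  have hball : ∀ w ∈ Icc u v, Zt w ∈ Metric.closedBall (0 : E e) ρ := fun w hw =>
    hρ w (hsub ⟨hu.trans hw.1, hw.2.trans hv⟩)
  have hδi : 0 ≤ (δ t)⁻¹ := inv_nonneg.2 hδ0.le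
  have hpath : ∀ w ∈ Icc u v, ‖Zt w - Zt u‖ ≤ L * (1 + 2 * B) * ((w - u) / δ t * x) := by
    intro w hw
    have := (convex_Icc u v).norm_image_sub_le_of_norm_hasDerivWithin_le
      (C := (δ t)⁻¹ * (L * ((1 + 2 * B) * x))) hder (fun w hw => by
        rw [norm_smul, Real.norm_of_nonneg hδi]
        exact mul_le_mul_of_nonneg_left ((ContinuousLinearMap.le_opNorm _ _).trans
          (mul_le_mul (hL.norm_field _ (hball w hw)) hln (norm_nonneg _) hL0)) hδi)
      (left_mem_Icc.2 huv) hw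
    rw [Real.norm_of_nonneg (sub_nonneg.2 hw.1)] at this
    refine this.trans_eq ?_
    ring
  refine ⟨hpath v ⟨huv, le_rfl⟩, ?_⟩
  have hinc : ∀ w ∈ Icc u v, incr (stretched T X δ).path u w = ((w - u) / δ t) • l.1 := by
    intro w hw
    exact (Prod.ext_iff.1 (stretched_inc_segment hX hδ ht ⟨hu, huv.trans hv⟩
      ⟨hu.trans hw.1, hw.2.trans hv⟩)).1
  -- After subtraction of the linear part, the derivative consists of the change of f along the flow
  -- times the first level, and of the second-level term. Both are of order x².
  have hder2 : ∀ w ∈ Icc u v, HasDerivWithinAt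
      (fun w => Zt w - ((w - u) / δ t) • f (Zt u) l.1)
      ((δ t)⁻¹ • (field f (Zt w) l - f (Zt u) l.1)) (Icc u v) w := by
    intro w hw
    have e1 : HasDerivWithinAt (fun w => (w - u) / δ t) (δ t)⁻¹ (Icc u v) w := by
      have := ((hasDerivWithinAt_id w (Icc u v)).sub_const u).div_const (δ t)
      rwa [one_div] at this
    rw [smul_sub]
    exact (hder w hw).sub (e1.smul_const _)
  have hbound : ∀ w ∈ Icc u v, ‖(δ t)⁻¹ • (field f (Zt w) l - f (Zt u) l.1)‖ ≤
      (δ t)⁻¹ * (L * (L * (1 + 2 * B) + 2) * x ^ 2) := by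
    intro w hw
    rw [norm_smul, Real.norm_of_nonneg hδi]
    refine mul_le_mul_of_nonneg_left ?_ hδi
    have hθ : (w - u) / δ t * x ≤ x := by
      refine mul_le_of_le_one_left hx0 ?_
      rw [div_le_one hδ0]
      linarith [hw.2]
    have n1 : ‖f (Zt w) - f (Zt u)‖ ≤ L * (L * (1 + 2 * B) * x) :=
      (hL.lip _ (hball u ⟨le_rfl, huv⟩) _ (hball w hw)).trans (mul_le_mul_of_nonneg_left
        ((hpath w hw).trans (mul_le_mul_of_nonneg_left hθ (by positivity))) hL0)
    have n2 : ‖derivTerm f (Zt w) l.2‖ ≤ L * (2 * x ^ 2) := by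
      rw [derivTerm_eq_field]
      refine (ContinuousLinearMap.le_opNorm _ _).trans
        (mul_le_mul (hL.norm_field _ (hball w hw)) ?_ (norm_nonneg _) hL0)
      rw [Prod.norm_def]
      simpa using hl2
    have e1 : field f (Zt w) l - f (Zt u) l.1 = (f (Zt w) - f (Zt u)) l.1 +
        derivTerm f (Zt w) l.2 := by
      rw [field_apply, sub_apply]; abel
    rw [e1]
    refine (norm_add_le _ _).trans ?_
    have n3 := (ContinuousLinearMap.le_opNorm (f (Zt w) - f (Zt u)) l.1).trans
      (mul_le_mul n1 hl1 (norm_nonneg _) (by positivity))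
    calc _ ≤ L * (L * (1 + 2 * B) * x) * x + L * (2 * x ^ 2) := add_le_add n3 n2
      _ = _ := by ring
  have := (convex_Icc u v).norm_image_sub_le_of_norm_hasDerivWithin_le hder2 hbound
    (left_mem_Icc.2 huv) (right_mem_Icc.2 huv)
  rw [Real.norm_of_nonneg (sub_nonneg.2 huv), sub_self, zero_div, zero_smul, sub_zero,
    sub_right_comm] at this
  rw [hinc v ⟨huv, le_rfl⟩, map_smul]
  refine this.trans_eq ?_
  ring

theorem IsTimeStretch.isControlled (hp : 2 ≤ p) (hf : ContDiff ℝ 2 f)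
    (hX : IsCadlagGeometric p T X) (hδ : IsStretchLength T X δ) (hT : 0 < T) {Z Zt : ℝ → E e}
    (hst : IsTimeStretch T f X δ Z Zt) (hc : IsControlled p T X Z fun t => f (Z t))
    (hZc : ContinuousOn Zt (Icc 0 (stretchedLength T X δ))) :
    IsControlled p (stretchedLength T X δ) (stretched T X δ) Zt fun r => f (Zt r) := by
  have hp0 : 0 < p := by linarith
  have hp1 : p⁻¹ ≤ 1 := inv_le_one_of_one_le₀ (by linarith)
  have hp2 : (p / 2)⁻¹ ≤ 1 := inv_le_one_of_one_le₀ (by linarith)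
  obtain ⟨F, hXF, hZF⟩ := exists_common_bound hp0 hX.rough hc
  obtain ⟨C₁, hC₁, hXt⟩ := hXF.stretched hp hX hδ hT
  have hm := stretchFun_monotoneOn hδ hT hXF.mono
  obtain ⟨ρ, hρ⟩ := isCompact_Icc.exists_bound_of_continuousOn hZc
  obtain ⟨L, hL⟩ := exists_fieldBounds hf ρ
  have hρ' : ∀ r ∈ Icc 0 (stretchedLength T X δ), Zt r ∈ Metric.closedBall (0 : E e) ρ :=
    fun r hr => mem_closedBall_zero_iff.2 (hρ r hr)
  have hL0 := hL.pos
  set B := |F T - F 0| ^ p⁻¹ with hB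
  have hB0 : 0 ≤ B := Real.rpow_nonneg (abs_nonneg _) _
  have hgap : ∀ t, 0 ≤ F t - Function.leftLim F t := fun t =>
    sub_nonneg.2 (hXF.mono.leftLim_le le_rfl)
  have hgapB : ∀ t ∈ Ioc 0 T, (F t - Function.leftLim F t) ^ p⁻¹ ≤ B := fun t ht =>
    Real.rpow_le_rpow (hgap t) ((sub_le_sub (hXF.mono ht.2)
      (hXF.mono.le_leftLim ht.1)).trans (le_abs_self _)) (inv_nonneg.2 hp0.le)
  have hθ : ∀ t ∈ X.jumpTimes T, ∀ u v, timeChangeLeft T X δ t ≤ u → u ≤ v →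
      v ≤ timeChange T X δ t → 0 ≤ (v - u) / δ t ∧ (v - u) / δ t ≤ 1 := by
    intro t ht u v hu huv hv
    have h0 := hδ.1 t ht
    refine ⟨div_nonneg (by linarith) h0.le, ?_⟩
    rw [div_le_one h0, ← timeChange_sub_left hδ ht]
    linarith
  have hagree : ∀ s t, 0 ≤ s → s ≤ t → t ≤ T →
      incr Zt (timeChange T X δ s) (timeChange T X δ t) = incr Z s t := fun s t h1 h2 h3 => by
    rw [incr, incr, hst.agree s ⟨h1, h2.trans h3⟩, hst.agree t ⟨h1.trans h2, h3⟩]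
  have hD : ∀ {u v}, 0 ≤ u → u ≤ v → v ≤ stretchedLength T X δ →
      stretchFun T X δ F u ≤ stretchFun T X δ F v := fun h1 h2 h3 =>
    hm ⟨h1, h2.trans h3⟩ ⟨h1.trans h2, h3⟩ h2
  set A₁ := 1 + L * (1 + 2 * B) with hA₁
  have hA₁0 : 0 ≤ A₁ := by positivity
  have P : ∀ u v, 0 ≤ u → u ≤ v → v ≤ stretchedLength T X δ →
      ‖incr Zt u v‖ ≤ (3 * A₁ + 2 * 0) * (stretchFun T X δ F v - stretchFun T X δ F u) ^ p⁻¹ := by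
    refine norm_le_stretchFun hδ hT hXF.mono (inv_pos.2 hp0) hA₁0 le_rfl ?_ ?_ ?_ ?_
    · intro s t h1 h2 h3
      rw [hagree s t h1 h2 h3]
      refine (hZF.path s t h1 h2 h3).trans (le_mul_of_one_le_left
        (Real.rpow_nonneg (sub_nonneg.2 (hXF.mono h2)) _) ?_)
      rw [hA₁]
      have : 0 ≤ L * (1 + 2 * B) := by positivity
      linarith
    · intro t ht u v hu huv hv
      obtain ⟨q0, q1⟩ := hθ t ht u v hu huv hv
      obtain ⟨j1, j2⟩ := hXF.jump_le hp0 hX ht.1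
      have h1 := (hst.segment_bounds hf hX hδ hL hρ' ht j1 j2 (hgapB t ht.1) hu huv hv).1
      have h2 := le_rpow_mul_of_le_one q0 q1 (hgap t) hp1
      refine h1.trans (mul_le_mul (by rw [hA₁]; linarith) h2 ?_ hA₁0)
      exact mul_nonneg q0 (Real.rpow_nonneg (hgap t) _)
    · intro u v w _ _ _ _
      rw [zero_mul, add_zero]
      have : incr Zt u w = incr Zt u v + incr Zt v w := by simp [incr]
      rw [this]
      exact norm_add_le _ _
    · intro u _
      exact hZc.sub continuousOn_const
  have Pf : ∀ u v, 0 ≤ u → u ≤ v → v ≤ stretchedLength T X δ →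
      ‖incr (fun r => f (Zt r)) u v‖ ≤
        L * (3 * A₁ + 2 * 0) * (stretchFun T X δ F v - stretchFun T X δ F u) ^ p⁻¹ := by
    intro u v h1 h2 h3
    have := hL.lip _ (hρ' u ⟨h1, h2.trans h3⟩) _ (hρ' v ⟨h1.trans h2, h3⟩)
    refine this.trans ?_
    rw [mul_assoc]
    exact mul_le_mul_of_nonneg_left (P u v h1 h2 h3) hL0
  set A₂ := 1 + L * (L * (1 + 2 * B) + 2) with hA₂
  have hA₂0 : 0 ≤ A₂ := by positivity
  have hK : 0 ≤ L * (3 * A₁ + 2 * 0) * C₁ := by positivity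
  have R : ∀ u v, 0 ≤ u → u ≤ v → v ≤ stretchedLength T X δ →
      ‖incr Zt u v - f (Zt u) (incr (stretched T X δ).path u v)‖ ≤
        (3 * A₂ + 2 * (L * (3 * A₁ + 2 * 0) * C₁)) *
          (stretchFun T X δ F v - stretchFun T X δ F u) ^ (p / 2)⁻¹ := by
    refine norm_le_stretchFun hδ hT hXF.mono (inv_pos.2 (half_pos hp0)) hA₂0 hK ?_ ?_ ?_ ?_
    · intro s t h1 h2 h3
      have e1 : incr (stretched T X δ).path (timeChange T X δ s) (timeChange T X δ t) =
          incr X.path s t := (Prod.ext_iff.1 (stretched_inc_timeChange hX hδ h1 h2 h3)).1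
      have h0 := sub_nonneg.2 (hXF.mono h2)
      rw [hagree s t h1 h2 h3, e1, hst.agree s ⟨h1, h2.trans h3⟩]
      have := hZF.remainder s t h1 h2 h3
      rw [← rpow_inv_half h0] at this
      refine this.trans (le_mul_of_one_le_left (Real.rpow_nonneg h0 _) ?_)
      rw [hA₂]
      have : 0 ≤ L * (L * (1 + 2 * B) + 2) := by positivity
      linarith
    · intro t ht u v hu huv hv
      obtain ⟨q0, q1⟩ := hθ t ht u v hu huv hv
      obtain ⟨j1, j2⟩ := hXF.jump_le hp0 hX ht.1
      have h1 := (hst.segment_bounds hf hX hδ hL hρ' ht j1 j2 (hgapB t ht.1) hu huv hv).2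
      have h2 := le_rpow_mul_of_le_one q0 q1 (hgap t) hp2
      rw [← rpow_inv_half (hgap t)] at h1
      refine h1.trans (mul_le_mul (by rw [hA₂]; linarith) h2 ?_ hA₂0)
      exact mul_nonneg q0 (Real.rpow_nonneg (hgap t) _)
    · intro u v w h1 h2 h3 h4
      -- The remainder fails to be additive by the increment of f(Z̃) applied to that of X̃, a
      -- product of two terms of order 1/p in the control; this fixes the constant K.
      have e1 : incr Zt u w - f (Zt u) (incr (stretched T X δ).path u w) =
          (incr Zt u v - f (Zt u) (incr (stretched T X δ).path u v)) +
          (incr Zt v w - f (Zt v) (incr (stretched T X δ).path v w)) +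
          (incr (fun r => f (Zt r)) u v) (incr (stretched T X δ).path v w) := by
        simp only [incr, map_sub, sub_apply]
        abel
      have guv := hD h1 h2 (h3.trans h4)
      have gvw := hD (h1.trans h2) h3 h4
      have n1 := Pf u v h1 h2 (h3.trans h4)
      have n2 := (hXt v w (h1.trans h2) h3 h4).1
      set y := (stretchFun T X δ F w - stretchFun T X δ F u) ^ p⁻¹ with hy
      have hy0 : 0 ≤ y := Real.rpow_nonneg (by linarith) _
      have n1' : ‖incr (fun r => f (Zt r)) u v‖ ≤ L * (3 * A₁ + 2 * 0) * y :=
        n1.trans (mul_le_mul_of_nonneg_left (Real.rpow_le_rpow (by linarith) (by linarith)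
          (inv_nonneg.2 hp0.le)) (by positivity))
      have n2' : ‖incr (stretched T X δ).path v w‖ ≤ C₁ * y :=
        n2.trans (mul_le_mul_of_nonneg_left (Real.rpow_le_rpow (by linarith) (by linarith)
          (inv_nonneg.2 hp0.le)) hC₁)
      rw [e1, rpow_inv_half (by linarith), ← hy]
      refine (norm_add₃_le).trans (add_le_add_right ?_ _)
      refine (ContinuousLinearMap.le_opNorm _ _).trans ((mul_le_mul n1' n2' (norm_nonneg _)
        (by positivity)).trans_eq ?_)
      ring
    · intro u _
      exact (hZc.sub continuousOn_const).sub ((f (Zt u)).continuous.comp_continuousOn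
        (continuousOn_stretched_inc hX hδ hT u).fst)
  exact ⟨finiteVar_of_norm_le hp0 (by positivity) hm P,
    finiteVar_of_norm_le hp0 (by positivity) hm Pf,
    finiteVar_of_norm_le (half_pos hp0) (by positivity) hm R⟩

/-- The integral I is constructed by sewing, independently of the equation, and then identified with
Z̃ - z₀. Over a jump interval the increments of both agree because the derivatives do. This makes
the jump sum in the decomposition of I the one in the canonical equation, which gives equality at
the points τ(t) and then on the jump intervals. -/
theorem SolvesCanonical.solvesRDE (hp : 2 ≤ p) (hp' : p < 3) (hf : ContDiff ℝ 2 f)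
    (hX : IsCadlagGeometric p T X) (hδ : IsStretchLength T X δ) (hT : 0 < T) {z₀ : E e}
    {Z Zt : ℝ → E e} (h : SolvesCanonical p T f X z₀ Z) (hst : IsTimeStretch T f X δ Z Zt) :
    SolvesRDE p (stretchedLength T X δ) f (stretched T X δ) z₀ Zt := by
  have hp0 : 0 < p := by linarith
  have hZc := h.continuousOn_stretch hp0 hf hX hδ hT hst
  have hc := hst.isControlled hp hf hX hδ hT h.controlled hZc
  obtain ⟨F, hF⟩ := sewable_roughGerm hp hp' hf (stretched_isRough hp hX hδ hT)
    (continuousOn_stretched_path hX hδ hT) hZc hc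
  obtain ⟨I, hI⟩ := hF.exists_integral
  obtain ⟨-, heq⟩ := h.exists_flow hf hX
  have hI0 : I 0 = 0 := integral_zero (hI 0 ⟨le_rfl, (stretchedLength_pos hδ hT).le⟩)
  have hleft : ∀ t ∈ Ioc 0 T, Function.leftLim Z t = Zt (timeChangeLeft T X δ t) := fun t ht =>
    leftLim_eq_of_tendsto (h.tendsto_left hf hX hst ht)
  have hseg : ∀ t ∈ Ioc 0 T, ∀ r ∈ Icc (timeChangeLeft T X δ t) (timeChange T X δ t),
      I r - I (timeChangeLeft T X δ t) = Zt r - Zt (timeChangeLeft T X δ t) := by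
    intro t ht r hr
    by_cases hJ : t ∈ X.jumpTimes T
    · have hsub := segment_subset hδ (jumpTimes_subset hJ)
      have hd := hasDerivWithinAt_integral_segment hf hX hδ hJ (hZc.mono hsub) (I := I)
        (fun u v hu huv hv => MRSLim.sub (hsub ⟨hu, huv.trans hv⟩).1
          (hI u (hsub ⟨hu, huv.trans hv⟩)) (hI v (hsub ⟨hu.trans huv, hv⟩)))
      have hd2 : ∀ w ∈ Icc (timeChangeLeft T X δ t) (timeChange T X δ t),
          HasDerivWithinAt (fun w => I w - Zt w) 0
            (Icc (timeChangeLeft T X δ t) (timeChange T X δ t)) w := by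
        intro w hw
        have h := (hd w hw).sub (hst.flow t hJ w hw)
        rw [sub_self] at h
        exact h
      have := (convex_Icc _ _).norm_image_sub_le_of_norm_hasDerivWithin_le (C := 0) hd2
        (fun w _ => by simp) (left_mem_Icc.2 (timeChangeLeft_le hδ t)) hr
      rw [zero_mul, norm_le_zero_iff, sub_sub_sub_comm] at this
      exact sub_eq_zero.1 this
    · rw [timeChange_eq_left hJ] at hr ⊢
      rw [le_antisymm hr.2 hr.1, sub_self, sub_self]
  have hIt : ∀ t ∈ Icc 0 T, I (timeChange T X δ t) = Zt (timeChange T X δ t) - z₀ := by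
    intro t ht
    obtain ⟨S, hS, hlim⟩ := exists_hasSum_rrsLim_integral hf hX hδ hT hZc hF hI hst.agree ht
    obtain ⟨I', S', hlim', hS', hZ⟩ := heq t ht
    have e1 := RRSLim.unique ht.1 hlim hlim'
    have e2 : S = S' := by
      refine hS.unique (hasSum_of_forall_eq (fun s => ?_) hS')
      have hs : (s : ℝ) ∈ Ioc 0 T := ⟨s.2.1, s.2.2.trans ht.2⟩
      rw [hseg s hs _ ⟨timeChangeLeft_le hδ s, le_rfl⟩, hleft s hs,
        hst.agree s ⟨hs.1.le, hs.2⟩]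
    rw [hst.agree t ht, hZ, ← e1, ← e2, hI0]
    abel
  have hIr : ∀ r ∈ Icc 0 (stretchedLength T X δ), I r = Zt r - z₀ := by
    intro r hr
    obtain ⟨t, ht, hrt⟩ := exists_originalTime hδ hT hr
    rcases ht.1.eq_or_lt with h0 | h0
    · rw [← h0, timeChangeLeft_zero, timeChange_zero] at hrt
      have := hIt 0 ⟨le_rfl, hT.le⟩
      rwa [timeChange_zero, ← le_antisymm hrt.2 hrt.1] at this
    · have a1 := hseg t ⟨h0, ht.2⟩ r hrt
      have a2 := hseg t ⟨h0, ht.2⟩ _ ⟨timeChangeLeft_le hδ t, le_rfl⟩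
      have a3 := hIt t ht
      have a4 : I r = (I r - I (timeChangeLeft T X δ t)) -
          (I (timeChange T X δ t) - I (timeChangeLeft T X δ t)) + I (timeChange T X δ t) := by abel
      rw [a4, a1, a2, a3]
      abel
  refine ⟨?_, hZc, hc, fun r hr => hIr r hr ▸ hI r hr⟩
  have := hst.agree 0 ⟨le_rfl, hT.le⟩
  rw [timeChange_zero] at this
  rw [this, h.init]

end Controlled

end CadlagRDE

end

theorem mainTheorem8 {d e : ℕ} (p T : ℝ) (hp : 2 ≤ p) (hp' : p < 3) (hT : 0 < T)
    (f : CadlagRDE.E e → (CadlagRDE.E d →L[ℝ] CadlagRDE.E e)) (hf : ContDiff ℝ 2 f)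
    (X : CadlagRDE.RoughData d) (hX : CadlagRDE.IsCadlagGeometric p T X)
    (δ : ℝ → ℝ) (hδ : CadlagRDE.IsStretchLength T X δ) (z₀ : CadlagRDE.E e) :
    -- the stretched path is a continuous geometric rough path on the stretched interval
    CadlagRDE.IsContinuousGeometric p (CadlagRDE.stretchedLength T X δ)
      (CadlagRDE.stretched T X δ) ∧
    -- the equivalence
    (∀ Z Zt : ℝ → CadlagRDE.E e, CadlagRDE.IsTimeStretch T f X δ Z Zt →
      (CadlagRDE.SolvesCanonical p T f X z₀ Z ↔
        CadlagRDE.SolvesRDE p (CadlagRDE.stretchedLength T X δ) f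
          (CadlagRDE.stretched T X δ) z₀ Zt)) ∧
    -- each solution of the canonical equation has a time-stretched version
    (∀ Z : ℝ → CadlagRDE.E e, CadlagRDE.SolvesCanonical p T f X z₀ Z →
      ∃ Zt, CadlagRDE.IsTimeStretch T f X δ Z Zt) ∧
    -- each solution of the continuous equation is a time-stretched version
    (∀ Zt : ℝ → CadlagRDE.E e,
      CadlagRDE.SolvesRDE p (CadlagRDE.stretchedLength T X δ) f
        (CadlagRDE.stretched T X δ) z₀ Zt →
      CadlagRDE.IsTimeStretch T f X δ (fun t => Zt (CadlagRDE.timeChange T X δ t)) Zt) ∧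
    -- time-stretched versions are unique
    (∀ Z Zt₁ Zt₂ : ℝ → CadlagRDE.E e,
      CadlagRDE.IsTimeStretch T f X δ Z Zt₁ → CadlagRDE.IsTimeStretch T f X δ Z Zt₂ →
      Set.EqOn Zt₁ Zt₂ (Set.Icc 0 (CadlagRDE.stretchedLength T X δ))) := by
  refine ⟨CadlagRDE.stretched_isContinuousGeometric hp hX hδ hT,
    fun Z Zt hst => ⟨fun h => h.solvesRDE hp hp' hf hX hδ hT hst,
      fun h => h.solvesCanonical hp hp' hf hX hδ hT hst⟩,
    fun Z h => h.exists_isTimeStretch hf hX hδ, fun Zt h => h.isTimeStretch hf hX hδ,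
    fun Z Zt₁ Zt₂ h₁ h₂ => h₁.unique hf hX hδ hT h₂⟩
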